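/- **Subtraction formula.** Let $P_1,\dots,P_m$ be nonzero real Laurent polynomials in $\alpha=(\alpha_1,\dots,\alpha_n)$ with non-negative coefficients, such that the Newton polytope $\mathcal P=\mathrm{Newt}(P_1\cdots P_m)\subset\mathbb R^n$ is $n$-dimensional. For $(\nu,c)\in\mathbb C^n\times\mathbb C^m$ consider the Euler integrand $$\mathcal I(\alpha)=\alpha^{\nu}\prod_{j=1}^m P_j(\alpha)^{c_j},\qquad \mathrm{Trop}\,\mathcal I(\rho)=\nu\cdot\rho+\sum_{j}c_j\,\mathrm{Trop}\,P_j(\rho),\quad \mathrm{Trop}\,P_j(\rho)=\max_{z\in \mathrm{Newt}P_j}\rho\cdot z ,$$ and let the exponents depend affinely on $\epsilon\in\mathbb C$: $(\nu,c)=(\nu,c)(\epsilon)=e_0+\epsilon e_1$. Let $\Sigma$ be the normal fan of $\mathcal P$, with cones $\sigma_F=\{\rho:\rho\cdot z$ is maximized over $\mathcal P$ at every point of $F\}$, $F$ a nonempty face. Choose one generator $\rho$ (of any normalization) for each one-dimensional cone of $\Sigma$; call these vectors the rays. Vectors are compatible if they lie in a common cone of $\Sigma$. Assume: * (logarithmic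 divergence) for each ray $\rho$, $\mathrm{Trop}\,\mathcal I(\rho)=a_\rho+O(\epsilon)$, where either $a_\rho=0$ (then $\rho$ is called divergent) or $\mathrm{Re}\,a_\rho<0$; * (regularization) for no ray $\rho$ is $\mathrm{Trop}\,\mathcal I(\rho)$ identically zero in $\epsilon$; * (geometric property) for each divergent ray $\rho$ there is given $w_\rho\in\mathbb R^n$ with $w_\rho\cdot\rho'=-\delta_{\rho,\rho'}$ for all divergent rays $\rho'$ compatible with $\rho$. Let $\Sigma^{\rm div}$ be the set of cones spanned by the (jointly) compatible sets of divergent rays, including $\{0\}$. For $\sigma\in\Sigma^{\rm div}$ let $\mathrm{Rays}\,\sigma$ be the set of rays lying in $\sigma$, let $\mathcal I|_\sigma$ be obtained from $\mathcal I$ by keeping in each $P_j$ only the monomials whose exponents maximize every $\rho\in\sigma$ over $\mathrm{Newt}\,P_j$, and put $$v_\sigma=\prod_{\rho\in\mathrm{Rays}\,\sigma}\Big(\frac1{1+\alpha^{w_\rho}}\Big)^{1-\mathrm{Trop}\,\mathcal I(\rho)},\qquad \mathcal I^{\rm ren}_\sigma=v_\sigma^{-1}\sum_{\sigma'\in\Sigma^{\rm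 div},\ \sigma'\supseteq\sigma}(-1)^{\dim\sigma'-\dim\sigma}\,v_{\sigma'}\,\mathcal I|_{\sigma'} .$$ Let $\rho^\sigma$ be the matrix with columns $\mathrm{Rays}\,\sigma$; choose $J_\sigma\subseteq\{1,\dots,n\}$ such that $J_\sigma^c$ has $|\mathrm{Rays}\,\sigma|$ elements and the minor $\det(\rho^\sigma_{J_\sigma^c})$ with rows $J_\sigma^c$ is non-zero. Let $\pi_\sigma$ keep the entries labelled by $J_\sigma$, and set $$u_\sigma=\sum_{\rho\in\mathrm{Rays}\,\sigma}\mathrm{Trop}\,\mathcal I(\rho)\,\pi_\sigma(w_\rho),\quad \mathrm{Vol}(\sigma)=\big|\det(\rho^\sigma_{J_\sigma^c})\big|\prod_{\rho\in\mathrm{Rays}\,\sigma}\big(-\mathrm{Trop}\,\mathcal I(\rho)\big)^{-1},\quad V_\sigma=\{\alpha_j>0,\ j\in J_\sigma;\ \alpha_i=1,\ i\in J_\sigma^c\}.$$ Then: 1. For every $\sigma\in\Sigma^{\rm div}$ the integrand $\alpha^{u_\sigma}\mathcal I^{\rm ren}_\sigma$ on $V_\sigma$ is locally finite with respect to $\frac{d\alpha}{\alpha}=\prod_{j\in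 J_\sigma}\frac{d\alpha_j}{\alpha_j}$: its integral converges absolutely for $\epsilon$ near $0$ and is analytic at $\epsilon=0$, and the Taylor coefficients of the integral at $\epsilon=0$ are the absolutely convergent integrals of the Taylor coefficients of the integrand. 2. Let $C\subset\mathbb C^n\times\mathbb C^m$ be the set of exponents for which $\int_{\mathbb R^n_+}\frac{d\alpha}{\alpha}\,\alpha^\nu\prod_j P_j^{c_j}$ converges absolutely. As a function of $(\nu,c)$ the integral continues meromorphically from $C$, which has nonempty interior, to a connected open set containing $C$ and $e_0$, and $e_0+\epsilon e_1$ is not a pole for small $\epsilon\ne0$. 3. For every such continuation (in particular for the one to all of $\mathbb C^n\times\mathbb C^m$) its value at $e_0+\epsilon e_1$, for all sufficiently small $\epsilon\neq0$ (where the continuation is regular), is $$\int_{\mathbb R^n_+}\frac{d\alpha}{\alpha}\,\mathcal I=\sum_{\sigma\in\Sigma^{\rm div}}\mathrm{Vol}(\sigma)\int_{V_\sigma}\frac{d\alpha}{\alpha}\,\alpha^{u_\sigma}\,\mathcal I^{\rm ren}_\sigma .$$ -/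

import Mathlib

open Filter Topology MeasureTheory Matrix

noncomputable section

namespace EulerSubtraction

open scoped Classical

/-! ### Cones, fans and Newton polytopes -/

/-- Real Laurent polynomials in `n` variables. -/
abbrev LaurentPoly (n : ℕ) : Type := AddMonoidAlgebra ℝ (Fin n → ℤ)

/-- An integer exponent vector seen as a point of `ℝⁿ`. -/
def expVec {n : ℕ} (k : Fin n → ℤ) : Fin n → ℝ := fun i => (k i : ℝ)

/-- The Newton polytope: the convex hull of the exponents that occur in `p`. -/
def newtonPolytope {n : ℕ} (p : LaurentPoly n) : Set (Fin n → ℝ) :=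
  convexHull ℝ (expVec '' {k | p.coeff k ≠ 0})

/-- The cone of all `ρ` such that `z ↦ ρ · z` is maximized over `K` at every point of `F`. -/
def normalCone {n : ℕ} (K F : Set (Fin n → ℝ)) : PointedCone ℝ (Fin n → ℝ) where
  carrier := {ρ | ∀ z ∈ F, ∀ y ∈ K, ρ ⬝ᵥ y ≤ ρ ⬝ᵥ z}
  add_mem' := by
    intro a b ha hb z hz y hy
    rw [add_dotProduct, add_dotProduct]
    exact add_le_add (ha z hz y hy) (hb z hz y hy)
  zero_mem' := by
    intro z _ y _
    simp
  smul_mem' := by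
    intro c a ha z hz y hy
    have h1 : (c • a) = (c : ℝ) • a := rfl
    rw [h1, smul_dotProduct, smul_dotProduct]
    exact mul_le_mul_of_nonneg_left (ha z hz y hy) c.2

/-- The normal fan of `K`: the cones `normalCone K F`, for `F` a nonempty face of `K`.
(All faces of a polytope, including the polytope itself, are exposed.) -/
def normalFan {n : ℕ} (K : Set (Fin n → ℝ)) : Set (PointedCone ℝ (Fin n → ℝ)) :=
  {σ | ∃ F : Set (Fin n → ℝ), F.Nonempty ∧ IsExposed ℝ K F ∧ σ = normalCone K F}

/-- The dimension of a cone. -/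
def coneDim {n : ℕ} (σ : PointedCone ℝ (Fin n → ℝ)) : ℕ :=
  Module.finrank ℝ (Submodule.span ℝ (σ : Set (Fin n → ℝ)))

/-- `R` consists of exactly one generator for each one-dimensional cone of `Σ`
(of arbitrary normalization). -/
def IsRaySystem {n : ℕ} (Sig : Set (PointedCone ℝ (Fin n → ℝ)))
    (R : Finset (Fin n → ℝ)) : Prop :=
  (∀ ρ ∈ R, ρ ≠ 0 ∧ PointedCone.hull ℝ {ρ} ∈ Sig) ∧
    ∀ σ ∈ Sig, coneDim σ = 1 → ∃! ρ, ρ ∈ R ∧ σ = PointedCone.hull ℝ {ρ}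

/-- A set of vectors is compatible with respect to `Σ` if some cone of `Σ` contains it. -/
def Compatible {n : ℕ} (Sig : Set (PointedCone ℝ (Fin n → ℝ))) (X : Set (Fin n → ℝ)) : Prop :=
  ∃ σ ∈ Sig, X ⊆ (σ : Set (Fin n → ℝ))

/-! ### Euler integrands -/

/-- The exponents `(ν, c)` of an Euler integrand. -/
abbrev Exponents (n m : ℕ) : Type := (Fin n → ℂ) × (Fin m → ℂ)

/-- The value of a Laurent polynomial at `α`. -/
def evalAt {n : ℕ} (p : LaurentPoly n) (α : Fin n → ℝ) : ℝ :=
  ∑ k ∈ p.coeff.support, p.coeff k * ∏ i, α i ^ k i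

/-- `Trop P (ρ)`, the maximum of `ρ · z` over the Newton polytope of `P`. -/
def tropPoly {n : ℕ} (p : LaurentPoly n) (ρ : Fin n → ℝ) : ℝ :=
  sSup ((fun z => ρ ⬝ᵥ z) '' newtonPolytope p)

/-- The initial form `P|_σ`: keep the monomials of `P` whose exponents lie on the face of
the Newton polytope at which every element of `σ` is maximized. -/
def initialForm {n : ℕ} (p : LaurentPoly n) (σ : PointedCone ℝ (Fin n → ℝ)) : LaurentPoly n :=
  AddMonoidAlgebra.ofCoeff
    (p.coeff.filter fun k => ∀ ρ ∈ σ, ρ ⬝ᵥ expVec k = tropPoly p ρ)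

/-- The Euler integrand `α ^ ν * ∏ j, P j (α) ^ c j`, for `α` with positive entries. -/
def integrand {n m : ℕ} (P : Fin m → LaurentPoly n) (e : Exponents n m) (α : Fin n → ℝ) : ℂ :=
  (∏ i, (α i : ℂ) ^ e.1 i) * ∏ j, (evalAt (P j) α : ℂ) ^ e.2 j

/-- `Trop I (ρ) = ν · ρ + ∑ j, c j * Trop (P j) (ρ)`. -/
def tropIntegrand {n m : ℕ} (P : Fin m → LaurentPoly n) (e : Exponents n m)
    (ρ : Fin n → ℝ) : ℂ :=
  ∑ i, e.1 i * (ρ i : ℂ) + ∑ j, e.2 j * (tropPoly (P j) ρ : ℂ)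

/-- The normal fan of the Newton polytope of `∏ j, P j`. -/
def integrandFan {n m : ℕ} (P : Fin m → LaurentPoly n) : Set (PointedCone ℝ (Fin n → ℝ)) :=
  normalFan (newtonPolytope (∏ j, P j))

/-- Exponents depending affinely on `ε`. -/
def affineExp {n m : ℕ} (e₀ e₁ : Exponents n m) (ε : ℂ) : Exponents n m := e₀ + ε • e₁

/-- The measure `dα/α = ∏ i, dα_i / α_i` on the positive orthant. -/
def logMeasure (ι : Type*) [Fintype ι] : Measure (ι → ℝ) :=
  Measure.pi fun _ =>
    (volume.restrict (Set.Ioi (0 : ℝ))).withDensity fun x => ENNReal.ofReal x⁻¹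

/-- The exponents for which the Euler integral converges (absolutely). -/
def convergenceDomain {n m : ℕ} (P : Fin m → LaurentPoly n) : Set (Exponents n m) :=
  {e | Integrable (integrand P e) (logMeasure (Fin n))}

/-- The Euler integral `∫ dα/α I`; only used for exponents in the convergence domain. -/
def eulerIntegral {n m : ℕ} (P : Fin m → LaurentPoly n) (e : Exponents n m) : ℂ :=
  ∫ α, integrand P e α ∂(logMeasure (Fin n))

/-- The function `F`, given on `C`, continues meromorphically to the connected open set `Ω`
as the function `G`, whose poles lie in `Z`: `G` is holomorphic on `Ω \ Z`, it agrees with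
`F` on `C`, and near each point of `Ω` it is a quotient `h / g` of holomorphic functions such
that `g` does not vanish identically and `Z` is contained in the zero set of `g`. -/
structure IsMeromorphicContinuation {E : Type*} [NormedAddCommGroup E] [NormedSpace ℂ E]
    (C : Set E) (F : E → ℂ) (Ω Z : Set E) (G : E → ℂ) : Prop where
  isOpen : IsOpen Ω
  isConnected : IsConnected Ω
  subset : C ⊆ Ω
  interior_nonempty : (interior C).Nonempty
  disjoint : Disjoint C Z
  isOpen_diff : IsOpen (Ω \ Z)
  analytic : AnalyticOnNhd ℂ G (Ω \ Z)
  eqOn : Set.EqOn G F C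
  quotient : ∀ p ∈ Ω, ∃ g h : E → ℂ, AnalyticAt ℂ g p ∧ AnalyticAt ℂ h p ∧
    (¬ ∀ᶠ q in 𝓝 p, g q = 0) ∧
    ∀ᶠ q in 𝓝 p, (q ∈ Z → g q = 0) ∧ (q ∉ Z → g q * G q = h q)

/-- Local finiteness: integration commutes with Taylor expansion in `ε` at `0`.
The integral converges for `ε` near `0` and is analytic at `0`, and its Taylor coefficients are
the (absolutely convergent) integrals of the Taylor coefficients of the integrand. -/
def LocallyFiniteFamily {X : Type*} [MeasurableSpace X] (μ : Measure X) (f : ℂ → X → ℂ) : Prop :=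
  (∀ᶠ ε in 𝓝 (0 : ℂ), Integrable (f ε) μ) ∧
  AnalyticAt ℂ (fun ε => ∫ x, f ε x ∂μ) 0 ∧
  (∀ᵐ x ∂μ, AnalyticAt ℂ (fun ε => f ε x) 0) ∧
  ∀ k : ℕ,
    Integrable (fun x => iteratedDeriv k (fun ε => f ε x) 0) μ ∧
    iteratedDeriv k (fun ε => ∫ x, f ε x ∂μ) 0 =
      ∫ x, iteratedDeriv k (fun ε => f ε x) 0 ∂μ

/-! ### The subtraction scheme -/

/-- The divergent rays of the family with exponents `e₀ + ε e₁`: those on which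
`Trop I = O(ε)`. -/
def divRays {n m : ℕ} (P : Fin m → LaurentPoly n) (e₀ : Exponents n m)
    (R : Finset (Fin n → ℝ)) : Finset (Fin n → ℝ) :=
  R.filter fun ρ => tropIntegrand P e₀ ρ = 0

/-- `I` is logarithmically divergent: on each ray either `Trop I = O(ε)`, or
`Trop I = a + O(ε)` with `Re a < 0`. -/
def LogDivergent {n m : ℕ} (P : Fin m → LaurentPoly n) (e₀ : Exponents n m)
    (R : Finset (Fin n → ℝ)) : Prop :=
  ∀ ρ ∈ R, tropIntegrand P e₀ ρ = 0 ∨ (tropIntegrand P e₀ ρ).re < 0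

/-- The divergences are regulated by `ε`: no `Trop I (ρ)` vanishes identically in `ε`. -/
def Regulated {n m : ℕ} (P : Fin m → LaurentPoly n) (e₀ e₁ : Exponents n m)
    (R : Finset (Fin n → ℝ)) : Prop :=
  ∀ ρ ∈ R, ∃ ε : ℂ, tropIntegrand P (affineExp e₀ e₁ ε) ρ ≠ 0

/-- The geometric property holds with the vectors `w ρ`. -/
def GeometricProperty {n m : ℕ} (P : Fin m → LaurentPoly n) (e₀ : Exponents n m)
    (R : Finset (Fin n → ℝ)) (w : (Fin n → ℝ) → (Fin n → ℝ)) : Prop :=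
  ∀ ρ ∈ divRays P e₀ R, ∀ ρ' ∈ divRays P e₀ R, Compatible (integrandFan P) {ρ, ρ'} →
    w ρ ⬝ᵥ ρ' = if ρ = ρ' then -1 else 0

/-- The cones of `Σ^div`: the positive spans of the compatible sets of divergent rays. -/
def divFan {n m : ℕ} (P : Fin m → LaurentPoly n) (e₀ : Exponents n m)
    (R : Finset (Fin n → ℝ)) : Finset (PointedCone ℝ (Fin n → ℝ)) :=
  ((divRays P e₀ R).powerset.filter fun S => Compatible (integrandFan P) (S : Set _)).image
    fun S => PointedCone.hull ℝ (S : Set (Fin n → ℝ))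

/-- The rays of a cone, as a subset of the chosen system of ray generators. -/
def coneRays {n : ℕ} (R : Finset (Fin n → ℝ)) (σ : PointedCone ℝ (Fin n → ℝ)) :
    Finset (Fin n → ℝ) :=
  R.filter fun ρ => ρ ∈ σ

/-- `v_{σ,w} = ∏_{ρ ∈ Rays σ} (1 / (1 + α ^ w_ρ)) ^ (1 - Trop I (ρ))`. -/
def vFactor {n m : ℕ} (P : Fin m → LaurentPoly n) (R : Finset (Fin n → ℝ))
    (w : (Fin n → ℝ) → (Fin n → ℝ)) (e : Exponents n m)
    (σ : PointedCone ℝ (Fin n → ℝ)) (α : Fin n → ℝ) : ℂ :=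
  ∏ ρ ∈ coneRays R σ,
    (((1 / (1 + ∏ i, α i ^ w ρ i) : ℝ)) : ℂ) ^ (1 - tropIntegrand P e ρ)

/-- `I_σ^ren = v_σ⁻¹ ∑_{σ' ⊇ σ} (-1) ^ (dim σ' - dim σ) v_{σ'} I|_{σ'}`, the sum being over the
cones `σ'` of `Σ^div` that contain `σ`. -/
def renormalized {n m : ℕ} (P : Fin m → LaurentPoly n) (e₀ : Exponents n m)
    (R : Finset (Fin n → ℝ)) (w : (Fin n → ℝ) → (Fin n → ℝ)) (e : Exponents n m)
    (σ : PointedCone ℝ (Fin n → ℝ)) (α : Fin n → ℝ) : ℂ :=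
  (vFactor P R w e σ α)⁻¹ *
    ∑ σ' ∈ (divFan P e₀ R).filter (fun σ' => σ ≤ σ'),
      (-1 : ℂ) ^ (coneDim σ' - coneDim σ) * vFactor P R w e σ' α *
        integrand (fun j => initialForm (P j) σ') e α

/-- The absolute value of the minor, with rows labelled by `K`, of the matrix whose columns are
the elements of `S` (it does not depend on the order of the columns). It is `0` by convention
if `S` and `K` differ in size. -/
def absMinor {n : ℕ} (S : Finset (Fin n → ℝ)) (K : Finset (Fin n)) : ℝ :=
  if h : K.card = S.card then
    |(Matrix.of fun i j : K => (Finset.equivOfCardEq h j : Fin n → ℝ) i).det|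
  else 0

/-- `Vol σ = |minor| * ∏_{ρ ∈ Rays σ} (- Trop I (ρ))⁻¹`. -/
def vol {n m : ℕ} (P : Fin m → LaurentPoly n) (R : Finset (Fin n → ℝ)) (e : Exponents n m)
    (σ : PointedCone ℝ (Fin n → ℝ)) (J : Finset (Fin n)) : ℂ :=
  (absMinor (coneRays R σ) Jᶜ : ℂ) * ∏ ρ ∈ coneRays R σ, (- tropIntegrand P e ρ)⁻¹

/-- The point of the slice `{α_i = 1, i ∉ J}` with given coordinates `α_j`, `j ∈ J`. -/
def sliceEmb {n : ℕ} (J : Finset (Fin n)) (β : J → ℝ) : Fin n → ℝ :=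
  fun i => if h : i ∈ J then β ⟨i, h⟩ else 1

/-- The integrand `α ^ u_σ * I_σ^ren` on the slice `V_σ`, in the coordinates `α_j`, `j ∈ J`,
where `u_σ = ∑_{ρ ∈ Rays σ} Trop I (ρ) π_σ(w_ρ)`. -/
def sliceIntegrand {n m : ℕ} (P : Fin m → LaurentPoly n) (e₀ : Exponents n m)
    (R : Finset (Fin n → ℝ)) (w : (Fin n → ℝ) → (Fin n → ℝ)) (e : Exponents n m)
    (σ : PointedCone ℝ (Fin n → ℝ)) (J : Finset (Fin n)) (β : J → ℝ) : ℂ :=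
  (∏ j : J, (β j : ℂ) ^ (∑ ρ ∈ coneRays R σ, tropIntegrand P e ρ * (w ρ j : ℂ))) *
    renormalized P e₀ R w e σ (sliceEmb J β)

end EulerSubtraction

end

open EulerSubtraction

/-! In logarithmic coordinates `x = log α` the Euler integral is the integral over `ℝ ^ n` of
`exp (logIntegrand P e x)`, whose exponential growth rate in the direction `x` is the real part of
the tropicalization. Everything is expressed through the functions `exp (logTerm P w S S' e x)`,
for compatible sets `S ⊆ S'` of divergent rays: these are the summands `S'` of the renormalized
integrand of `S` (`renSum`), restricted to the slice of `S`.

*Combinatorics.* The fan of the product of the `P j` is accessible through the faces of the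
individual `P j`: a set of vectors is compatible if and only if it has a common maximizer in the
support of every `P j` (`compatible_iff_joint`). Every vector is a non-negative combination of
compatible rays (`IsFanRays.exists_decomposition`), and after adding a large multiple of the rays
in `S'` one gets a decomposition adapted to the initial forms of `S'`
(`IsFanRays.exists_star_decomposition`). On such combinations the growth rates are linear.

*Local finiteness.* At the divergent exponents the growth rate of every term is non-positive, and
it vanishes only along divergent cones (`IsFanRays.growth_nonpos`). There, close to a direction
that involves a ray `ρ₀` outside `S`, the terms of `S'` and `S' ∪ {ρ₀}` differ by an
exponentially small amount, and they enter with opposite signs (`IsFanRays.decaysNear_pair`).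
Hence the renormalized integrand decays in every direction that is not in the span of `S`
(`IsFanRays.decaysNear_renSum`). The slice is transversal to this span, so compactness of the
sphere gives a bound by `C * exp (-δ * ‖x‖)`, uniform in the exponents; dominated convergence and
Cauchy's estimates do the rest.

*The formula.* The Euler integral converges exactly where the tropicalization is negative on all
rays (`IsFanRays.mem_convergenceDomain_iff`). There, the term of `S'` in the integrand of the zero
cone can be integrated over the span of any `S ⊆ S'` by Fubini's theorem: the initial form is
quasi-homogeneous along `S`, the powers of `1 / (1 + α ^ w)` produce the one-dimensional integrals
`integral_exp_softplus`, and what remains is the summand of `S'` on the slice of `S`, with the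
factor `Vol` (`integral_exp_logTerm_slice`). So in the right-hand side of the formula each `S'`
occurs with the coefficient `∑ S ⊆ S', (-1) ^ (|S'| - |S|)`, which vanishes unless `S' = ∅`
(`IsFanRays.renFormula_eq_eulerIntegral`).

*Continuation.* Both sides of the formula agree on the part of the domain of convergence that is
close to the divergent exponents `e₀`, and `e₀` is in its closure. After multiplication by the
product of the tropicalizations on the divergent rays, the right-hand side is analytic near `e₀`.
So it provides a continuation, and an identity theorem for meromorphic continuations
(`IsMeromorphicContinuation.mul_eq`) shows that it agrees with any other one. -/

noncomputable section

namespace EulerSubtraction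

open scoped Classical

/-! ### Dominated integrals depending holomorphically on parameters -/

/-- A family `f ε`, `ε` in a disc, that is holomorphic in `ε` and dominated by an integrable
function. -/
structure DominatedHolomorphic {X : Type*} [MeasurableSpace X] (μ : Measure X)
    (f : ℂ → X → ℂ) (c : ℂ) (r : ℝ) (g : X → ℝ) : Prop where
  pos : 0 < r
  integrable : Integrable g μ
  meas : ∀ ε ∈ Metric.ball c r, AEStronglyMeasurable (f ε) μ
  diff : ∀ x, DifferentiableOn ℂ (fun ε => f ε x) (Metric.ball c r)
  bound : ∀ ε ∈ Metric.ball c r, ∀ x, ‖f ε x‖ ≤ g x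

namespace DominatedHolomorphic

variable {X : Type*} [MeasurableSpace X] {μ : Measure X} {f : ℂ → X → ℂ} {c : ℂ} {r : ℝ}
  {g : X → ℝ}

theorem integrable_apply (h : DominatedHolomorphic μ f c r g) {ε : ℂ}
    (hε : ε ∈ Metric.ball c r) : Integrable (f ε) μ :=
  h.integrable.mono' (h.meas ε hε) (ae_of_all _ (h.bound ε hε))

/-- Cauchy's estimate: the derivative in the parameter is again a dominated family. -/
theorem deriv (h : DominatedHolomorphic μ f c r g) :
    DominatedHolomorphic μ (fun ε x => deriv (fun ε' => f ε' x) ε) c (r / 2)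
      (fun x => g x / (r / 4)) where
  pos := half_pos h.pos
  integrable := h.integrable.div_const _
  meas := by
    intro ε hε
    have hr := h.pos
    have hε' : dist ε c < r / 2 := hε
    -- the derivative is the limit of difference quotients along `1 / (n + 1)`
    let u : ℕ → ℂ := fun k => ((r / 4 : ℝ) : ℂ) * (1 / ((k : ℂ) + 1))
    have hu_norm : ∀ k, ‖u k‖ ≤ r / 4 := by
      intro k
      have h1 : ‖(1 / ((k : ℂ) + 1))‖ ≤ 1 := by
        rw [norm_div, norm_one]
        have : ‖(k : ℂ) + 1‖ = (k : ℝ) + 1 := by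
          have := Complex.norm_natCast (k + 1)
          push_cast at this
          simpa using this
        rw [this, div_le_one (by positivity)]
        linarith [Nat.cast_nonneg (α := ℝ) k]
      calc ‖u k‖ = ‖((r / 4 : ℝ) : ℂ)‖ * ‖(1 / ((k : ℂ) + 1))‖ := norm_mul _ _
        _ ≤ (r / 4) * 1 := by
            rw [Complex.norm_real, Real.norm_of_nonneg (by positivity)]
            gcongr
        _ = r / 4 := mul_one _
    have hu_ne : ∀ k, u k ≠ 0 := by
      intro k
      have h2 : ((k : ℂ) + 1) ≠ 0 := Nat.cast_add_one_ne_zero k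
      have h3 : ((r / 4 : ℝ) : ℂ) ≠ 0 := by
        exact_mod_cast (by positivity : (r / 4 : ℝ) ≠ 0)
      exact mul_ne_zero h3 (div_ne_zero one_ne_zero h2)
    have hu_lim : Tendsto u atTop (𝓝 0) := by
      have := (tendsto_one_div_add_atTop_nhds_zero_nat (𝕜 := ℂ)).const_mul ((r / 4 : ℝ) : ℂ)
      simpa [u] using this
    refine aestronglyMeasurable_of_tendsto_ae atTop
      (f := fun k x => (u k)⁻¹ • (f (ε + u k) x - f ε x)) ?_ ?_
    · intro k
      refine ((h.meas (ε + u k) ?_).sub (h.meas ε ?_)).const_smul ((u k)⁻¹)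
      · rw [Metric.mem_ball, dist_eq_norm] at *
        calc ‖ε + u k - c‖ = ‖(ε - c) + u k‖ := by ring_nf
          _ ≤ ‖ε - c‖ + ‖u k‖ := norm_add_le _ _
          _ < r := by linarith [hu_norm k]
      · rw [Metric.mem_ball]; linarith
    · refine ae_of_all _ fun x => ?_
      have hd : HasDerivAt (fun ε' => f ε' x) (_root_.deriv (fun ε' => f ε' x) ε) ε := by
        refine ((h.diff x).differentiableAt (Metric.isOpen_ball.mem_nhds ?_)).hasDerivAt
        rw [Metric.mem_ball]; linarith
      have := hd.tendsto_slope_zero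
      exact this.comp (tendsto_nhdsWithin_iff.2 ⟨hu_lim, Eventually.of_forall hu_ne⟩)
  diff := by
    intro x
    exact ((h.diff x).deriv Metric.isOpen_ball).mono
      (Metric.ball_subset_ball (by linarith [h.pos]))
  bound := by
    intro ε hε x
    have hr := h.pos
    have hε' : dist ε c < r / 2 := hε
    have hsub : Metric.closedBall ε (r / 4) ⊆ Metric.ball c r := by
      intro z hz
      rw [Metric.mem_closedBall] at hz
      rw [Metric.mem_ball]
      linarith [dist_triangle z ε c]
    refine Complex.norm_deriv_le_of_forall_mem_sphere_norm_le (by positivity) ?_ ?_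
    · refine DifferentiableOn.diffContOnCl ?_
      rw [closure_ball _ (by positivity)]
      exact (h.diff x).mono hsub
    · intro z hz
      exact h.bound z (hsub (Metric.sphere_subset_closedBall hz)) x

theorem hasDerivAt (h : DominatedHolomorphic μ f c r g) {ε : ℂ}
    (hε : ε ∈ Metric.ball c (r / 2)) :
    HasDerivAt (fun ε => ∫ x, f ε x ∂μ) (∫ x, _root_.deriv (fun ε' => f ε' x) ε ∂μ) ε := by
  have hsub : Metric.ball c (r / 2) ⊆ Metric.ball c r :=
    Metric.ball_subset_ball (by linarith [h.pos])
  refine (hasDerivAt_integral_of_dominated_loc_of_deriv_le (F := f)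
    (F' := fun ε x => _root_.deriv (fun ε' => f ε' x) ε) (s := Metric.ball c (r / 2))
    (bound := fun x => g x / (r / 4))
    (Metric.isOpen_ball.mem_nhds hε) ?_ (h.integrable_apply (hsub hε)) (h.deriv.meas ε hε)
    (ae_of_all _ fun x z hz => h.deriv.bound z hz x) h.deriv.integrable
    (ae_of_all _ fun x z hz => ?_)).2
  · filter_upwards [Metric.isOpen_ball.mem_nhds (hsub hε)] with z hz
    exact h.meas z hz
  · exact ((h.diff x).differentiableAt (Metric.isOpen_ball.mem_nhds (hsub hz))).hasDerivAt

theorem iteratedDeriv_integral (k : ℕ) : ∀ {f : ℂ → X → ℂ} {r : ℝ} {g : X → ℝ},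
    DominatedHolomorphic μ f c r g →
    Integrable (fun x => iteratedDeriv k (fun ε => f ε x) c) μ ∧
    iteratedDeriv k (fun ε => ∫ x, f ε x ∂μ) c = ∫ x, iteratedDeriv k (fun ε => f ε x) c ∂μ := by
  induction k with
  | zero =>
    intro f r g h
    simp only [iteratedDeriv_zero]
    exact ⟨h.integrable_apply (Metric.mem_ball_self h.pos), trivial⟩
  | succ k ih =>
    intro f r g h
    have h1 := ih h.deriv
    simp only [iteratedDeriv_succ']
    refine ⟨h1.1, ?_⟩
    rw [← h1.2]
    refine Filter.EventuallyEq.iteratedDeriv_eq k ?_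
    filter_upwards [Metric.ball_mem_nhds c (half_pos h.pos)] with ε hε
    exact (h.hasDerivAt hε).deriv

theorem analyticAt_integral (h : DominatedHolomorphic μ f c r g) :
    AnalyticAt ℂ (fun ε => ∫ x, f ε x ∂μ) c := by
  have : DifferentiableOn ℂ (fun ε => ∫ x, f ε x ∂μ) (Metric.ball c (r / 2)) :=
    fun ε hε => (h.hasDerivAt hε).differentiableAt.differentiableWithinAt
  exact this.analyticAt (Metric.ball_mem_nhds c (half_pos h.pos))

theorem locallyFiniteFamily (h : DominatedHolomorphic μ f 0 r g) : LocallyFiniteFamily μ f := by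
  refine ⟨?_, h.analyticAt_integral, ae_of_all _ fun x =>
    (h.diff x).analyticAt (Metric.ball_mem_nhds 0 h.pos), fun k => iteratedDeriv_integral k h⟩
  filter_upwards [Metric.ball_mem_nhds 0 h.pos] with ε hε
  exact h.integrable_apply hε

end DominatedHolomorphic

/-! ### Osgood's lemma -/

theorem continuous_deriv_circleMap_smul {F : Type*} [NormedRing F] [NormedAlgebra ℂ F]
    (c : ℂ) (r : ℝ) (hr : 0 ≤ r) (g : C(Metric.sphere c r, F)) :
    Continuous fun θ : ℝ =>
      deriv (circleMap c r) θ • g ⟨circleMap c r θ, circleMap_mem_sphere c hr θ⟩ := by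
  have h1 : Continuous (deriv (circleMap c r)) := by
    have : deriv (circleMap c r) = fun θ => circleMap 0 r θ * Complex.I :=
      funext fun θ => deriv_circleMap c r θ
    rw [this]
    fun_prop
  exact h1.smul (g.continuous.comp ((continuous_circleMap c r).subtype_mk _))

/-- The Cauchy integral over a circle, as a continuous linear functional on the continuous
functions on that circle. -/
def circleFunctional {F : Type*} [NormedRing F] [NormedAlgebra ℂ F] [CompleteSpace F]
    (c : ℂ) (r : ℝ) (hr : 0 < r) : C(Metric.sphere c r, F) →L[ℂ] F :=
  LinearMap.mkContinuous
    { toFun := fun g => (2 * Real.pi * Complex.I : ℂ)⁻¹ •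
        ∫ θ in (0 : ℝ)..2 * Real.pi,
          deriv (circleMap c r) θ • g ⟨circleMap c r θ, circleMap_mem_sphere c hr.le θ⟩
      map_add' := by
        intro g h
        rw [← smul_add, ← intervalIntegral.integral_add]
        · simp only [ContinuousMap.add_apply, smul_add]
        all_goals
          exact (continuous_deriv_circleMap_smul c r hr.le _).intervalIntegrable _ _
      map_smul' := by
        intro a g
        simp only [ContinuousMap.smul_apply, RingHom.id_apply]
        rw [smul_comm a, ← intervalIntegral.integral_smul a]
        congr 1
        refine intervalIntegral.integral_congr fun θ _ => ?_
        exact smul_comm _ _ _ }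
    r (by
      intro g
      simp only [LinearMap.coe_mk, AddHom.coe_mk]
      rw [norm_smul]
      have h1 : ‖∫ θ in (0 : ℝ)..2 * Real.pi,
          deriv (circleMap c r) θ • g ⟨circleMap c r θ, circleMap_mem_sphere c hr.le θ⟩‖ ≤
          (r * ‖g‖) * |2 * Real.pi - 0| := by
        refine intervalIntegral.norm_integral_le_of_norm_le_const fun θ _ => ?_
        rw [norm_smul]
        have : ‖deriv (circleMap c r) θ‖ = r := by
          simp [deriv_circleMap, abs_of_pos hr]
        rw [this]
        exact mul_le_mul_of_nonneg_left (g.norm_coe_le_norm _) hr.le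
      have hpi := Real.pi_pos
      have h2 : ‖(2 * Real.pi * Complex.I : ℂ)⁻¹‖ = (2 * Real.pi)⁻¹ := by
        simp [abs_of_pos hpi]
      rw [h2]
      rw [sub_zero, abs_of_pos (by positivity)] at h1
      calc (2 * Real.pi)⁻¹ * _ ≤ (2 * Real.pi)⁻¹ * ((r * ‖g‖) * (2 * Real.pi)) := by gcongr
        _ = r * ‖g‖ := by field_simp)

theorem circleFunctional_eq {F : Type*} [NormedRing F] [NormedAlgebra ℂ F] [CompleteSpace F]
    {c : ℂ} {r : ℝ} (hr : 0 < r) (g : C(Metric.sphere c r, F)) (f : ℂ → F)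
    (hfg : ∀ ζ : Metric.sphere c r, g ζ = f ζ) :
    circleFunctional c r hr g = (2 * Real.pi * Complex.I : ℂ)⁻¹ • ∮ z in C(c, r), f z := by
  simp only [circleFunctional, LinearMap.mkContinuous_apply, LinearMap.coe_mk, AddHom.coe_mk,
    circleIntegral]
  simp only [hfg]

/-- A continuous function that is holomorphic along every complex line is analytic, on `ℂ ^ k`.
The induction on `k` applies Cauchy's formula in the first variable, with values in the Banach
algebra of continuous functions on a circle in the other variables. -/
theorem osgood_pi (k : ℕ) : ∀ {F : Type} [NormedRing F] [NormedAlgebra ℂ F] [CompleteSpace F]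
    {f : (Fin k → ℂ) → F} {U : Set (Fin k → ℂ)}, IsOpen U → ContinuousOn f U →
    (∀ x ∈ U, ∀ y, DifferentiableAt ℂ (fun z : ℂ => f (x + z • y)) 0) →
    AnalyticOnNhd ℂ f U := by
  induction k with
  | zero =>
    intro F _ _ _ f U _ _ _ x _
    have : f = fun _ => f 0 := by
      funext y
      rw [Subsingleton.elim y 0]
    rw [this]
    exact analyticAt_const
  | succ k ih =>
    intro F _ _ _ f U hU hc hl x₀ hx₀
    obtain ⟨r', hr', hball⟩ := Metric.isOpen_iff.1 hU x₀ hx₀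
    obtain ⟨r, hr, hrr⟩ : ∃ r, 0 < r ∧ r < r' := exists_between hr'
    set z₀ : ℂ := x₀ 0 with hz₀
    set e₀ : Fin k → ℂ := Fin.tail x₀ with he₀
    have hmem : ∀ z ∈ Metric.closedBall z₀ r, ∀ e ∈ Metric.ball e₀ r, Fin.cons z e ∈ U := by
      intro z hz e he
      refine hball ?_
      rw [Metric.mem_ball, dist_pi_lt_iff hr']
      intro i
      refine Fin.cases ?_ (fun i => ?_) i
      · exact lt_of_le_of_lt hz hrr
      · have := (dist_pi_lt_iff hr).1 he i
        exact lt_trans this hrr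
    have hcons : Continuous fun p : ℂ × (Fin k → ℂ) => (Fin.cons p.1 p.2 : Fin (k + 1) → ℂ) := by
      refine continuous_pi fun i => ?_
      refine Fin.cases ?_ (fun i => ?_) i
      · exact continuous_fst
      · exact (continuous_apply i).comp continuous_snd
    -- the restrictions of `f` to the circle around `z₀`, as a function of the other variables
    let Φ : (Fin k → ℂ) → C(Metric.sphere z₀ r, F) := fun e =>
      if h : Continuous (fun ζ : Metric.sphere z₀ r => f (Fin.cons (ζ : ℂ) e)) then ⟨_, h⟩ else 0
    have hΦ : ∀ e ∈ Metric.ball e₀ r, ∀ ζ : Metric.sphere z₀ r,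
        Φ e ζ = f (Fin.cons (ζ : ℂ) e) := by
      intro e he ζ
      have h : Continuous (fun ζ : Metric.sphere z₀ r => f (Fin.cons (ζ : ℂ) e)) := by
        refine hc.comp_continuous (hcons.comp (continuous_subtype_val.prodMk continuous_const)) ?_
        intro ζ
        exact hmem _ (Metric.sphere_subset_closedBall ζ.2) e he
      simp only [Φ, dif_pos h, ContinuousMap.coe_mk]
    have hΦc : ContinuousOn Φ (Metric.ball e₀ r) := by
      rw [continuousOn_iff_continuous_domRestrict]
      refine ContinuousMap.continuous_of_continuous_uncurry _ ?_
      have : (Function.uncurry fun (x : Metric.ball e₀ r) y =>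
          ((Metric.ball e₀ r).domRestrict Φ x) y) =
          fun p : Metric.ball e₀ r × Metric.sphere z₀ r =>
            f (Fin.cons (p.2 : ℂ) (p.1 : Fin k → ℂ)) := by
        funext p
        exact hΦ p.1 p.1.2 p.2
      rw [this]
      refine hc.comp_continuous (hcons.comp (g := fun p : ℂ × (Fin k → ℂ) =>
        (Fin.cons p.1 p.2 : Fin (k + 1) → ℂ)) (f := fun p : Metric.ball e₀ r ×
          Metric.sphere z₀ r => ((p.2 : ℂ), (p.1 : Fin k → ℂ))) ?_) ?_
      · exact (continuous_subtype_val.comp continuous_snd).prodMk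
          (continuous_subtype_val.comp continuous_fst)
      · intro p
        exact hmem _ (Metric.sphere_subset_closedBall p.2.2) _ p.1.2
    have hline : ∀ z ∈ Metric.closedBall z₀ r, ∀ e ∈ Metric.ball e₀ r, ∀ a : ℂ, ∀ y,
        DifferentiableAt ℂ (fun t : ℂ => f (Fin.cons (z + t * a) (e + t • y))) 0 := by
      intro z hz e he a y
      have := hl _ (hmem z hz e he) (Fin.cons a y)
      convert this using 3
      rename_i t
      funext i
      refine Fin.cases ?_ (fun i => ?_) i <;> simp
    have hΦl : ∀ e ∈ Metric.ball e₀ r, ∀ y,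
        DifferentiableAt ℂ (fun z : ℂ => Φ (e + z • y)) 0 := by
      intro e he y
      have hcont : Continuous fun z : ℂ => e + z • y := by fun_prop
      have hnhds : (fun z : ℂ => e + z • y) ⁻¹' Metric.ball e₀ r ∈ 𝓝 (0 : ℂ) := by
        refine hcont.continuousAt.preimage_mem_nhds (Metric.isOpen_ball.mem_nhds ?_)
        simpa using he
      obtain ⟨s', hs', hsub'⟩ := Metric.mem_nhds_iff.1 hnhds
      obtain ⟨s, hs, hss⟩ : ∃ s, 0 < s ∧ s < s' := exists_between hs'
      have hsub : ∀ z ∈ Metric.closedBall (0 : ℂ) s, e + z • y ∈ Metric.ball e₀ r :=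
        fun z hz => hsub' (Metric.closedBall_subset_ball hss hz)
      have hcs : ContinuousOn (fun z : ℂ => Φ (e + z • y)) (Metric.closedBall 0 s) :=
        hΦc.comp hcont.continuousOn hsub
      have hci : CircleIntegrable (fun z : ℂ => Φ (e + z • y)) 0 s :=
        (hcs.mono Metric.sphere_subset_closedBall).circleIntegrable hs.le
      have hps := hasFPowerSeriesOn_cauchy_integral (R := ⟨s, hs.le⟩) hci
        (by exact_mod_cast hs)
      refine (hps.analyticAt.differentiableAt).congr_of_eventuallyEq ?_
      filter_upwards [Metric.ball_mem_nhds (0 : ℂ) hs] with z hz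
      ext ζ
      -- Cauchy's formula for the value at each `ζ`
      let ev : C(Metric.sphere z₀ r, F) →L[ℂ] F := ContinuousMap.evalCLM ℂ ζ
      have hev : ∀ g, ev g = g ζ := fun g => rfl
      have hd : DifferentiableOn ℂ (fun z : ℂ => Φ (e + z • y) ζ) (Metric.closedBall 0 s) := by
        intro w hw
        have h1 := hline ζ (Metric.sphere_subset_closedBall ζ.2) (e + w • y) (hsub w hw) 0 y
        have h2 : DifferentiableAt ℂ (fun z : ℂ => f (Fin.cons (ζ : ℂ) (e + z • y))) w := by
          have h3 : DifferentiableAt ℂ (fun z : ℂ => z - w) w := by fun_prop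
          have h4 := DifferentiableAt.comp (x := w) (f := fun z : ℂ => z - w)
            (g := fun t : ℂ => f (Fin.cons ((ζ : ℂ) + t * 0) (e + w • y + t • y)))
            (by simpa using h1) h3
          refine h4.congr_of_eventuallyEq (Eventually.of_forall fun t => ?_)
          change f _ = f _
          congr 1
          rw [mul_zero, add_zero, sub_smul]
          congr 1
          abel
        refine (h2.differentiableWithinAt).congr (fun z hz => hΦ _ (hsub z hz) ζ) ?_
        exact hΦ _ (hsub w hw) ζ
      have hcf := Complex.two_pi_I_inv_smul_circleIntegral_sub_inv_smul_of_differentiable_on_off_countable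
        (s := ∅) Set.countable_empty hz hd.continuousOn
        (fun w hw => (hd w (Metric.ball_subset_closedBall hw.1)).differentiableAt
          (Metric.closedBall_mem_nhds_of_mem hw.1))
      rw [← hcf, ← hev ((2 * Real.pi * Complex.I : ℂ)⁻¹ • _), map_smul]
      congr 1
      simp only [circleIntegral]
      rw [← ContinuousLinearMap.intervalIntegral_comp_comm]
      · refine intervalIntegral.integral_congr fun θ _ => ?_
        simp only [map_smul]
        rfl
      · have hci2 : CircleIntegrable (fun w : ℂ => (w - z)⁻¹ • Φ (e + w • y)) 0 s := by
          refine ContinuousOn.circleIntegrable hs.le ?_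
          refine ContinuousOn.fun_smul ?_ (hcs.mono Metric.sphere_subset_closedBall)
          refine ContinuousOn.inv₀ (by fun_prop) ?_
          intro w hw h0
          rw [sub_eq_zero] at h0
          rw [h0, mem_sphere_iff_norm] at hw
          rw [mem_ball_iff_norm] at hz
          exact absurd hw hz.ne
        exact hci2.out
    have hΦa : AnalyticAt ℂ Φ e₀ :=
      ih Metric.isOpen_ball hΦc hΦl e₀ (Metric.mem_ball_self hr)
    -- the Cauchy kernel as an analytic function with values in the Banach algebra
    let u : C(Metric.sphere z₀ r, F) := ⟨fun ζ => (ζ : ℂ) • (1 : F), by fun_prop⟩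
    have hunit : ∀ z ∈ Metric.ball z₀ r, ∃ v : (C(Metric.sphere z₀ r, F))ˣ,
        (v : C(Metric.sphere z₀ r, F)) = u - z • (1 : C(Metric.sphere z₀ r, F)) ∧
        ∀ ζ : Metric.sphere z₀ r,
          ((v⁻¹ : (C(Metric.sphere z₀ r, F))ˣ) : C(Metric.sphere z₀ r, F)) ζ =
            ((ζ : ℂ) - z)⁻¹ • (1 : F) := by
      intro z hz
      have hne : ∀ ζ : Metric.sphere z₀ r, (ζ : ℂ) - z ≠ 0 := by
        intro ζ h0
        rw [sub_eq_zero] at h0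
        have h1 := ζ.2
        rw [h0, mem_sphere_iff_norm] at h1
        rw [mem_ball_iff_norm] at hz
        exact absurd h1 hz.ne
      let q : C(Metric.sphere z₀ r, F) :=
        ⟨fun ζ => ((ζ : ℂ) - z)⁻¹ • (1 : F),
          (Continuous.inv₀ (by fun_prop) hne).smul continuous_const⟩
      refine ⟨⟨u - z • 1, q, ?_, ?_⟩, rfl, fun ζ => rfl⟩
      · ext ζ
        simp only [ContinuousMap.mul_apply, ContinuousMap.sub_apply, ContinuousMap.smul_apply,
          ContinuousMap.one_apply, u, q, ContinuousMap.coe_mk, ← sub_smul]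
        rw [smul_mul_smul_comm, mul_inv_cancel₀ (hne ζ), one_smul, one_mul]
      · ext ζ
        simp only [ContinuousMap.mul_apply, ContinuousMap.sub_apply, ContinuousMap.smul_apply,
          ContinuousMap.one_apply, u, q, ContinuousMap.coe_mk, ← sub_smul]
        rw [smul_mul_smul_comm, inv_mul_cancel₀ (hne ζ), one_smul, one_mul]
    have hker : AnalyticAt ℂ
        (fun z : ℂ => Ring.inverse (u - z • (1 : C(Metric.sphere z₀ r, F)))) z₀ := by
      obtain ⟨v, hv, _⟩ := hunit z₀ (Metric.mem_ball_self hr)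
      have h1 : AnalyticAt ℂ Ring.inverse (u - z₀ • (1 : C(Metric.sphere z₀ r, F))) := by
        rw [← hv]; exact analyticAt_inverse v
      refine AnalyticAt.fun_comp (g := Ring.inverse)
        (f := fun z : ℂ => u - z • (1 : C(Metric.sphere z₀ r, F))) h1 ?_
      exact analyticAt_const.fun_sub (AnalyticAt.fun_smul (f := fun z : ℂ => z) analyticAt_id
        analyticAt_const)
    have hproj0 : AnalyticAt ℂ (fun x : Fin (k + 1) → ℂ => x 0) x₀ :=
      (ContinuousLinearMap.proj (R := ℂ) (φ := fun _ : Fin (k + 1) => ℂ) 0).analyticAt x₀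
    have hproj1 : AnalyticAt ℂ (fun x : Fin (k + 1) → ℂ => (Fin.tail x : Fin k → ℂ)) x₀ :=
      (ContinuousLinearMap.pi fun i : Fin k =>
        ContinuousLinearMap.proj (R := ℂ) (φ := fun _ : Fin (k + 1) => ℂ) i.succ).analyticAt x₀
    have hprod : AnalyticAt ℂ (fun x : Fin (k + 1) → ℂ => circleFunctional z₀ r hr
        (Ring.inverse (u - (x 0) • (1 : C(Metric.sphere z₀ r, F))) * Φ (Fin.tail x))) x₀ := by
      refine AnalyticAt.fun_comp (g := circleFunctional (F := F) z₀ r hr)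
        (ContinuousLinearMap.analyticAt (𝕜 := ℂ) (circleFunctional (F := F) z₀ r hr) _)
        (AnalyticAt.fun_mul ?_ ?_)
      · exact AnalyticAt.fun_comp (g := fun z : ℂ =>
          Ring.inverse (u - z • (1 : C(Metric.sphere z₀ r, F)))) hker hproj0
      · exact AnalyticAt.fun_comp (g := Φ) hΦa hproj1
    refine hprod.congr ?_
    have hev0 : ∀ᶠ x : Fin (k + 1) → ℂ in 𝓝 x₀, x 0 ∈ Metric.ball z₀ r :=
      hproj0.continuousAt.eventually (Metric.ball_mem_nhds _ hr)
    have hev1 : ∀ᶠ x : Fin (k + 1) → ℂ in 𝓝 x₀, (Fin.tail x : Fin k → ℂ) ∈ Metric.ball e₀ r :=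
      hproj1.continuousAt.eventually (Metric.ball_mem_nhds _ hr)
    filter_upwards [hev0, hev1] with x hx0 hx1
    obtain ⟨v, hv, hv'⟩ := hunit (x 0) hx0
    rw [← hv, Ring.inverse_unit, circleFunctional_eq hr _
      (fun ζ => (ζ - x 0)⁻¹ • f (Fin.cons ζ (Fin.tail x)))]
    · have hd : DifferentiableOn ℂ (fun z : ℂ => f (Fin.cons z (Fin.tail x)))
          (Metric.closedBall z₀ r) := by
        intro w hw
        have h1 := hline w hw (Fin.tail x) hx1 1 0
        have h2 : DifferentiableAt ℂ (fun z : ℂ => f (Fin.cons z (Fin.tail x))) w := by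
          have h3 : DifferentiableAt ℂ (fun z : ℂ => z - w) w := by fun_prop
          have h4 := DifferentiableAt.comp (x := w) (f := fun z : ℂ => z - w)
            (g := fun t : ℂ => f (Fin.cons (w + t * 1) (Fin.tail x + t • (0 : Fin k → ℂ))))
            (by simpa using h1) h3
          refine h4.congr_of_eventuallyEq (Eventually.of_forall fun t => ?_)
          change f _ = f _
          congr 1
          rw [mul_one, smul_zero, add_zero, add_sub_cancel]
        exact h2.differentiableWithinAt
      rw [Complex.two_pi_I_inv_smul_circleIntegral_sub_inv_smul_of_differentiable_on_off_countable
        (s := ∅) Set.countable_empty hx0 hd.continuousOn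
        (fun w hw => (hd w (Metric.ball_subset_closedBall hw.1)).differentiableAt
          (Metric.closedBall_mem_nhds_of_mem hw.1))]
      rw [Fin.cons_self_tail]
    · intro ζ
      rw [ContinuousMap.mul_apply, hv', hΦ _ hx1, smul_one_mul]

/-- **Osgood's lemma**: on an open subset of a finite-dimensional space, a continuous function
that is holomorphic along every complex line is analytic. -/
theorem osgood {E : Type*} [NormedAddCommGroup E] [NormedSpace ℂ E] [FiniteDimensional ℂ E]
    {f : E → ℂ} {U : Set E} (hU : IsOpen U) (hc : ContinuousOn f U)
    (hl : ∀ x ∈ U, ∀ y, DifferentiableAt ℂ (fun z : ℂ => f (x + z • y)) 0) :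
    AnalyticOnNhd ℂ f U := by
  let φ : E ≃L[ℂ] (Fin (Module.finrank ℂ E) → ℂ) :=
    ContinuousLinearEquiv.ofFinrankEq (by simp)
  have h : AnalyticOnNhd ℂ (f ∘ φ.symm) (φ.symm ⁻¹' U) := by
    refine osgood_pi _ (hU.preimage φ.symm.continuous)
      (hc.comp φ.symm.continuous.continuousOn fun x hx => hx) ?_
    intro x hx y
    have := hl (φ.symm x) hx (φ.symm y)
    simpa [Function.comp_def] using this
  intro x hx
  have h1 : AnalyticAt ℂ (f ∘ φ.symm) (φ x) := h (φ x) (by simpa using hx)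
  have h2 := h1.fun_comp (φ.analyticAt x)
  simpa [Function.comp_def] using h2

/-! ### Logarithmic coordinates -/

/-- The coordinatewise exponential `x ↦ α = e ^ x`. -/
def expMap {ι : Type*} (x : ι → ℝ) : ι → ℝ := fun i => Real.exp (x i)

theorem measurePreserving_exp : MeasurePreserving Real.exp volume
    ((volume.restrict (Set.Ioi (0 : ℝ))).withDensity fun x => ENNReal.ofReal x⁻¹) := by
  refine ⟨Real.measurable_exp, ?_⟩
  ext s hs
  have hs' : MeasurableSet (Real.exp ⁻¹' s) := Real.measurable_exp hs
  rw [Measure.map_apply Real.measurable_exp hs, withDensity_apply _ hs,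
    Measure.restrict_restrict hs]
  have himg : Real.exp '' (Real.exp ⁻¹' s) = s ∩ Set.Ioi 0 := by
    rw [Set.image_preimage_eq_inter_range, Real.range_exp]
  rw [← himg, lintegral_image_eq_lintegral_abs_deriv_mul hs'
    (fun x _ => (Real.hasDerivAt_exp x).hasDerivWithinAt) Real.exp_injective.injOn]
  have : ∀ x : ℝ, ENNReal.ofReal |Real.exp x| * ENNReal.ofReal (Real.exp x)⁻¹ = 1 := by
    intro x
    rw [← ENNReal.ofReal_mul (abs_nonneg _), abs_of_pos (Real.exp_pos x),
      mul_inv_cancel₀ (Real.exp_pos x).ne', ENNReal.ofReal_one]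
  simp only [this, lintegral_one, Measure.restrict_apply_univ]

theorem measurableEmbedding_expMap {ι : Type*} [Fintype ι] :
    MeasurableEmbedding (expMap : (ι → ℝ) → ι → ℝ) := by
  refine Continuous.measurableEmbedding ?_ ?_
  · exact continuous_pi fun i => Real.continuous_exp.comp (continuous_apply i)
  · intro x y h
    funext i
    exact Real.exp_injective (congrFun h i)

theorem measurePreserving_expMap (ι : Type*) [Fintype ι] :
    MeasurePreserving (expMap : (ι → ℝ) → ι → ℝ) volume (logMeasure ι) := by
  have : SigmaFinite
      ((volume.restrict (Set.Ioi (0 : ℝ))).withDensity fun x => ENNReal.ofReal x⁻¹) :=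
    SigmaFinite.withDensity_ofReal _
  exact measurePreserving_pi (fun _ : ι => (volume : Measure ℝ)) _ fun _ => measurePreserving_exp

theorem integrable_logMeasure_iff {ι : Type*} [Fintype ι] {f : (ι → ℝ) → ℂ} :
    Integrable f (logMeasure ι) ↔ Integrable fun x => f (expMap x) :=
  ((measurePreserving_expMap ι).integrable_comp_emb measurableEmbedding_expMap).symm

theorem integral_logMeasure {ι : Type*} [Fintype ι] (f : (ι → ℝ) → ℂ) :
    ∫ α, f α ∂(logMeasure ι) = ∫ x, f (expMap x) :=
  ((measurePreserving_expMap ι).integral_comp measurableEmbedding_expMap f).symm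

theorem locallyFiniteFamily_logMeasure {ι : Type*} [Fintype ι] {f : ℂ → (ι → ℝ) → ℂ}
    (h : LocallyFiniteFamily volume fun ε x => f ε (expMap x)) :
    LocallyFiniteFamily (logMeasure ι) f := by
  obtain ⟨h1, h2, h3, h4⟩ := h
  refine ⟨?_, ?_, ?_, fun k => ⟨?_, ?_⟩⟩
  · simpa only [integrable_logMeasure_iff] using h1
  · simpa only [integral_logMeasure] using h2
  · rw [← (measurePreserving_expMap ι).map_eq, measurableEmbedding_expMap.ae_map_iff]
    exact h3
  · rw [integrable_logMeasure_iff]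
    exact (h4 k).1
  · simp only [integral_logMeasure]
    exact (h4 k).2

/-! ### Exponentially decaying functions -/

theorem integrable_exp_neg_mul_abs {δ : ℝ} (hδ : 0 < δ) :
    Integrable fun t : ℝ => Real.exp (-δ * |t|) := by
  have h1 : IntegrableOn (fun t : ℝ => Real.exp (-δ * |t|)) (Set.Ioi 0) := by
    refine (integrableOn_exp_mul_Ioi (neg_lt_zero.2 hδ) 0).congr_fun (fun t ht => ?_)
      measurableSet_Ioi
    simp only [abs_of_pos (Set.mem_Ioi.1 ht)]
  have h2 : IntegrableOn (fun t : ℝ => Real.exp (-δ * |t|)) (Set.Iic 0) := by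
    refine (integrableOn_exp_mul_Iic hδ 0).congr_fun (fun t ht => ?_) measurableSet_Iic
    simp only [abs_of_nonpos (Set.mem_Iic.1 ht)]
    ring_nf
  rw [← integrableOn_univ, ← Set.Iic_union_Ioi (a := (0 : ℝ))]
  exact h2.union h1

theorem integrable_exp_neg_mul_norm {ι : Type*} [Fintype ι] {δ : ℝ} (hδ : 0 < δ) :
    Integrable fun x : ι → ℝ => Real.exp (-δ * ‖x‖) := by
  have hN : (0 : ℝ) < Fintype.card ι + 1 := by positivity
  have h1 : Integrable fun x : ι → ℝ => ∏ i, Real.exp (-(δ / (Fintype.card ι + 1)) * |x i|) :=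
    Integrable.fintype_prod (f := fun (_ : ι) t => Real.exp (-(δ / (Fintype.card ι + 1)) * |t|))
      fun _ => integrable_exp_neg_mul_abs (by positivity)
  refine h1.mono' (by fun_prop) (ae_of_all _ fun x => ?_)
  rw [Real.norm_of_nonneg (Real.exp_pos _).le, ← Real.exp_sum, Real.exp_le_exp,
    ← Finset.mul_sum]
  have h2 : ∑ i, |x i| ≤ Fintype.card ι * ‖x‖ := by
    calc ∑ i, |x i| ≤ ∑ _i : ι, ‖x‖ := Finset.sum_le_sum fun i _ => norm_le_pi_norm x i
      _ = Fintype.card ι * ‖x‖ := by simp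
  have h3 : ∑ i, |x i| ≤ (Fintype.card ι + 1) * ‖x‖ := by nlinarith [norm_nonneg x]
  have h4 : δ / (Fintype.card ι + 1) * ∑ i, |x i| ≤ δ * ‖x‖ := by
    rw [div_mul_eq_mul_div, div_le_iff₀ hN]
    nlinarith
  linarith

/-! ### The integral over the directions of a divergent cone -/

/-- The logarithm of `1 + e ^ t`. -/
def softplus (t : ℝ) : ℝ := Real.log (1 + Real.exp t)

theorem continuous_softplus : Continuous softplus := by
  unfold softplus
  refine Continuous.log (by fun_prop) fun t => ?_
  positivity

theorem softplus_nonneg (t : ℝ) : 0 ≤ softplus t :=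
  Real.log_nonneg (by linarith [Real.exp_pos t])

theorem softplus_le_exp (t : ℝ) : softplus t ≤ Real.exp t := by
  have := Real.log_le_sub_one_of_pos (show 0 < 1 + Real.exp t by positivity)
  unfold softplus
  linarith

theorem max_le_softplus (t : ℝ) : max 0 t ≤ softplus t := by
  refine max_le (softplus_nonneg t) ?_
  unfold softplus
  rw [Real.le_log_iff_exp_le (by positivity)]
  linarith

theorem softplus_le_max_add (t : ℝ) : softplus t ≤ max 0 t + Real.log 2 := by
  have h2 : (0 : ℝ) < 2 := two_pos
  unfold softplus
  rw [Real.log_le_iff_le_exp (by positivity), Real.exp_add, Real.exp_log h2]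
  have h3 : 1 ≤ Real.exp (max 0 t) := Real.one_le_exp (le_max_left _ _)
  have h4 : Real.exp t ≤ Real.exp (max 0 t) := Real.exp_le_exp.2 (le_max_right _ _)
  linarith

/-- The factor `(1 / (1 + α ^ w)) ^ (1 - T)` integrates the weight `e ^ {t T}` along a ray:
`e ^ {t T} (1 + e ^ {a - t}) ^ (T - 1)` is the derivative of `(e ^ t + e ^ a) ^ T / T`. -/
theorem integral_exp_softplus {T : ℂ} (hT : T.re < 0) (a : ℝ) :
    ∫ t : ℝ, Complex.exp (T * t - (1 - T) * softplus (a - t)) = Complex.exp (T * a) * (-T)⁻¹ := by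
  have hT0 : T ≠ 0 := fun h => by simp [h] at hT
  have hpos : ∀ t : ℝ, 0 < Real.exp t + Real.exp a := fun t => by positivity
  have hsp : ∀ t : ℝ, softplus (a - t) = Real.log (Real.exp t + Real.exp a) - t := by
    intro t
    have : 1 + Real.exp (a - t) = (Real.exp t + Real.exp a) / Real.exp t := by
      rw [Real.exp_sub]; field_simp
    rw [softplus, this, Real.log_div (hpos t).ne' (Real.exp_pos t).ne', Real.log_exp]
  have hderiv : ∀ t : ℝ, HasDerivAt
      (fun t : ℝ => Complex.exp (T * (Real.log (Real.exp t + Real.exp a) : ℝ)) * T⁻¹)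
      (Complex.exp (T * t - (1 - T) * softplus (a - t))) t := by
    intro t
    have h1 : HasDerivAt (fun t : ℝ => Real.log (Real.exp t + Real.exp a))
        (Real.exp t / (Real.exp t + Real.exp a)) t :=
      ((Real.hasDerivAt_exp t).add_const _).log (hpos t).ne'
    have h2 := ((h1.ofReal_comp.const_mul T).cexp).mul_const T⁻¹
    refine h2.congr_deriv ?_
    have h3 : ((Real.exp t / (Real.exp t + Real.exp a) : ℝ) : ℂ) =
        Complex.exp ((t - Real.log (Real.exp t + Real.exp a) : ℝ) : ℂ) := by
      rw [← Complex.ofReal_exp, Real.exp_sub, Real.exp_log (hpos t)]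
    rw [h3, hsp, mul_comm T (Complex.exp _), ← mul_assoc, mul_assoc, mul_inv_cancel₀ hT0, mul_one,
      ← Complex.exp_add]
    congr 1
    push_cast
    ring
  have hlog_a : ∀ t : ℝ, a ≤ Real.log (Real.exp t + Real.exp a) := fun t => by
    rw [Real.le_log_iff_exp_le (hpos t)]; linarith [Real.exp_pos t]
  have hlog_t : ∀ t : ℝ, t ≤ Real.log (Real.exp t + Real.exp a) := fun t => by
    rw [Real.le_log_iff_exp_le (hpos t)]; linarith [Real.exp_pos a]
  set δ : ℝ := min 1 (-T.re) with hδ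
  have hδ0 : 0 < δ := lt_min one_pos (by linarith)
  have hint : Integrable fun t : ℝ => Complex.exp (T * t - (1 - T) * softplus (a - t)) := by
    refine ((integrable_exp_neg_mul_abs hδ0).const_mul
      (1 + Real.exp ((T.re - 1) * a))).mono' ?_ (ae_of_all _ fun t => ?_)
    · refine Continuous.aestronglyMeasurable ?_
      have := continuous_softplus
      fun_prop
    · rw [Complex.norm_exp]
      have hre : (T * t - (1 - T) * softplus (a - t)).re =
          t + (T.re - 1) * Real.log (Real.exp t + Real.exp a) := by
        rw [hsp]
        simp only [Complex.sub_re, Complex.mul_re, Complex.ofReal_re, Complex.ofReal_im,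
          Complex.one_re, mul_zero, sub_zero]
        ring
      rw [hre]
      rcases le_total 0 t with ht | ht
      · have h1 : t + (T.re - 1) * Real.log (Real.exp t + Real.exp a) ≤ -δ * |t| := by
          rw [abs_of_nonneg ht]
          have h2 : δ ≤ -T.re := min_le_right _ _
          nlinarith [hlog_t t]
        calc _ ≤ Real.exp (-δ * |t|) := Real.exp_le_exp.2 h1
          _ ≤ _ := le_mul_of_one_le_left (Real.exp_pos _).le
            (by linarith [Real.exp_pos ((T.re - 1) * a)])
      · have h1 : t + (T.re - 1) * Real.log (Real.exp t + Real.exp a) ≤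
            (T.re - 1) * a + -δ * |t| := by
          rw [abs_of_nonpos ht]
          have h2 : δ ≤ 1 := min_le_left _ _
          nlinarith [hlog_a t]
        calc _ ≤ Real.exp ((T.re - 1) * a + -δ * |t|) := Real.exp_le_exp.2 h1
          _ = Real.exp ((T.re - 1) * a) * Real.exp (-δ * |t|) := Real.exp_add _ _
          _ ≤ _ := mul_le_mul_of_nonneg_right (by linarith) (Real.exp_pos _).le
  have hbot : Tendsto (fun t : ℝ =>
      Complex.exp (T * (Real.log (Real.exp t + Real.exp a) : ℝ)) * T⁻¹) atBot
      (𝓝 (Complex.exp (T * a) * T⁻¹)) := by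
    have h1 : Tendsto (fun t : ℝ => Real.log (Real.exp t + Real.exp a)) atBot (𝓝 a) := by
      have h2 : Tendsto (fun t : ℝ => Real.exp t + Real.exp a) atBot (𝓝 (0 + Real.exp a)) :=
        Real.tendsto_exp_atBot.add_const _
      have h3 := h2.log (by rw [zero_add]; positivity)
      rwa [zero_add, Real.log_exp] at h3
    have h4 : Continuous fun s : ℝ => Complex.exp (T * s) * T⁻¹ := by fun_prop
    exact (h4.tendsto a).comp h1
  have htop : Tendsto (fun t : ℝ =>
      Complex.exp (T * (Real.log (Real.exp t + Real.exp a) : ℝ)) * T⁻¹) atTop (𝓝 0) := by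
    have h1 : Tendsto (fun t : ℝ =>
        Complex.exp (T * (Real.log (Real.exp t + Real.exp a) : ℝ))) atTop (𝓝 0) := by
      rw [tendsto_zero_iff_norm_tendsto_zero]
      have h2 : Tendsto (fun t : ℝ => Real.exp (T.re * t)) atTop (𝓝 0) :=
        Real.tendsto_exp_atBot.comp (tendsto_id.const_mul_atTop_of_neg hT)
      refine squeeze_zero (fun _ => norm_nonneg _) (fun t => ?_) h2
      rw [Complex.norm_exp, Real.exp_le_exp, Complex.re_mul_ofReal]
      nlinarith [hlog_t t]
    simpa using h1.mul_const T⁻¹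
  rw [integral_of_hasDerivAt_of_tendsto hderiv hint hbot htop, zero_sub, inv_neg, mul_neg]

/-- Change of variables from `ℝ ^ n` to a coordinate subspace `ℝ ^ J` and the coefficients of
vectors `ρ k`, `k ∉ J`, that span a complement of it. -/
theorem integral_eq_integral_slice {n : ℕ} (J : Finset (Fin n))
    (ρ : {i // ¬ i ∈ J} → Fin n → ℝ)
    (hdet : (Matrix.of fun i k : {i // ¬ i ∈ J} => ρ k i).det ≠ 0)
    {f : (Fin n → ℝ) → ℂ} (hf : Integrable f) :
    (Integrable fun y : J → ℝ => ∫ t : {i // ¬ i ∈ J} → ℝ,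
      f ((fun i => if h : i ∈ J then y ⟨i, h⟩ else 0) + ∑ k, t k • ρ k)) ∧
    ∫ x, f x = (|(Matrix.of fun i k : {i // ¬ i ∈ J} => ρ k i).det| : ℝ) *
      ∫ y : J → ℝ, ∫ t : {i // ¬ i ∈ J} → ℝ,
        f ((fun i => if h : i ∈ J then y ⟨i, h⟩ else 0) + ∑ k, t k • ρ k) := by
  let M : Matrix (Fin n) (Fin n) ℝ := Matrix.of fun i k =>
    if h : k ∈ J then (if i = k then 1 else 0) else ρ ⟨k, h⟩ i
  set D := (Matrix.of fun i k : {i // ¬ i ∈ J} => ρ k i).det with hD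
  have hM : M.det = D := by
    rw [Matrix.twoBlockTriangular_det M (fun i => i ∈ J)]
    · have h1 : M.toSquareBlockProp (fun i => i ∈ J) = 1 := by
        ext i k
        change (if h : (k : Fin n) ∈ J then (if (i : Fin n) = k then (1 : ℝ) else 0) else
          ρ ⟨k, h⟩ i) = _
        rw [dif_pos k.2, Matrix.one_apply]
        simp only [Subtype.ext_iff]
      have h2 : M.toSquareBlockProp (fun i => ¬ i ∈ J) =
          Matrix.of fun i k : {i // ¬ i ∈ J} => ρ k i := by
        ext i k
        change (if h : (k : Fin n) ∈ J then (if (i : Fin n) = k then (1 : ℝ) else 0) else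
          ρ ⟨k, h⟩ i) = _
        rw [dif_neg k.2]
        rfl
      rw [h1, h2]
      refine (congrArg (· * D) ?_).trans (one_mul D)
      convert! Matrix.det_one (n := {i // i ∈ J}) (R := ℝ)
    · intro i hi k hk
      have : i ≠ k := fun h => hi (h ▸ hk)
      simp [M, hk, this]
  have hmap := Real.map_matrix_volume_pi_eq_smul_volume_pi (M := M) (by rw [hM]; exact hdet)
  have hmeas : Measurable (Matrix.toLin' M) :=
    (Matrix.toLin' M).continuous_of_finiteDimensional.measurable
  have hDpos : 0 < |D|⁻¹ := inv_pos.2 (abs_pos.2 hdet)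
  have hfM : Integrable f (Measure.map (Matrix.toLin' M) volume) := by
    rw [hmap]
    exact hf.smul_measure ENNReal.ofReal_ne_top
  have hint1 : ∫ x, f x = (|D| : ℝ) * ∫ x, f (Matrix.toLin' M x) := by
    rw [← integral_map hmeas.aemeasurable hfM.aestronglyMeasurable, hmap, integral_smul_measure,
      hM, abs_inv, ENNReal.toReal_ofReal hDpos.le, Complex.real_smul, ← mul_assoc,
      ← Complex.ofReal_mul, mul_inv_cancel₀ (abs_pos.2 hdet).ne', Complex.ofReal_one, one_mul]
  have hfM' : Integrable fun x => f (Matrix.toLin' M x) := hfM.comp_measurable hmeas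
  let e := MeasurableEquiv.piEquivPiSubtypeProd (fun _ : Fin n => ℝ) (fun i => i ∈ J)
  have he : MeasurePreserving e.symm := by
    convert! (volume_preserving_piEquivPiSubtypeProd (fun _ : Fin n => ℝ) (fun i => i ∈ J)).symm
  have hkey : ∀ p : (J → ℝ) × ({i // ¬ i ∈ J} → ℝ), Matrix.toLin' M (e.symm p) =
      (fun i => if h : i ∈ J then p.1 ⟨i, h⟩ else 0) + ∑ k, p.2 k • ρ k := by
    intro p
    funext i
    rw [Matrix.toLin'_apply]
    simp only [Matrix.mulVec, dotProduct, Pi.add_apply, Finset.sum_apply, Pi.smul_apply,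
      smul_eq_mul]
    rw [← Fintype.sum_subtype_add_sum_subtype (fun i => i ∈ J)]
    congr 1
    · have : ∀ k : {i // i ∈ J}, M i k * e.symm p k = if i = (k : Fin n) then p.1 k else 0 := by
        intro k
        have hk : e.symm p k = p.1 k := by
          simp [e, MeasurableEquiv.piEquivPiSubtypeProd, Equiv.piEquivPiSubtypeProd, k.2]
        rw [hk]
        simp [M, k.2]
      simp only [this]
      by_cases h : i ∈ J
      · rw [dif_pos h, Finset.sum_eq_single ⟨i, h⟩]
        · simp
        · intro b _ hb
          rw [if_neg]
          intro h'
          exact hb (Subtype.ext h'.symm)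
        · simp
      · rw [dif_neg h]
        refine Finset.sum_eq_zero fun k _ => if_neg ?_
        intro h'
        exact h (h' ▸ k.2)
    · refine Finset.sum_congr rfl fun k _ => ?_
      have hk : e.symm p k = p.2 k := by
        simp [e, MeasurableEquiv.piEquivPiSubtypeProd, Equiv.piEquivPiSubtypeProd, k.2]
      rw [hk]
      simp [M, k.2, mul_comm]
  have hprod : Integrable (fun p : (J → ℝ) × ({i // ¬ i ∈ J} → ℝ) =>
      f ((fun i => if h : i ∈ J then p.1 ⟨i, h⟩ else 0) + ∑ k, p.2 k • ρ k)) := by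
    have := (he.integrable_comp_emb e.symm.measurableEmbedding).2 hfM'
    refine this.congr (ae_of_all _ fun p => ?_)
    simp only [Function.comp, hkey]
  refine ⟨hprod.integral_prod_left, ?_⟩
  rw [hint1, ← he.integral_comp e.symm.measurableEmbedding]
  congr 1
  simp only [hkey]
  exact integral_prod _ hprod

/-! ### Support functions and faces of Newton polytopes -/

section Newton

variable {n m : ℕ}

theorem exists_isMax_support {p : LaurentPoly n} (hp : p ≠ 0) (ρ : Fin n → ℝ) :
    ∃ k ∈ p.coeff.support, tropPoly p ρ = ρ ⬝ᵥ expVec k ∧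
      ∀ z ∈ newtonPolytope p, ρ ⬝ᵥ z ≤ ρ ⬝ᵥ expVec k := by
  have hne : p.coeff.support.Nonempty := by
    rw [Finsupp.support_nonempty_iff]
    exact fun h => hp (AddMonoidAlgebra.coeff_eq_zero.1 h)
  obtain ⟨k, hk, hmax⟩ := p.coeff.support.exists_max_image (fun k => ρ ⬝ᵥ expVec k) hne
  have hz : ∀ z ∈ newtonPolytope p, ρ ⬝ᵥ z ≤ ρ ⬝ᵥ expVec k := by
    intro z hz
    have hconv : Convex ℝ {z : Fin n → ℝ | ρ ⬝ᵥ z ≤ ρ ⬝ᵥ expVec k} :=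
      convex_halfSpace_le ⟨fun a b => dotProduct_add ρ a b, fun c a => dotProduct_smul c ρ a⟩ _
    refine convexHull_min ?_ hconv hz
    rintro _ ⟨l, hl, rfl⟩
    exact hmax l (Finsupp.mem_support_iff.2 hl)
  have hmem : expVec k ∈ newtonPolytope p :=
    subset_convexHull ℝ _ ⟨k, Finsupp.mem_support_iff.1 hk, rfl⟩
  refine ⟨k, hk, ?_, hz⟩
  refine IsGreatest.csSup_eq ⟨⟨_, hmem, rfl⟩, ?_⟩
  rintro _ ⟨z, hz', rfl⟩
  exact hz z hz'

theorem expVec_mem_newtonPolytope {p : LaurentPoly n} {k : Fin n → ℤ}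
    (hk : k ∈ p.coeff.support) : expVec k ∈ newtonPolytope p :=
  subset_convexHull ℝ _ ⟨k, Finsupp.mem_support_iff.1 hk, rfl⟩

theorem dotProduct_le_tropPoly_of_mem {p : LaurentPoly n} (hp : p ≠ 0) (ρ : Fin n → ℝ)
    {z : Fin n → ℝ} (hz : z ∈ newtonPolytope p) : ρ ⬝ᵥ z ≤ tropPoly p ρ := by
  obtain ⟨k, _, h1, h2⟩ := exists_isMax_support hp ρ
  rw [h1]
  exact h2 z hz

theorem dotProduct_le_tropPoly {p : LaurentPoly n} (hp : p ≠ 0) (ρ : Fin n → ℝ)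
    {k : Fin n → ℤ} (hk : k ∈ p.coeff.support) : ρ ⬝ᵥ expVec k ≤ tropPoly p ρ :=
  dotProduct_le_tropPoly_of_mem hp ρ (expVec_mem_newtonPolytope hk)

theorem exists_eq_tropPoly {p : LaurentPoly n} (hp : p ≠ 0) (ρ : Fin n → ℝ) :
    ∃ k ∈ p.coeff.support, ρ ⬝ᵥ expVec k = tropPoly p ρ := by
  obtain ⟨k, hk, h1, _⟩ := exists_isMax_support hp ρ
  exact ⟨k, hk, h1.symm⟩

/-- The exponents of `p` at which `ρ` is maximal. -/
def face (p : LaurentPoly n) (ρ : Fin n → ℝ) : Finset (Fin n → ℤ) :=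
  p.coeff.support.filter fun k => ρ ⬝ᵥ expVec k = tropPoly p ρ

theorem mem_face {p : LaurentPoly n} {ρ : Fin n → ℝ} {k : Fin n → ℤ} :
    k ∈ face p ρ ↔ k ∈ p.coeff.support ∧ ρ ⬝ᵥ expVec k = tropPoly p ρ := Finset.mem_filter

theorem face_nonempty {p : LaurentPoly n} (hp : p ≠ 0) (ρ : Fin n → ℝ) : (face p ρ).Nonempty := by
  obtain ⟨k, hk, h⟩ := exists_eq_tropPoly hp ρ
  exact ⟨k, mem_face.2 ⟨hk, h⟩⟩

theorem tropPoly_eq_of_forall_le {p : LaurentPoly n} (hp : p ≠ 0) {ρ : Fin n → ℝ}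
    {k : Fin n → ℤ} (hk : k ∈ p.coeff.support)
    (h : ∀ l ∈ p.coeff.support, ρ ⬝ᵥ expVec l ≤ ρ ⬝ᵥ expVec k) :
    tropPoly p ρ = ρ ⬝ᵥ expVec k := by
  obtain ⟨l, hl, h1⟩ := exists_eq_tropPoly hp ρ
  exact le_antisymm (h1 ▸ h l hl) (dotProduct_le_tropPoly hp ρ hk)

theorem mem_face_of_forall_le {p : LaurentPoly n} (hp : p ≠ 0) {ρ : Fin n → ℝ}
    {k : Fin n → ℤ} (hk : k ∈ p.coeff.support)
    (h : ∀ l ∈ p.coeff.support, ρ ⬝ᵥ expVec l ≤ ρ ⬝ᵥ expVec k) : k ∈ face p ρ :=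
  mem_face.2 ⟨hk, (tropPoly_eq_of_forall_le hp hk h).symm⟩

theorem le_of_mem_face {p : LaurentPoly n} (hp : p ≠ 0) {ρ : Fin n → ℝ}
    {k l : Fin n → ℤ} (hk : k ∈ face p ρ) (hl : l ∈ p.coeff.support) :
    ρ ⬝ᵥ expVec l ≤ ρ ⬝ᵥ expVec k := by
  rw [(mem_face.1 hk).2]
  exact dotProduct_le_tropPoly hp ρ hl

theorem face_smul {p : LaurentPoly n} (hp : p ≠ 0) {c : ℝ} (hc : 0 < c) (ρ : Fin n → ℝ) :
    face p (c • ρ) = face p ρ := by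
  ext k
  constructor
  · intro hk
    refine mem_face_of_forall_le hp (mem_face.1 hk).1 fun l hl => ?_
    have := le_of_mem_face hp hk hl
    rw [smul_dotProduct, smul_dotProduct] at this
    exact le_of_mul_le_mul_left this hc
  · intro hk
    refine mem_face_of_forall_le hp (mem_face.1 hk).1 fun l hl => ?_
    rw [smul_dotProduct, smul_dotProduct]
    exact mul_le_mul_of_nonneg_left (le_of_mem_face hp hk hl) hc.le

theorem tropPoly_smul {p : LaurentPoly n} (hp : p ≠ 0) {c : ℝ} (hc : 0 ≤ c) (ρ : Fin n → ℝ) :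
    tropPoly p (c • ρ) = c * tropPoly p ρ := by
  obtain ⟨k, hk⟩ := face_nonempty hp ρ
  rw [tropPoly_eq_of_forall_le hp (mem_face.1 hk).1 (ρ := c • ρ), smul_dotProduct,
    (mem_face.1 hk).2, smul_eq_mul]
  intro l hl
  rw [smul_dotProduct, smul_dotProduct]
  exact mul_le_mul_of_nonneg_left (le_of_mem_face hp hk hl) hc

theorem tropPoly_eq_sup' {p : LaurentPoly n} (hp : p ≠ 0) (hne : p.coeff.support.Nonempty)
    (ρ : Fin n → ℝ) :
    tropPoly p ρ = p.coeff.support.sup' hne fun k => ρ ⬝ᵥ expVec k := by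
  refine le_antisymm ?_ (Finset.sup'_le _ _ fun k hk => dotProduct_le_tropPoly hp ρ hk)
  obtain ⟨k, hk, h⟩ := exists_eq_tropPoly hp ρ
  rw [← h]
  exact Finset.le_sup' (fun k => ρ ⬝ᵥ expVec k) hk

theorem continuous_tropPoly {p : LaurentPoly n} (hp : p ≠ 0) : Continuous (tropPoly p) := by
  have hne : p.coeff.support.Nonempty := by
    obtain ⟨k, hk, _⟩ := exists_eq_tropPoly hp 0
    exact ⟨k, hk⟩
  have : tropPoly p = fun ρ => p.coeff.support.sup' hne fun k => ρ ⬝ᵥ expVec k :=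
    funext (tropPoly_eq_sup' hp hne)
  rw [this]
  refine Continuous.finset_sup'_apply hne fun k _ => ?_
  exact Continuous.dotProduct continuous_id continuous_const

/-! ### Products of polynomials with nonnegative coefficients -/

theorem coeff_mul_eq_sum {p q : LaurentPoly n} (k : Fin n → ℤ) :
    (p * q).coeff k = ∑ a ∈ p.coeff.support, ∑ b ∈ q.coeff.support,
      if a + b = k then p.coeff a * q.coeff b else 0 := by
  rw [AddMonoidAlgebra.coeff_mul]
  rfl

/-- Nonnegative coefficients do not cancel: the exponents of a product are exactly the sums of
exponents of the factors. -/
theorem support_prod {P : Fin m → LaurentPoly n} (hPpos : ∀ j k, 0 ≤ (P j).coeff k)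
    (s : Finset (Fin m)) :
    (∀ k, 0 ≤ (∏ j ∈ s, P j).coeff k) ∧
    ∀ k, k ∈ (∏ j ∈ s, P j).coeff.support ↔
      ∃ v : Fin m → Fin n → ℤ, (∀ j ∈ s, v j ∈ (P j).coeff.support) ∧ k = ∑ j ∈ s, v j := by
  induction s using Finset.induction_on with
  | empty =>
    have h1 : ∀ k, (∏ j ∈ (∅ : Finset (Fin m)), P j).coeff k = if k = 0 then (1 : ℝ) else 0 := by
      intro k
      rw [Finset.prod_empty, AddMonoidAlgebra.one_def, AddMonoidAlgebra.coeff_single,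
        Finsupp.single_apply]
      simp only [eq_comm]
    refine ⟨fun k => by rw [h1]; split_ifs <;> norm_num, fun k => ?_⟩
    rw [Finsupp.mem_support_iff, h1]
    simp
  | insert a s ha ih =>
    obtain ⟨ih1, ih2⟩ := ih
    have hnn : ∀ (k b c : Fin n → ℤ), 0 ≤ if b + c = k then
        (P a).coeff b * (∏ j ∈ s, P j).coeff c else 0 := by
      intro k b c
      split_ifs
      · exact mul_nonneg (hPpos _ _) (ih1 _)
      · exact le_rfl
    refine ⟨fun k => ?_, fun k => ?_⟩
    · rw [Finset.prod_insert ha, coeff_mul_eq_sum]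
      exact Finset.sum_nonneg fun b _ => Finset.sum_nonneg fun c _ => hnn k b c
    · rw [Finset.prod_insert ha, Finsupp.mem_support_iff, coeff_mul_eq_sum]
      constructor
      · intro h
        obtain ⟨b, hb, hb'⟩ := Finset.exists_ne_zero_of_sum_ne_zero h
        obtain ⟨c, hc, hc'⟩ := Finset.exists_ne_zero_of_sum_ne_zero hb'
        have hbc : b + c = k := by
          by_contra h'
          exact hc' (if_neg h')
        obtain ⟨v, hv, hcv⟩ := (ih2 c).1 hc
        refine ⟨Function.update v a b, fun j hj => ?_, ?_⟩
        · rcases Finset.mem_insert.1 hj with rfl | hj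
          · simpa using hb
          · rw [Function.update_of_ne (ne_of_mem_of_not_mem hj ha)]
            exact hv j hj
        · rw [Finset.sum_insert ha, Function.update_self, ← hbc, hcv]
          congr 1
          refine Finset.sum_congr rfl fun j hj => ?_
          rw [Function.update_of_ne (ne_of_mem_of_not_mem hj ha)]
      · rintro ⟨v, hv, rfl⟩
        have hc : ∑ j ∈ s, v j ∈ (∏ j ∈ s, P j).coeff.support :=
          (ih2 _).2 ⟨v, fun j hj => hv j (Finset.mem_insert_of_mem hj), rfl⟩
        have hb := hv a (Finset.mem_insert_self a s)
        refine ne_of_gt ?_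
        refine Finset.sum_pos' (fun b _ => Finset.sum_nonneg fun c _ => hnn _ b c) ⟨v a, hb, ?_⟩
        refine Finset.sum_pos' (fun c _ => hnn _ _ c) ⟨_, hc, ?_⟩
        rw [if_pos (Finset.sum_insert ha).symm]
        exact mul_pos (lt_of_le_of_ne (hPpos _ _) (Finsupp.mem_support_iff.1 hb).symm)
          (lt_of_le_of_ne (ih1 _) (Finsupp.mem_support_iff.1 hc).symm)

theorem expVec_sum (s : Finset (Fin m)) (v : Fin m → Fin n → ℤ) :
    expVec (∑ j ∈ s, v j) = ∑ j ∈ s, expVec (v j) := by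
  funext i
  simp [expVec, Finset.sum_apply]

variable {P : Fin m → LaurentPoly n}

theorem sum_expVec_mem_newtonPolytope (hPpos : ∀ j k, 0 ≤ (P j).coeff k)
    {v : Fin m → Fin n → ℤ} (hv : ∀ j, v j ∈ (P j).coeff.support) :
    ∑ j, expVec (v j) ∈ newtonPolytope (∏ j, P j) := by
  rw [← expVec_sum]
  exact expVec_mem_newtonPolytope
    (((support_prod hPpos Finset.univ).2 _).2 ⟨v, fun j _ => hv j, rfl⟩)

theorem dotProduct_le_sum_tropPoly (hP : ∀ j, P j ≠ 0) (hPpos : ∀ j k, 0 ≤ (P j).coeff k)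
    (ρ : Fin n → ℝ) {z : Fin n → ℝ} (hz : z ∈ newtonPolytope (∏ j, P j)) :
    ρ ⬝ᵥ z ≤ ∑ j, tropPoly (P j) ρ := by
  have hconv : Convex ℝ {z : Fin n → ℝ | ρ ⬝ᵥ z ≤ ∑ j, tropPoly (P j) ρ} :=
    convex_halfSpace_le ⟨fun a b => dotProduct_add ρ a b, fun c a => dotProduct_smul c ρ a⟩ _
  refine convexHull_min ?_ hconv hz
  rintro _ ⟨l, hl, rfl⟩
  obtain ⟨v, hv, rfl⟩ := ((support_prod hPpos Finset.univ).2 l).1 (Finsupp.mem_support_iff.2 hl)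
  rw [Set.mem_ofPred_eq, expVec_sum, dotProduct_sum]
  exact Finset.sum_le_sum fun j _ => dotProduct_le_tropPoly (hP j) ρ (hv j (Finset.mem_univ j))

/-- The functional `y ↦ ρ · y`. -/
def dotFunctional (ρ : Fin n → ℝ) : StrongDual ℝ (Fin n → ℝ) :=
  LinearMap.toContinuousLinearMap
    { toFun := fun y => ρ ⬝ᵥ y
      map_add' := fun a b => dotProduct_add ρ a b
      map_smul' := fun c a => dotProduct_smul c ρ a }

theorem normalCone_mem_normalFan {K : Set (Fin n → ℝ)} (ρ : Fin n → ℝ)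
    (hne : {z ∈ K | ∀ y ∈ K, ρ ⬝ᵥ y ≤ ρ ⬝ᵥ z}.Nonempty) :
    normalCone K {z ∈ K | ∀ y ∈ K, ρ ⬝ᵥ y ≤ ρ ⬝ᵥ z} ∈ normalFan K :=
  ⟨_, hne, fun _ => ⟨dotFunctional ρ, rfl⟩, rfl⟩

/-- A finite set of vectors is compatible if and only if every polynomial has an exponent at
which all of them are maximal. -/
theorem compatible_iff (hP : ∀ j, P j ≠ 0) (hPpos : ∀ j k, 0 ≤ (P j).coeff k)
    (S : Finset (Fin n → ℝ)) :
    Compatible (integrandFan P) (S : Set (Fin n → ℝ)) ↔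
      ∃ v : Fin m → Fin n → ℤ, ∀ ρ ∈ S, ∀ j, v j ∈ (P j).coeff.support ∧ v j ∈ face (P j) ρ := by
  set σ : Fin n → ℝ := ∑ ρ ∈ S, ρ with hσ
  have hσdot : ∀ z, σ ⬝ᵥ z = ∑ ρ ∈ S, ρ ⬝ᵥ z := fun z => sum_dotProduct _ _ _
  constructor
  · rintro ⟨_, ⟨F, ⟨z, hz⟩, hF, rfl⟩, hS⟩
    obtain ⟨l, hl⟩ := hF ⟨z, hz⟩
    have hzK : z ∈ newtonPolytope (∏ j, P j) := by
      rw [hl] at hz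
      exact hz.1
    choose v hv using fun j => face_nonempty (hP j) σ
    have hvs : ∀ j, v j ∈ (P j).coeff.support := fun j => (mem_face.1 (hv j)).1
    have hvK := sum_expVec_mem_newtonPolytope hPpos hvs
    have h1 : ∀ ρ ∈ S, ρ ⬝ᵥ ∑ j, expVec (v j) ≤ ρ ⬝ᵥ z := fun ρ hρ => hS hρ z hz _ hvK
    have h2 : σ ⬝ᵥ z ≤ σ ⬝ᵥ ∑ j, expVec (v j) := by
      refine (dotProduct_le_sum_tropPoly hP hPpos σ hzK).trans (le_of_eq ?_)
      rw [dotProduct_sum]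
      exact Finset.sum_congr rfl fun j _ => ((mem_face.1 (hv j)).2).symm
    have h3 : ∀ ρ ∈ S, ρ ⬝ᵥ ∑ j, expVec (v j) = ρ ⬝ᵥ z := by
      rw [← Finset.sum_eq_sum_iff_of_le h1]
      rw [hσdot, hσdot] at h2
      exact le_antisymm (Finset.sum_le_sum h1) h2
    refine ⟨v, fun ρ hρ j => ⟨hvs j, mem_face.2 ⟨hvs j, ?_⟩⟩⟩
    have h4 : ∑ j, tropPoly (P j) ρ ≤ ∑ j, ρ ⬝ᵥ expVec (v j) := by
      choose u hu using fun j => face_nonempty (hP j) ρ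
      have huK := sum_expVec_mem_newtonPolytope hPpos fun j => (mem_face.1 (hu j)).1
      have := hS hρ z hz _ huK
      rw [← h3 ρ hρ, dotProduct_sum, dotProduct_sum] at this
      refine le_trans (le_of_eq ?_) this
      exact Finset.sum_congr rfl fun j _ => ((mem_face.1 (hu j)).2).symm
    have h5 : ∀ j ∈ Finset.univ, ρ ⬝ᵥ expVec (v j) ≤ tropPoly (P j) ρ :=
      fun j _ => dotProduct_le_tropPoly (hP j) ρ (hvs j)
    exact (Finset.sum_eq_sum_iff_of_le h5).1 (le_antisymm (Finset.sum_le_sum h5) h4) j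
      (Finset.mem_univ j)
  · rintro ⟨v, hv⟩
    rcases S.eq_empty_or_nonempty with rfl | ⟨ρ₀, hρ₀⟩
    · choose u hu using fun j => face_nonempty (hP j) 0
      have huK := sum_expVec_mem_newtonPolytope hPpos fun j => (mem_face.1 (hu j)).1
      exact ⟨_, normalCone_mem_normalFan 0 ⟨_, huK, fun y _ => by simp⟩, by simp⟩
    · have hvs : ∀ j, v j ∈ (P j).coeff.support := fun j => (hv ρ₀ hρ₀ j).1
      have hvK := sum_expVec_mem_newtonPolytope hPpos hvs
      have hmax : ∀ ρ ∈ S, ∀ y ∈ newtonPolytope (∏ j, P j),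
          ρ ⬝ᵥ y ≤ ρ ⬝ᵥ ∑ j, expVec (v j) := by
        intro ρ hρ y hy
        refine (dotProduct_le_sum_tropPoly hP hPpos ρ hy).trans (le_of_eq ?_)
        rw [dotProduct_sum]
        exact Finset.sum_congr rfl fun j _ => ((mem_face.1 (hv ρ hρ j).2).2).symm
      refine ⟨_, normalCone_mem_normalFan (K := newtonPolytope (∏ j, P j)) σ
        ⟨_, hvK, fun y hy => ?_⟩, ?_⟩
      · rw [hσdot, hσdot]
        exact Finset.sum_le_sum fun ρ hρ => hmax ρ hρ y hy
      · intro ρ hρ z hz y hy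
        have h1 := hz.2 _ hvK
        rw [hσdot, hσdot] at h1
        have h2 : ∀ ρ ∈ S, ρ ⬝ᵥ z ≤ ρ ⬝ᵥ ∑ j, expVec (v j) := fun ρ hρ => hmax ρ hρ z hz.1
        have h3 := (Finset.sum_eq_sum_iff_of_le h2).1 (le_antisymm (Finset.sum_le_sum h2) h1) ρ hρ
        rw [h3]
        exact hmax ρ hρ y hy

theorem eq_zero_of_forall_dotProduct_eq (hP : ∀ j, P j ≠ 0) (hPpos : ∀ j k, 0 ≤ (P j).coeff k)
    (hfull : (interior (newtonPolytope (∏ j, P j))).Nonempty) {d : Fin n → ℝ}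
    (hd : ∀ j, ∀ u ∈ (P j).coeff.support, ∀ v ∈ (P j).coeff.support,
      d ⬝ᵥ expVec u = d ⬝ᵥ expVec v) : d = 0 := by
  have hsum : ∀ y ∈ newtonPolytope (∏ j, P j), ∀ z ∈ newtonPolytope (∏ j, P j),
      d ⬝ᵥ y = d ⬝ᵥ z := by
    have hle : ∀ y ∈ newtonPolytope (∏ j, P j), d ⬝ᵥ y = ∑ j, tropPoly (P j) d := by
      intro y hy
      refine le_antisymm (dotProduct_le_sum_tropPoly hP hPpos d hy) ?_
      have h1 := dotProduct_le_sum_tropPoly hP hPpos (-d) hy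
      have h2 : ∀ j, tropPoly (P j) (-d) = - tropPoly (P j) d := by
        intro j
        obtain ⟨k, hk⟩ := face_nonempty (hP j) d
        rw [← (mem_face.1 hk).2, ← neg_dotProduct]
        refine tropPoly_eq_of_forall_le (hP j) (mem_face.1 hk).1 fun l hl => ?_
        rw [neg_dotProduct, neg_dotProduct, hd j l hl k (mem_face.1 hk).1]
      simp only [h2, Finset.sum_neg_distrib, neg_dotProduct] at h1
      linarith
    intro y hy z hz
    rw [hle y hy, hle z hz]
  obtain ⟨z, hz⟩ := hfull
  have hcont : Continuous fun t : ℝ => z + t • d := by fun_prop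
  have hnhds : ∀ᶠ t in 𝓝 (0 : ℝ), z + t • d ∈ newtonPolytope (∏ j, P j) := by
    refine hcont.continuousAt.eventually ?_
    simpa using mem_interior_iff_mem_nhds.1 hz
  obtain ⟨t, ht, ht0⟩ := ((hnhds.filter_mono (nhdsWithin_le_nhds (s := Set.Ioi 0))).and
    (self_mem_nhdsWithin (a := (0 : ℝ)) (s := Set.Ioi 0))).exists
  have h1 := hsum _ ht z (interior_subset hz)
  rw [dotProduct_add, dotProduct_smul, smul_eq_mul] at h1
  have h2 : t * (d ⬝ᵥ d) = 0 := by linarith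
  rcases mul_eq_zero.1 h2 with h3 | h3
  · exact absurd h3 (ne_of_gt ht0)
  · exact dotProduct_self_eq_zero.1 h3

theorem mem_hull_singleton {x y : Fin n → ℝ} :
    y ∈ PointedCone.hull ℝ {x} ↔ ∃ c : ℝ, 0 ≤ c ∧ y = c • x := by
  rw [PointedCone.hull, Submodule.mem_span_singleton]
  constructor
  · rintro ⟨c, rfl⟩
    exact ⟨c, c.2, rfl⟩
  · rintro ⟨c, hc, rfl⟩
    exact ⟨⟨c, hc⟩, rfl⟩

theorem coneDim_hull (S : Set (Fin n → ℝ)) :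
    coneDim (PointedCone.hull ℝ S) = Module.finrank ℝ (Submodule.span ℝ S) := by
  have : Submodule.span ℝ ((PointedCone.hull ℝ S : PointedCone ℝ (Fin n → ℝ)) :
      Set (Fin n → ℝ)) = Submodule.span ℝ S := by
    refine le_antisymm (Submodule.span_le.2 ?_) (Submodule.span_mono PointedCone.subset_hull)
    exact PointedCone.hull_le_span ℝ S
  rw [coneDim, this]

/-- The combinatorial properties of the rays `R` of the normal fan of the product of the `P j`,
expressed through the faces of the individual factors. -/
structure IsFanRays (P : Fin m → LaurentPoly n) (R : Finset (Fin n → ℝ)) : Prop where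
  ne_zero : ∀ j, P j ≠ 0
  /-- The fan is pointed. -/
  pointed : ∀ d : Fin n → ℝ, (∀ j, ∀ u ∈ (P j).coeff.support, ∀ v ∈ (P j).coeff.support,
    d ⬝ᵥ expVec u = d ⬝ᵥ expVec v) → d = 0
  /-- Vectors in the relative interior of a one-dimensional cone are multiples of rays. -/
  exists_ray : ∀ x : Fin n → ℝ, x ≠ 0 →
    (∀ d : Fin n → ℝ, (∀ j, ∀ u ∈ face (P j) x, ∀ v ∈ face (P j) x,
      d ⬝ᵥ expVec u = d ⬝ᵥ expVec v) → ∃ t : ℝ, d = t • x) →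
    ∃ ρ ∈ R, ∃ c : ℝ, 0 < c ∧ x = c • ρ
  ray_ne_zero : ∀ ρ ∈ R, ρ ≠ 0
  /-- Rays are extremal. -/
  extremal : ∀ ρ ∈ R, ∀ s : Fin n → ℝ, (∀ j, face (P j) ρ ⊆ face (P j) s) →
    ∃ c : ℝ, 0 ≤ c ∧ s = c • ρ
  /-- There is only one ray in each direction. -/
  unique : ∀ ρ ∈ R, ∀ ρ' ∈ R, ∀ c : ℝ, 0 ≤ c → ρ' = c • ρ → ρ' = ρ

theorem isFanRays (hP : ∀ j, P j ≠ 0) (hPpos : ∀ j k, 0 ≤ (P j).coeff k)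
    (hfull : (interior (newtonPolytope (∏ j, P j))).Nonempty)
    {R : Finset (Fin n → ℝ)} (hR : IsRaySystem (integrandFan P) R) : IsFanRays P R where
  ne_zero := hP
  pointed d hd := eq_zero_of_forall_dotProduct_eq hP hPpos hfull hd
  exists_ray := by
    intro x hx hW
    set K := newtonPolytope (∏ j, P j) with hK
    set F := {z ∈ K | ∀ y ∈ K, x ⬝ᵥ y ≤ x ⬝ᵥ z} with hF
    -- sums of maximal exponents are maximal
    have hface : ∀ v : Fin m → Fin n → ℤ, (∀ j, v j ∈ face (P j) x) →
        ∑ j, expVec (v j) ∈ F := by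
      intro v hv
      refine ⟨sum_expVec_mem_newtonPolytope hPpos fun j => (mem_face.1 (hv j)).1, fun y hy => ?_⟩
      refine (dotProduct_le_sum_tropPoly hP hPpos x hy).trans (le_of_eq ?_)
      rw [dotProduct_sum]
      exact Finset.sum_congr rfl fun j _ => ((mem_face.1 (hv j)).2).symm
    choose v₀ hv₀ using fun j => face_nonempty (hP j) x
    have hcone : normalCone K F = PointedCone.hull ℝ {x} := by
      ext d
      rw [mem_hull_singleton]
      constructor
      · intro hd
        obtain ⟨t, rfl⟩ := hW d (by
          intro j u hu v hv
          have h1 : ∀ u ∈ face (P j) x, ∀ v ∈ face (P j) x,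
              d ⬝ᵥ expVec u ≤ d ⬝ᵥ expVec v := by
            intro u hu v hv
            have hmem : ∀ w ∈ face (P j) x, ∀ i, Function.update v₀ j w i ∈ face (P i) x := by
              intro w hw i
              by_cases hi : i = j
              · subst hi; simpa using hw
              · rw [Function.update_of_ne hi]; exact hv₀ i
            have h2 := hd _ (hface _ (hmem v hv)) _ (hface _ (hmem u hu)).1
            rw [dotProduct_sum, dotProduct_sum, ← Finset.add_sum_erase _ _ (Finset.mem_univ j),
              ← Finset.add_sum_erase _ _ (Finset.mem_univ j)] at h2
            have h3 : ∀ w, ∑ i ∈ Finset.univ.erase j, d ⬝ᵥ expVec (Function.update v₀ j w i) =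
                ∑ i ∈ Finset.univ.erase j, d ⬝ᵥ expVec (v₀ i) := by
              intro w
              refine Finset.sum_congr rfl fun i hi => ?_
              rw [Function.update_of_ne (Finset.ne_of_mem_erase hi)]
            rw [h3, h3, Function.update_self, Function.update_self] at h2
            linarith
          exact le_antisymm (h1 u hu v hv) (h1 v hv u hu))
        refine ⟨t, ?_, rfl⟩
        by_contra ht
        push Not at ht
        -- otherwise `x` and `-x` would both be maximal on the face
        refine hx (eq_zero_of_forall_dotProduct_eq hP hPpos hfull ?_)
        have h1 : ∀ j, ∀ u ∈ (P j).coeff.support, x ⬝ᵥ expVec u = x ⬝ᵥ expVec (v₀ j) := by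
          intro j u hu
          refine le_antisymm (le_of_mem_face (hP j) (hv₀ j) hu) ?_
          have hmem : ∀ i, Function.update v₀ j u i ∈ (P i).coeff.support := by
            intro i
            by_cases hi : i = j
            · subst hi; simpa using hu
            · rw [Function.update_of_ne hi]; exact (mem_face.1 (hv₀ i)).1
          have h2 := hd _ (hface _ hv₀) _ (sum_expVec_mem_newtonPolytope hPpos hmem)
          rw [smul_dotProduct, smul_dotProduct, smul_eq_mul, smul_eq_mul,
            mul_le_mul_left_of_neg ht, dotProduct_sum, dotProduct_sum,
            ← Finset.add_sum_erase _ _ (Finset.mem_univ j),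
            ← Finset.add_sum_erase _ _ (Finset.mem_univ j)] at h2
          have h3 : ∑ i ∈ Finset.univ.erase j, x ⬝ᵥ expVec (Function.update v₀ j u i) =
              ∑ i ∈ Finset.univ.erase j, x ⬝ᵥ expVec (v₀ i) := by
            refine Finset.sum_congr rfl fun i hi => ?_
            rw [Function.update_of_ne (Finset.ne_of_mem_erase hi)]
          rw [h3, Function.update_self] at h2
          linarith
        intro j u hu v hv
        rw [h1 j u hu, h1 j v hv]
      · rintro ⟨c, hc, rfl⟩ z hz y hy
        rw [smul_dotProduct, smul_dotProduct]
        exact mul_le_mul_of_nonneg_left (hz.2 y hy) hc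
    have hmem : PointedCone.hull ℝ {x} ∈ integrandFan P := by
      rw [← hcone]
      exact normalCone_mem_normalFan x ⟨_, hface v₀ hv₀⟩
    obtain ⟨ρ, ⟨hρ, hρ'⟩, _⟩ := hR.2 _ hmem
      (by rw [coneDim_hull]; exact finrank_span_singleton hx)
    have hxm : x ∈ PointedCone.hull ℝ {ρ} := by
      rw [← hρ']
      exact mem_hull_singleton.2 ⟨1, zero_le_one, (one_smul ℝ x).symm⟩
    obtain ⟨c, hc, hxc⟩ := mem_hull_singleton.1 hxm
    refine ⟨ρ, hρ, c, lt_of_le_of_ne hc ?_, hxc⟩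
    rintro rfl
    exact hx (by rw [hxc, zero_smul])
  ray_ne_zero ρ hρ := (hR.1 ρ hρ).1
  extremal := by
    intro ρ hρ s hs
    obtain ⟨F, ⟨z₀, hz₀⟩, hF, hcone⟩ := (hR.1 ρ hρ).2
    rw [← mem_hull_singleton, hcone]
    have hρm : ρ ∈ normalCone (newtonPolytope (∏ j, P j)) F := by
      rw [← hcone]
      exact mem_hull_singleton.2 ⟨1, zero_le_one, (one_smul ℝ ρ).symm⟩
    intro z hz y hy
    have hzK : z ∈ newtonPolytope (∏ j, P j) := by
      obtain ⟨l, hl⟩ := hF ⟨z, hz⟩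
      rw [hl] at hz
      exact hz.1
    refine (dotProduct_le_sum_tropPoly hP hPpos s hy).trans ?_
    -- a large multiple of the defect of `ρ` bounds the defect of `s`
    let lam : ℝ := ∑ k ∈ (∏ j, P j).coeff.support,
      (∑ j, tropPoly (P j) s - s ⬝ᵥ expVec k) / (∑ j, tropPoly (P j) ρ - ρ ⬝ᵥ expVec k)
    have hdef : ∀ (ρ : Fin n → ℝ), ∀ k ∈ (∏ j, P j).coeff.support,
        0 ≤ ∑ j, tropPoly (P j) ρ - ρ ⬝ᵥ expVec k := fun ρ k hk =>
      sub_nonneg.2 (dotProduct_le_sum_tropPoly hP hPpos ρ (expVec_mem_newtonPolytope hk))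
    have hlam : ∀ k ∈ (∏ j, P j).coeff.support, ∑ j, tropPoly (P j) s - s ⬝ᵥ expVec k ≤
        lam * (∑ j, tropPoly (P j) ρ - ρ ⬝ᵥ expVec k) := by
      intro k hk
      rcases (hdef ρ k hk).eq_or_lt with h0 | h0
      · rw [← h0, mul_zero]
        obtain ⟨v, hv, rfl⟩ := ((support_prod hPpos Finset.univ).2 k).1 hk
        rw [expVec_sum, dotProduct_sum] at h0
        have h1 : ∀ j ∈ Finset.univ, ρ ⬝ᵥ expVec (v j) ≤ tropPoly (P j) ρ :=
          fun j hj => dotProduct_le_tropPoly (hP j) ρ (hv j hj)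
        have h2 := (Finset.sum_eq_sum_iff_of_le h1).1 (by linarith)
        rw [expVec_sum, dotProduct_sum, sub_nonpos]
        refine Finset.sum_le_sum fun j hj => le_of_eq ?_
        exact ((mem_face.1 (hs j (mem_face.2 ⟨hv j hj, h2 j hj⟩))).2).symm
      · rw [← div_le_iff₀ h0]
        exact Finset.single_le_sum (f := fun k => (∑ j, tropPoly (P j) s - s ⬝ᵥ expVec k) /
          (∑ j, tropPoly (P j) ρ - ρ ⬝ᵥ expVec k))
          (fun k hk => div_nonneg (hdef s k hk) (hdef ρ k hk)) hk
    have hconv : Convex ℝ {z : Fin n → ℝ | (lam • ρ - s) ⬝ᵥ z ≤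
        lam * (∑ j, tropPoly (P j) ρ) - ∑ j, tropPoly (P j) s} :=
      convex_halfSpace_le ⟨fun a b => dotProduct_add _ a b, fun c a => dotProduct_smul c _ a⟩ _
    have hz2 : (lam • ρ - s) ⬝ᵥ z ≤
        lam * (∑ j, tropPoly (P j) ρ) - ∑ j, tropPoly (P j) s := by
      refine convexHull_min ?_ hconv hzK
      rintro _ ⟨k, hk, rfl⟩
      have := hlam k (Finsupp.mem_support_iff.2 hk)
      rw [Set.mem_ofPred_eq, sub_dotProduct, smul_dotProduct, smul_eq_mul]
      linarith
    have hz3 : ρ ⬝ᵥ z = ∑ j, tropPoly (P j) ρ := by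
      refine le_antisymm (dotProduct_le_sum_tropPoly hP hPpos ρ hzK) ?_
      choose u hu using fun j => face_nonempty (hP j) ρ
      have := hρm z hz _ (sum_expVec_mem_newtonPolytope hPpos fun j => (mem_face.1 (hu j)).1)
      rw [dotProduct_sum] at this
      refine le_trans (le_of_eq ?_) this
      exact Finset.sum_congr rfl fun j _ => ((mem_face.1 (hu j)).2).symm
    rw [sub_dotProduct, smul_dotProduct, smul_eq_mul, hz3] at hz2
    linarith
  unique := by
    intro ρ hρ ρ' hρ' c hc h
    have hc' : c ≠ 0 := by
      rintro rfl
      exact (hR.1 ρ' hρ').1 (by rw [h, zero_smul])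
    have hhull : PointedCone.hull ℝ {ρ} = PointedCone.hull ℝ {ρ'} := by
      ext y
      rw [mem_hull_singleton, mem_hull_singleton]
      constructor
      · rintro ⟨a, ha, rfl⟩
        exact ⟨a / c, div_nonneg ha hc, by rw [h, smul_smul, div_mul_cancel₀ _ hc']⟩
      · rintro ⟨a, ha, rfl⟩
        exact ⟨a * c, mul_nonneg ha hc, by rw [h, smul_smul]⟩
    have hdim : coneDim (PointedCone.hull ℝ {ρ}) = 1 := by
      rw [coneDim_hull]
      exact finrank_span_singleton (hR.1 ρ hρ).1
    exact (hR.2 _ (hR.1 ρ hρ).2 hdim).unique ⟨hρ', hhull⟩ ⟨hρ, rfl⟩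

end Newton

/-! ### Decomposition into rays -/

section Rays

variable {n m : ℕ} {P : Fin m → LaurentPoly n} {R : Finset (Fin n → ℝ)}

/-- Every vector is a nonnegative combination of rays of the cone in whose relative interior it
lies. If `x` is not itself on a ray, there is a `d`, not a multiple of `x`, that is constant on the
faces of `x`. Subtracting from `± d` the largest multiples of `x` that keep these faces maximal
gives two vectors with strictly larger faces, and `x` is a positive multiple of their sum. -/
theorem IsFanRays.exists_decomposition (H : IsFanRays P R) (x : Fin n → ℝ) :
    ∃ c : (Fin n → ℝ) → ℝ, (∀ ρ, 0 ≤ c ρ) ∧ x = ∑ ρ ∈ R, c ρ • ρ ∧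
      ∀ ρ ∈ R, c ρ ≠ 0 → ∀ j, face (P j) x ⊆ face (P j) ρ := by
  induction hN : ∑ j, ((P j).coeff.support \ face (P j) x).card using Nat.strong_induction_on
    generalizing x with
  | _ N ih =>
  by_cases hx : x = 0
  · exact ⟨fun _ => 0, fun _ => le_rfl, by simp [hx], fun ρ _ h => absurd rfl h⟩
  by_cases hW : ∀ d : Fin n → ℝ, (∀ j, ∀ u ∈ face (P j) x, ∀ v ∈ face (P j) x,
      d ⬝ᵥ expVec u = d ⬝ᵥ expVec v) → ∃ t : ℝ, d = t • x
  · obtain ⟨ρ, hρ, a, ha, hxa⟩ := H.exists_ray x hx hW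
    refine ⟨fun s => if s = ρ then a else 0, fun s => ?_, ?_, ?_⟩
    · simp only
      split_ifs
      · exact ha.le
      · exact le_rfl
    · simp [hρ, hxa]
    · intro s _ hs j
      have : s = ρ := by
        by_contra h
        exact hs (if_neg h)
      rw [this, hxa, face_smul (H.ne_zero j) ha]
  · push Not at hW
    obtain ⟨d, hd, hdx⟩ := hW
    choose a ha using fun j => face_nonempty (H.ne_zero j) x
    let I : Finset (Σ _ : Fin m, Fin n → ℤ) :=
      Finset.univ.sigma fun j => (P j).coeff.support \ face (P j) x
    have hmemI : ∀ j v, (⟨j, v⟩ : Σ _ : Fin m, Fin n → ℤ) ∈ I ↔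
        v ∈ (P j).coeff.support ∧ v ∉ face (P j) x := by
      intro j v
      simp [I]
    let g : (Σ _ : Fin m, Fin n → ℤ) → ℝ := fun i => x ⬝ᵥ expVec (a i.1) - x ⬝ᵥ expVec i.2
    have hg : ∀ i ∈ I, 0 < g i := by
      rintro ⟨j, v⟩ hi
      obtain ⟨h1, h2⟩ := (hmemI j v).1 hi
      refine sub_pos.2 (lt_of_le_of_ne (le_of_mem_face (H.ne_zero j) (ha j) h1) fun h => h2 ?_)
      exact mem_face.2 ⟨h1, by rw [h]; exact (mem_face.1 (ha j)).2⟩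
    let r : (Σ _ : Fin m, Fin n → ℤ) → ℝ := fun i =>
      (d ⬝ᵥ expVec (a i.1) - d ⬝ᵥ expVec i.2) / g i
    have hr : ∀ i ∈ I, d ⬝ᵥ expVec (a i.1) - d ⬝ᵥ expVec i.2 = r i * g i := fun i hi =>
      (div_mul_cancel₀ _ (hg i hi).ne').symm
    have hI : I.Nonempty := by
      by_contra hI
      rw [Finset.not_nonempty_iff_eq_empty] at hI
      have hall : ∀ j, ∀ v ∈ (P j).coeff.support, v ∈ face (P j) x := by
        intro j v hv
        by_contra h
        have := (hmemI j v).2 ⟨hv, h⟩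
        rw [hI] at this
        exact absurd this (Finset.notMem_empty _)
      refine hx (H.pointed x fun j u hu v hv => ?_)
      rw [(mem_face.1 (hall j u hu)).2, (mem_face.1 (hall j v hv)).2]
    obtain ⟨i₀, hi₀, hmin⟩ := I.exists_min_image r hI
    obtain ⟨i₁, hi₁, hmax⟩ := I.exists_max_image r hI
    -- the two vectors on the boundary of the cone of `x`
    have hkey : ∀ (s b : ℝ), (∀ i ∈ I, 0 ≤ s * r i + b) → (∃ i ∈ I, s * r i + b = 0) →
        ∃ c : (Fin n → ℝ) → ℝ, (∀ ρ, 0 ≤ c ρ) ∧ s • d + b • x = ∑ ρ ∈ R, c ρ • ρ ∧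
          ∀ ρ ∈ R, c ρ ≠ 0 → ∀ j, face (P j) x ⊆ face (P j) ρ := by
      rintro s b hnn ⟨⟨j₀, v₀⟩, hi, hi0⟩
      set y := s • d + b • x with hy
      have hydot : ∀ z, y ⬝ᵥ z = s * (d ⬝ᵥ z) + b * (x ⬝ᵥ z) := by
        intro z
        rw [hy, add_dotProduct, smul_dotProduct, smul_dotProduct, smul_eq_mul, smul_eq_mul]
      have hyI : ∀ i ∈ I, y ⬝ᵥ expVec (a i.1) - y ⬝ᵥ expVec i.2 = (s * r i + b) * g i := by
        intro i hi
        have h1 := hr i hi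
        have h2 : g i = x ⬝ᵥ expVec (a i.1) - x ⬝ᵥ expVec i.2 := rfl
        rw [hydot, hydot]
        linear_combination s * h1 - b * h2
      have hyf : ∀ j, ∀ v ∈ face (P j) x, y ⬝ᵥ expVec v = y ⬝ᵥ expVec (a j) := by
        intro j v hv
        rw [hydot, hydot, hd j v hv (a j) (ha j), (mem_face.1 hv).2, (mem_face.1 (ha j)).2]
      have hle : ∀ j, ∀ v ∈ (P j).coeff.support, y ⬝ᵥ expVec v ≤ y ⬝ᵥ expVec (a j) := by
        intro j v hv
        by_cases hvf : v ∈ face (P j) x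
        · exact (hyf j v hvf).le
        · have hi := (hmemI j v).2 ⟨hv, hvf⟩
          have := hyI _ hi
          have h2 := mul_nonneg (hnn _ hi) (hg _ hi).le
          linarith
      have haj : ∀ j, a j ∈ face (P j) y := fun j =>
        mem_face_of_forall_le (H.ne_zero j) (mem_face.1 (ha j)).1 (hle j)
      have hmem : ∀ j, ∀ v ∈ (P j).coeff.support, y ⬝ᵥ expVec v = y ⬝ᵥ expVec (a j) →
          v ∈ face (P j) y := fun j v hv h =>
        mem_face.2 ⟨hv, h.trans (mem_face.1 (haj j)).2⟩
      have hsub : ∀ j, face (P j) x ⊆ face (P j) y := fun j v hv =>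
        hmem j v (mem_face.1 hv).1 (hyf j v hv)
      have hlt : ∑ j, ((P j).coeff.support \ face (P j) y).card < N := by
        rw [← hN]
        refine Finset.sum_lt_sum
          (fun j _ => Finset.card_le_card (Finset.sdiff_subset_sdiff subset_rfl (hsub j)))
          ⟨j₀, Finset.mem_univ _, ?_⟩
        obtain ⟨h1, h2⟩ := (hmemI j₀ v₀).1 hi
        refine Finset.card_lt_card ((Finset.ssubset_iff_of_subset
          (Finset.sdiff_subset_sdiff subset_rfl (hsub j₀))).2 ⟨v₀, ?_, ?_⟩)
        · exact Finset.mem_sdiff.2 ⟨h1, h2⟩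
        · have h3 := hyI _ hi
          rw [hi0, zero_mul] at h3
          have h4 : v₀ ∈ face (P j₀) y := hmem j₀ v₀ h1 (by simpa using (sub_eq_zero.1 h3).symm)
          simp [h4]
      obtain ⟨c, hc1, hc2, hc3⟩ := ih _ hlt y rfl
      exact ⟨c, hc1, hc2, fun ρ hρ h j => (hsub j).trans (hc3 ρ hρ h j)⟩
    obtain ⟨c₁, hc₁, hd₁, hf₁⟩ := hkey 1 (-r i₀) (fun i hi => by linarith [hmin i hi])
      ⟨i₀, hi₀, by ring⟩
    obtain ⟨c₂, hc₂, hd₂, hf₂⟩ := hkey (-1) (r i₁) (fun i hi => by linarith [hmax i hi])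
      ⟨i₁, hi₁, by ring⟩
    have hlt : r i₀ < r i₁ := by
      refine lt_of_le_of_ne (hmin i₁ hi₁) fun heq => hdx (r i₀) ?_
      have hri : ∀ i ∈ I, r i = r i₀ := fun i hi =>
        le_antisymm ((hmax i hi).trans heq.ge) (hmin i hi)
      rw [← sub_eq_zero]
      refine H.pointed _ ?_
      have h1 : ∀ j, ∀ u ∈ (P j).coeff.support,
          (d - r i₀ • x) ⬝ᵥ expVec u = (d - r i₀ • x) ⬝ᵥ expVec (a j) := by
        intro j u hu
        rw [sub_dotProduct, sub_dotProduct, smul_dotProduct, smul_dotProduct, smul_eq_mul,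
          smul_eq_mul]
        by_cases huf : u ∈ face (P j) x
        · rw [hd j u huf (a j) (ha j), (mem_face.1 huf).2, (mem_face.1 (ha j)).2]
        · have hi := (hmemI j u).2 ⟨hu, huf⟩
          have h1 := hr _ hi
          rw [hri _ hi] at h1
          have h2 : g ⟨j, u⟩ = x ⬝ᵥ expVec (a j) - x ⬝ᵥ expVec u := rfl
          rw [h2] at h1
          simp only at h1
          linarith
      intro j u hu v hv
      rw [h1 j u hu, h1 j v hv]
    have hpos : 0 < r i₁ - r i₀ := sub_pos.2 hlt
    refine ⟨fun ρ => (r i₁ - r i₀)⁻¹ * (c₁ ρ + c₂ ρ),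
      fun ρ => mul_nonneg (inv_pos.2 hpos).le (add_nonneg (hc₁ ρ) (hc₂ ρ)), ?_, ?_⟩
    · simp only [mul_smul, add_smul, ← Finset.smul_sum, Finset.sum_add_distrib, ← hd₁, ← hd₂]
      have : (1 : ℝ) • d + -r i₀ • x + ((-1 : ℝ) • d + r i₁ • x) = (r i₁ - r i₀) • x := by
        module
      rw [this, smul_smul, inv_mul_cancel₀ hpos.ne', one_smul]
    · intro ρ hρ h j
      by_cases h1 : c₁ ρ = 0
      · refine hf₂ ρ hρ (fun h2 => h ?_) j
        simp [h1, h2]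
      · exact hf₁ ρ hρ h1 j

/-! ### Compatible sets of rays and initial forms -/

/-- Every polynomial has an exponent at which all elements of `S` are maximal. -/
def Joint (P : Fin m → LaurentPoly n) (S : Finset (Fin n → ℝ)) : Prop :=
  ∃ v : Fin m → Fin n → ℤ, (∀ j, v j ∈ (P j).coeff.support) ∧
    ∀ ρ ∈ S, ∀ j, v j ∈ face (P j) ρ

theorem Joint.mono {S T : Finset (Fin n → ℝ)} (h : Joint P T) (hST : S ⊆ T) : Joint P S := by
  obtain ⟨v, hvs, hv⟩ := h
  exact ⟨v, hvs, fun ρ hρ => hv ρ (hST hρ)⟩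

theorem compatible_iff_joint (hP : ∀ j, P j ≠ 0) (hPpos : ∀ j k, 0 ≤ (P j).coeff k)
    (S : Finset (Fin n → ℝ)) :
    Compatible (integrandFan P) (S : Set (Fin n → ℝ)) ↔ Joint P S := by
  rw [compatible_iff hP hPpos]
  constructor
  · rintro ⟨v, hv⟩
    rcases S.eq_empty_or_nonempty with rfl | ⟨ρ, hρ⟩
    · choose u hu using fun j => face_nonempty (hP j) 0
      exact ⟨u, fun j => (mem_face.1 (hu j)).1, by simp⟩
    · exact ⟨v, fun j => (hv ρ hρ j).1, fun ρ hρ j => (hv ρ hρ j).2⟩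
  · rintro ⟨v, hvs, hv⟩
    exact ⟨v, fun ρ hρ j => ⟨hvs j, hv ρ hρ j⟩⟩

/-- The initial forms of the polynomials `P j` along the cone spanned by `S`. -/
def initialForms (P : Fin m → LaurentPoly n) (S : Finset (Fin n → ℝ)) : Fin m → LaurentPoly n :=
  fun j => initialForm (P j) (PointedCone.hull ℝ (S : Set (Fin n → ℝ)))

theorem coeff_initialForms_nonneg (hPpos : ∀ j k, 0 ≤ (P j).coeff k) (S : Finset (Fin n → ℝ))
    (j : Fin m) (k : Fin n → ℤ) : 0 ≤ (initialForms P S j).coeff k := by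
  rw [initialForms, initialForm, AddMonoidAlgebra.coeff_ofCoeff, Finsupp.filter_apply]
  split_ifs
  · exact hPpos j k
  · exact le_rfl

theorem coeff_initialForms_of_mem {S : Finset (Fin n → ℝ)} {j : Fin m} {k : Fin n → ℤ}
    (hk : k ∈ (initialForms P S j).coeff.support) :
    (initialForms P S j).coeff k = (P j).coeff k := by
  rw [initialForms, initialForm, AddMonoidAlgebra.coeff_ofCoeff] at hk ⊢
  rw [Finsupp.support_filter, Finset.mem_filter] at hk
  rw [Finsupp.filter_apply, if_pos hk.2]

theorem mem_support_initialForms (hP : ∀ j, P j ≠ 0) {S : Finset (Fin n → ℝ)} {j : Fin m}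
    {k : Fin n → ℤ} : k ∈ (initialForms P S j).coeff.support ↔
      k ∈ (P j).coeff.support ∧ ∀ ρ ∈ S, k ∈ face (P j) ρ := by
  rw [initialForms, initialForm, AddMonoidAlgebra.coeff_ofCoeff, Finsupp.support_filter,
    Finset.mem_filter]
  refine and_congr_right fun hk => ⟨fun h ρ hρ => ?_, fun h ρ hρ => ?_⟩
  · exact mem_face.2 ⟨hk, h ρ (PointedCone.subset_hull hρ)⟩
  · suffices k ∈ face (P j) ρ from (mem_face.1 this).2
    refine Submodule.span_induction (p := fun ρ _ => k ∈ face (P j) ρ) ?_ ?_ ?_ ?_ hρ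
    · intro ρ hρ
      exact h ρ hρ
    · exact mem_face_of_forall_le (hP j) hk fun l _ => by simp
    · intro a b _ _ ha hb
      refine mem_face_of_forall_le (hP j) hk fun l hl => ?_
      rw [add_dotProduct, add_dotProduct]
      exact add_le_add (le_of_mem_face (hP j) ha hl) (le_of_mem_face (hP j) hb hl)
    · intro c a _ ha
      refine mem_face_of_forall_le (hP j) hk fun l hl => ?_
      have h1 : (c • a) = (c : ℝ) • a := rfl
      rw [h1, smul_dotProduct, smul_dotProduct]
      exact mul_le_mul_of_nonneg_left (le_of_mem_face (hP j) ha hl) c.2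

theorem initialForms_ne_zero (hP : ∀ j, P j ≠ 0) {S : Finset (Fin n → ℝ)} (hS : Joint P S)
    (j : Fin m) : initialForms P S j ≠ 0 := by
  obtain ⟨v, hvs, hv⟩ := hS
  have hk : v j ∈ (initialForms P S j).coeff.support :=
    (mem_support_initialForms hP).2 ⟨hvs j, fun ρ hρ => hv ρ hρ j⟩
  intro h
  rw [h] at hk
  simp at hk

theorem initialForms_empty (hP : ∀ j, P j ≠ 0) : initialForms P ∅ = P := by
  funext j
  refine AddMonoidAlgebra.coeff_injective (Finsupp.ext fun k => ?_)
  by_cases hk : k ∈ (P j).coeff.support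
  · exact coeff_initialForms_of_mem ((mem_support_initialForms hP).2 ⟨hk, by simp⟩)
  · have : k ∉ (initialForms P ∅ j).coeff.support := fun h =>
      hk ((mem_support_initialForms hP).1 h).1
    rw [Finsupp.notMem_support_iff.1 hk, Finsupp.notMem_support_iff.1 this]

/-- Modulo the span of a compatible set `S`, every vector lies in a cone that contains `S`, and
the support functions of the initial forms along `S` are computed in this cone. -/
theorem IsFanRays.exists_star_decomposition (H : IsFanRays P R) {S : Finset (Fin n → ℝ)}
    (hSR : S ⊆ R) (hS : Joint P S) (x : Fin n → ℝ) :
    ∃ b : (Fin n → ℝ) → ℝ, (∀ ρ, ρ ∉ S → 0 ≤ b ρ) ∧ x = ∑ ρ ∈ R, b ρ • ρ ∧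
      Joint P (S ∪ R.filter fun ρ => b ρ ≠ 0) ∧
      ∀ j, tropPoly (initialForms P S j) x = ∑ ρ ∈ R, b ρ * tropPoly (P j) ρ := by
  have hne := initialForms_ne_zero H.ne_zero hS
  choose a ha _ using fun j => exists_eq_tropPoly (hne j) 0
  have ha' := fun j => (mem_support_initialForms H.ne_zero).1 (ha j)
  set gap : Fin m → (Fin n → ℤ) → ℝ := fun j v =>
    ∑ ρ ∈ S, (tropPoly (P j) ρ - ρ ⬝ᵥ expVec v) with hgap
  have hgap_nonneg : ∀ j, ∀ v ∈ (P j).coeff.support, 0 ≤ gap j v := fun j v hv =>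
    Finset.sum_nonneg fun ρ _ => sub_nonneg.2 (dotProduct_le_tropPoly (H.ne_zero j) ρ hv)
  have hgap_pos : ∀ j, ∀ v ∈ (P j).coeff.support, v ∉ (initialForms P S j).coeff.support →
      0 < gap j v := by
    intro j v hv hv'
    rw [mem_support_initialForms H.ne_zero] at hv'
    push Not at hv'
    obtain ⟨ρ, hρ, h⟩ := hv' hv
    refine Finset.sum_pos' (fun ρ _ => sub_nonneg.2 (dotProduct_le_tropPoly (H.ne_zero j) ρ hv))
      ⟨ρ, hρ, sub_pos.2 (lt_of_le_of_ne (dotProduct_le_tropPoly (H.ne_zero j) ρ hv) fun h' => ?_)⟩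
    exact h (mem_face.2 ⟨hv, h'⟩)
  let t : ℝ := 1 + ∑ j, ∑ v ∈ (P j).coeff.support,
    |x ⬝ᵥ expVec v - x ⬝ᵥ expVec (a j)| / gap j v
  have ht : ∀ j, ∀ v ∈ (P j).coeff.support, v ∉ (initialForms P S j).coeff.support →
      x ⬝ᵥ expVec v - x ⬝ᵥ expVec (a j) < t * gap j v := by
    intro j v hv hv'
    have hnn : ∀ i, ∀ u ∈ (P i).coeff.support,
        0 ≤ |x ⬝ᵥ expVec u - x ⬝ᵥ expVec (a i)| / gap i u := fun i u hu =>
      div_nonneg (abs_nonneg _) (hgap_nonneg i u hu)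
    have h1 : |x ⬝ᵥ expVec v - x ⬝ᵥ expVec (a j)| / gap j v ≤
        ∑ j, ∑ v ∈ (P j).coeff.support, |x ⬝ᵥ expVec v - x ⬝ᵥ expVec (a j)| / gap j v :=
      (Finset.single_le_sum (f := fun v => |x ⬝ᵥ expVec v - x ⬝ᵥ expVec (a j)| / gap j v)
        (hnn j) hv).trans (Finset.single_le_sum
          (f := fun j => ∑ v ∈ (P j).coeff.support,
            |x ⬝ᵥ expVec v - x ⬝ᵥ expVec (a j)| / gap j v)
          (fun i _ => Finset.sum_nonneg (hnn i)) (Finset.mem_univ j))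
    have h2 : |x ⬝ᵥ expVec v - x ⬝ᵥ expVec (a j)| / gap j v < t := by
      simp only [t]; linarith
    rw [div_lt_iff₀ (hgap_pos j v hv hv')] at h2
    exact (le_abs_self _).trans_lt h2
  set y : Fin n → ℝ := x + t • ∑ ρ ∈ S, ρ with hy
  have hydot : ∀ z, y ⬝ᵥ z = x ⬝ᵥ z + t * ∑ ρ ∈ S, ρ ⬝ᵥ z := by
    intro z
    rw [hy, add_dotProduct, smul_dotProduct, sum_dotProduct, smul_eq_mul]
  have hyin : ∀ j, ∀ v ∈ (initialForms P S j).coeff.support,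
      y ⬝ᵥ expVec v = x ⬝ᵥ expVec v + t * ∑ ρ ∈ S, tropPoly (P j) ρ := by
    intro j v hv
    rw [hydot]
    congr 2
    exact Finset.sum_congr rfl fun ρ hρ =>
      (mem_face.1 (((mem_support_initialForms H.ne_zero).1 hv).2 ρ hρ)).2
  -- far in the direction of `S`, only the exponents of the initial forms can be maximal
  have hyface : ∀ j, face (P j) y ⊆ (initialForms P S j).coeff.support := by
    intro j v hv
    by_contra hv'
    have hvs := (mem_face.1 hv).1
    have h1 := le_of_mem_face (H.ne_zero j) hv (ha' j).1
    have h2 := ht j v hvs hv'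
    rw [hyin j _ (ha j), hydot] at h1
    simp only [hgap, Finset.sum_sub_distrib] at h2
    nlinarith
  have htrop : ∀ j, tropPoly (initialForms P S j) x =
      tropPoly (P j) y - t * ∑ ρ ∈ S, tropPoly (P j) ρ := by
    intro j
    obtain ⟨k, hk⟩ := face_nonempty (H.ne_zero j) y
    rw [tropPoly_eq_of_forall_le (hne j) (hyface j hk), ← (mem_face.1 hk).2,
      hyin j k (hyface j hk)]
    · ring
    · intro l hl
      have := le_of_mem_face (H.ne_zero j) hk ((mem_support_initialForms H.ne_zero).1 hl).1
      rw [hyin j k (hyface j hk), hyin j l hl] at this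
      linarith
  obtain ⟨c, hc, hyc, hcf⟩ := H.exists_decomposition y
  have hyt : ∀ j, tropPoly (P j) y = ∑ ρ ∈ R, c ρ * tropPoly (P j) ρ := by
    intro j
    obtain ⟨k, hk⟩ := face_nonempty (H.ne_zero j) y
    rw [← (mem_face.1 hk).2]
    conv_lhs => rw [hyc]
    rw [sum_dotProduct]
    refine Finset.sum_congr rfl fun ρ hρ => ?_
    rw [smul_dotProduct, smul_eq_mul]
    by_cases h : c ρ = 0
    · simp [h]
    · rw [(mem_face.1 (hcf ρ hρ h j hk)).2]
  have hite : ∀ f : (Fin n → ℝ) → ℝ, ∑ ρ ∈ R, (if ρ ∈ S then t else 0) * f ρ =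
      t * ∑ ρ ∈ S, f ρ := by
    intro f
    rw [Finset.mul_sum, ← Finset.sum_subset hSR]
    · exact Finset.sum_congr rfl fun ρ hρ => by rw [if_pos hρ]
    · intro ρ _ hρ
      rw [if_neg hρ, zero_mul]
  refine ⟨fun ρ => c ρ - if ρ ∈ S then t else 0, ?_, ?_, ?_, ?_⟩
  · intro ρ hρ
    simpa only [if_neg hρ, sub_zero] using hc ρ
  · simp only [sub_smul, Finset.sum_sub_distrib, ← hyc]
    have : ∑ ρ ∈ R, (if ρ ∈ S then t else 0) • ρ = t • ∑ ρ ∈ S, ρ := by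
      rw [Finset.smul_sum, ← Finset.sum_subset hSR]
      · exact Finset.sum_congr rfl fun ρ hρ => by rw [if_pos hρ]
      · intro ρ _ hρ
        rw [if_neg hρ, zero_smul]
    rw [this, hy, add_sub_cancel_right]
  · choose v hv using fun j => face_nonempty (H.ne_zero j) y
    refine ⟨v, fun j => (mem_face.1 (hv j)).1, fun ρ hρ j => ?_⟩
    by_cases hρS : ρ ∈ S
    · exact ((mem_support_initialForms H.ne_zero).1 (hyface j (hv j))).2 ρ hρS
    · have h1 : ρ ∈ R ∧ c ρ - (if ρ ∈ S then t else 0) ≠ 0 := by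
        rcases Finset.mem_union.1 hρ with h | h
        · exact absurd h hρS
        · exact Finset.mem_filter.1 h
      rw [if_neg hρS, sub_zero] at h1
      exact hcf ρ h1.1 h1.2 j (hv j)
  · intro j
    simp only [sub_mul, Finset.sum_sub_distrib]
    rw [htrop, hyt, hite]

/-- A compatible set of rays is determined by the cone it spans. -/
theorem IsFanRays.mem_of_mem_hull (H : IsFanRays P R) {S : Finset (Fin n → ℝ)} (hSR : S ⊆ R)
    (hS : Joint P S) {ρ : Fin n → ℝ} (hρ : ρ ∈ R)
    (hmem : ρ ∈ PointedCone.hull ℝ (S : Set (Fin n → ℝ))) : ρ ∈ S := by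
  obtain ⟨c, hc⟩ := Submodule.mem_span_finset.1 hmem
  have hρc : ρ = ∑ s ∈ S, (c s : ℝ) • s := hc.2.symm
  obtain ⟨v, hvs, hv⟩ := hS
  obtain ⟨s, hs, hcs⟩ : ∃ s ∈ S, c s ≠ 0 := by
    by_contra h
    push Not at h
    refine H.ray_ne_zero ρ hρ ?_
    rw [hρc]
    refine Finset.sum_eq_zero fun s hs => ?_
    rw [h s hs]
    simp
  have hface : ∀ j, face (P j) ρ ⊆ face (P j) s := by
    intro j k hk
    have hks := (mem_face.1 hk).1
    have h1 := le_of_mem_face (H.ne_zero j) hk (hvs j)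
    have hdot : ∀ z, ρ ⬝ᵥ z = ∑ s ∈ S, (c s : ℝ) * (s ⬝ᵥ z) := by
      intro z
      conv_lhs => rw [hρc]
      rw [sum_dotProduct]
      exact Finset.sum_congr rfl fun s _ => by rw [smul_dotProduct, smul_eq_mul]
    rw [hdot, hdot] at h1
    have h2 : ∀ s ∈ S, (c s : ℝ) * (s ⬝ᵥ expVec k) ≤ (c s : ℝ) * (s ⬝ᵥ expVec (v j)) :=
      fun s hs => mul_le_mul_of_nonneg_left (le_of_mem_face (H.ne_zero j) (hv s hs j) hks) (c s).2
    have h3 := (Finset.sum_eq_sum_iff_of_le h2).1 (le_antisymm (Finset.sum_le_sum h2) h1) s hs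
    have h4 : (c s : ℝ) ≠ 0 := fun h => hcs (Subtype.ext h)
    refine mem_face.2 ⟨hks, ?_⟩
    rw [mul_left_cancel₀ h4 h3]
    exact (mem_face.1 (hv s hs j)).2
  obtain ⟨a, ha, hsa⟩ := H.extremal ρ hρ s hface
  rw [← H.unique ρ hρ s (hSR hs) a ha hsa]
  exact hs

/-- If a vector lies, modulo the span of `S`, both in the cone spanned by `S` and `b` and in a
cone spanned by `T ⊇ S` and `b'`, then the former is compatible with `T`. -/
theorem joint_of_sum_eq (hP : ∀ j, P j ≠ 0) {S T : Finset (Fin n → ℝ)}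
    (hST : S ⊆ T)
    {b b' : (Fin n → ℝ) → ℝ} (hb : ∀ ρ, ρ ∉ S → 0 ≤ b ρ) (hb' : ∀ ρ, ρ ∉ S → 0 ≤ b' ρ)
    (hJb : Joint P (S ∪ R.filter fun ρ => b ρ ≠ 0))
    (hJb' : Joint P (T ∪ R.filter fun ρ => b' ρ ≠ 0))
    (heq : ∑ ρ ∈ R, b ρ • ρ = ∑ ρ ∈ R, b' ρ • ρ) :
    Joint P (T ∪ R.filter fun ρ => b ρ ≠ 0) := by
  obtain ⟨u, hus, hu⟩ := hJb
  obtain ⟨v, hvs, hv⟩ := hJb'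
  refine ⟨v, hvs, fun ρ hρ j => ?_⟩
  rcases Finset.mem_union.1 hρ with hρT | hρb
  · exact hv ρ (Finset.mem_union_left _ hρT) j
  obtain ⟨hρR, hρ0⟩ := Finset.mem_filter.1 hρb
  by_cases hρS : ρ ∈ S
  · exact hv ρ (Finset.mem_union_left _ (hST hρS)) j
  -- compare the values at the exponents `u j` and `v j`: all terms on the left are nonnegative,
  -- all terms on the right are nonpositive
  have hdot : ∀ (c : (Fin n → ℝ) → ℝ) z, (∑ ρ ∈ R, c ρ • ρ) ⬝ᵥ z = ∑ ρ ∈ R, c ρ * (ρ ⬝ᵥ z) := by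
    intro c z
    rw [sum_dotProduct]
    exact Finset.sum_congr rfl fun s _ => by rw [smul_dotProduct, smul_eq_mul]
  have hsum : ∑ ρ ∈ R, b ρ * (ρ ⬝ᵥ expVec (u j) - ρ ⬝ᵥ expVec (v j)) =
      ∑ ρ ∈ R, b' ρ * (ρ ⬝ᵥ expVec (u j) - ρ ⬝ᵥ expVec (v j)) := by
    simp only [mul_sub, Finset.sum_sub_distrib, ← hdot, heq]
  have hS0 : ∀ ρ ∈ S, ρ ⬝ᵥ expVec (u j) - ρ ⬝ᵥ expVec (v j) = 0 := by
    intro ρ hρ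
    rw [(mem_face.1 (hu ρ (Finset.mem_union_left _ hρ) j)).2,
      (mem_face.1 (hv ρ (Finset.mem_union_left _ (hST hρ)) j)).2, sub_self]
  have h1 : ∀ ρ ∈ R, 0 ≤ b ρ * (ρ ⬝ᵥ expVec (u j) - ρ ⬝ᵥ expVec (v j)) := by
    intro ρ hρ
    by_cases h0 : b ρ = 0
    · simp [h0]
    by_cases hρS : ρ ∈ S
    · rw [hS0 ρ hρS, mul_zero]
    · refine mul_nonneg (hb ρ hρS) (sub_nonneg.2 ?_)
      exact le_of_mem_face (hP j)
        (hu ρ (Finset.mem_union_right _ (Finset.mem_filter.2 ⟨hρ, h0⟩)) j) (hvs j)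
  have h2 : ∀ ρ ∈ R, b' ρ * (ρ ⬝ᵥ expVec (u j) - ρ ⬝ᵥ expVec (v j)) ≤ 0 := by
    intro ρ hρ
    by_cases h0 : b' ρ = 0
    · simp [h0]
    by_cases hρS : ρ ∈ S
    · rw [hS0 ρ hρS, mul_zero]
    · refine mul_nonpos_of_nonneg_of_nonpos (hb' ρ hρS) (sub_nonpos.2 ?_)
      exact le_of_mem_face (hP j)
        (hv ρ (Finset.mem_union_right _ (Finset.mem_filter.2 ⟨hρ, h0⟩)) j) (hus j)
  have h3 : ∑ ρ ∈ R, b ρ * (ρ ⬝ᵥ expVec (u j) - ρ ⬝ᵥ expVec (v j)) = 0 :=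
    le_antisymm (hsum ▸ Finset.sum_nonpos h2) (Finset.sum_nonneg h1)
  have h4 := (mul_eq_zero.1 ((Finset.sum_eq_zero_iff_of_nonneg h1).1 h3 ρ hρR)).resolve_left hρ0
  refine mem_face.2 ⟨hvs j, ?_⟩
  rw [← sub_eq_zero.1 h4]
  exact (mem_face.1 (hu ρ (Finset.mem_union_right _ hρb) j)).2

end Rays

/-! ### Growth rates of the subtraction terms -/

section Growth

variable {n m : ℕ} {P : Fin m → LaurentPoly n} {R D : Finset (Fin n → ℝ)}
  {w : (Fin n → ℝ) → (Fin n → ℝ)}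

/-- The vectors `w ρ` are dual to the rays in `D`, within each compatible set. -/
def DualOn (P : Fin m → LaurentPoly n) (D : Finset (Fin n → ℝ))
    (w : (Fin n → ℝ) → (Fin n → ℝ)) : Prop :=
  ∀ ρ ∈ D, ∀ ρ' ∈ D, Joint P {ρ, ρ'} → w ρ ⬝ᵥ ρ' = if ρ = ρ' then -1 else 0

theorem DualOn.apply (hw : DualOn P D w) {S : Finset (Fin n → ℝ)} (hSD : S ⊆ D)
    (hS : Joint P S) {ρ ρ' : Fin n → ℝ} (hρ : ρ ∈ S) (hρ' : ρ' ∈ S) :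
    w ρ ⬝ᵥ ρ' = if ρ = ρ' then -1 else 0 := by
  refine hw ρ (hSD hρ) ρ' (hSD hρ') (hS.mono fun s hs => ?_)
  rcases Finset.mem_insert.1 hs with rfl | hs
  · exact hρ
  · rw [Finset.mem_singleton.1 hs]
    exact hρ'

/-- The exponential growth rate, in the direction `x`, of the term of `S'` in the renormalized
integrand of `S`. -/
def growth (P : Fin m → LaurentPoly n) (w : (Fin n → ℝ) → (Fin n → ℝ))
    (S S' : Finset (Fin n → ℝ)) (e : Exponents n m) (x : Fin n → ℝ) : ℝ :=
  ∑ ρ ∈ S, (tropIntegrand P e ρ).re * (w ρ ⬝ᵥ x) -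
    ∑ ρ ∈ S' \ S, (1 - (tropIntegrand P e ρ).re) * max 0 (w ρ ⬝ᵥ x) +
    (tropIntegrand (initialForms P S') e x).re

theorem dotProduct_sum_smul (y : Fin n → ℝ) (b : (Fin n → ℝ) → ℝ) :
    y ⬝ᵥ (∑ ρ ∈ R, b ρ • ρ) = ∑ ρ ∈ R, b ρ * (y ⬝ᵥ ρ) := by
  rw [dotProduct_sum]
  exact Finset.sum_congr rfl fun s _ => by rw [dotProduct_smul, smul_eq_mul]

theorem tropIntegrand_eq_sum {S : Finset (Fin n → ℝ)} {b : (Fin n → ℝ) → ℝ} {x : Fin n → ℝ}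
    (e : Exponents n m) (hx : x = ∑ ρ ∈ R, b ρ • ρ)
    (hb : ∀ j, tropPoly (initialForms P S j) x = ∑ ρ ∈ R, b ρ * tropPoly (P j) ρ) :
    tropIntegrand (initialForms P S) e x = ∑ ρ ∈ R, (b ρ : ℂ) * tropIntegrand P e ρ := by
  simp only [tropIntegrand, hb]
  have hxi : ∀ i, x i = ∑ ρ ∈ R, b ρ * ρ i := by
    intro i
    conv_lhs => rw [hx]
    simp [Finset.sum_apply]
  simp only [hxi, mul_add, Finset.sum_add_distrib, Complex.ofReal_sum, Finset.mul_sum,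
    Complex.ofReal_mul]
  congr 1
  · rw [Finset.sum_comm]
    exact Finset.sum_congr rfl fun ρ _ => Finset.sum_congr rfl fun i _ => by ring
  · rw [Finset.sum_comm]
    exact Finset.sum_congr rfl fun ρ _ => Finset.sum_congr rfl fun i _ => by ring

theorem re_tropIntegrand_eq_sum {S : Finset (Fin n → ℝ)} {b : (Fin n → ℝ) → ℝ} {x : Fin n → ℝ}
    (e : Exponents n m) (hx : x = ∑ ρ ∈ R, b ρ • ρ)
    (hb : ∀ j, tropPoly (initialForms P S j) x = ∑ ρ ∈ R, b ρ * tropPoly (P j) ρ) :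
    (tropIntegrand (initialForms P S) e x).re = ∑ ρ ∈ R, b ρ * (tropIntegrand P e ρ).re := by
  rw [tropIntegrand_eq_sum e hx hb, Complex.re_sum]
  exact Finset.sum_congr rfl fun ρ _ => Complex.re_ofReal_mul _ _

/-- At exponents at which the rays in `D` are logarithmically divergent and all others are
convergent, the term of `S'` does not grow, and it decays except in the directions of divergent
cones that contain `S'`, modulo the span of `S`. -/
theorem IsFanRays.growth_nonpos (H : IsFanRays P R) (hw : DualOn P D w) (hDR : D ⊆ R)
    {e : Exponents n m} (h0 : ∀ ρ ∈ D, tropIntegrand P e ρ = 0)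
    (hneg : ∀ ρ ∈ R, ρ ∉ D → (tropIntegrand P e ρ).re < 0)
    {S S' : Finset (Fin n → ℝ)} (hSS : S ⊆ S') (hSD : S' ⊆ D) (hS : Joint P S')
    (x : Fin n → ℝ) :
    growth P w S S' e x ≤ 0 ∧ (growth P w S S' e x = 0 →
      ∃ b : (Fin n → ℝ) → ℝ, (∀ ρ, ρ ∉ S → 0 ≤ b ρ) ∧ x = ∑ ρ ∈ R, b ρ • ρ ∧
        (∀ ρ ∈ R, b ρ ≠ 0 → ρ ∈ D) ∧ Joint P (S' ∪ R.filter fun ρ => b ρ ≠ 0)) := by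
  obtain ⟨b, hb, hx, hJ, htrop⟩ := H.exists_star_decomposition (hSD.trans hDR) hS x
  have hgrowth : growth P w S S' e x =
      -∑ ρ ∈ S' \ S, max 0 (w ρ ⬝ᵥ x) + ∑ ρ ∈ R, b ρ * (tropIntegrand P e ρ).re := by
    rw [growth, re_tropIntegrand_eq_sum e hx htrop]
    congr 1
    have h1 : ∑ ρ ∈ S, (tropIntegrand P e ρ).re * (w ρ ⬝ᵥ x) = 0 :=
      Finset.sum_eq_zero fun ρ hρ => by rw [h0 ρ (hSD (hSS hρ)), Complex.zero_re, zero_mul]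
    rw [h1, zero_sub]
    congr 1
    refine Finset.sum_congr rfl fun ρ hρ => ?_
    rw [h0 ρ (hSD (Finset.mem_sdiff.1 hρ).1), Complex.zero_re, sub_zero, one_mul]
  have h1 : ∀ ρ ∈ S' \ S, 0 ≤ max 0 (w ρ ⬝ᵥ x) := fun ρ _ => le_max_left _ _
  have h2 : ∀ ρ ∈ R, b ρ * (tropIntegrand P e ρ).re ≤ 0 := by
    intro ρ hρ
    by_cases hρD : ρ ∈ D
    · rw [h0 ρ hρD, Complex.zero_re, mul_zero]
    · exact mul_nonpos_of_nonneg_of_nonpos (hb ρ fun h => hρD (hSD h)) (hneg ρ hρ hρD).le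
  have h3 := Finset.sum_nonneg h1
  have h4 := Finset.sum_nonpos h2
  rw [hgrowth]
  refine ⟨by linarith, fun heq => ⟨b, ?_, hx, ?_, hJ⟩⟩
  all_goals
    have h5 : ∑ ρ ∈ S' \ S, max 0 (w ρ ⬝ᵥ x) = 0 := by linarith
    have h6 : ∑ ρ ∈ R, b ρ * (tropIntegrand P e ρ).re = 0 := by linarith
    have hbD : ∀ ρ ∈ R, b ρ ≠ 0 → ρ ∈ D := by
      intro ρ hρ hbρ
      by_contra hρD
      have := (Finset.sum_eq_zero_iff_of_nonpos h2).1 h6 ρ hρ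
      exact (hneg ρ hρ hρD).ne ((mul_eq_zero.1 this).resolve_left hbρ)
  · intro ρ hρ
    by_cases hρS : ρ ∈ S'
    · have h7 := (Finset.sum_eq_zero_iff_of_nonneg h1).1 h5 ρ (Finset.mem_sdiff.2 ⟨hρS, hρ⟩)
      have h8 : w ρ ⬝ᵥ x = - b ρ := by
        rw [hx, dotProduct_sum_smul, Finset.sum_eq_single ρ]
        · rw [hw.apply hSD (hS) hρS hρS, if_pos rfl, mul_neg_one]
        · intro s hs hsρ
          by_cases hbs : b s = 0
          · rw [hbs, zero_mul]
          · have hJD : S' ∪ R.filter (fun ρ => b ρ ≠ 0) ⊆ D := by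
              refine Finset.union_subset hSD fun s hs => ?_
              exact hbD s (Finset.mem_filter.1 hs).1 (Finset.mem_filter.1 hs).2
            rw [hw.apply hJD hJ (Finset.mem_union_left _ hρS)
              (Finset.mem_union_right _ (Finset.mem_filter.2 ⟨hs, hbs⟩)), if_neg hsρ.symm,
              mul_zero]
        · intro h
          exact absurd (hDR (hSD hρS)) h
      have h9 : w ρ ⬝ᵥ x ≤ 0 := by
        rw [← h7]
        exact le_max_right _ _
      linarith
    · exact hb ρ hρS
  · exact hbD

/-- At exponents at which all rays are convergent, and the rays in `S'` sufficiently weakly so,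
the term of `S'` in the integrand of the zero cone decays in all directions. -/
theorem IsFanRays.growth_neg (H : IsFanRays P R) (hw : DualOn P D w) (hDR : D ⊆ R)
    {e : Exponents n m} (hneg : ∀ ρ ∈ R, (tropIntegrand P e ρ).re < 0)
    {S' : Finset (Fin n → ℝ)} (hSD : S' ⊆ D) (hS : Joint P S')
    (hsmall : ∀ ρ ∈ R, ρ ∉ D → ∑ s ∈ S', -(tropIntegrand P e s).re * |w s ⬝ᵥ ρ| <
      -(tropIntegrand P e ρ).re)
    {x : Fin n → ℝ} (hx0 : x ≠ 0) : growth P w ∅ S' e x < 0 := by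
  obtain ⟨b, hb, hx, hJ, htrop⟩ := H.exists_star_decomposition (hSD.trans hDR) hS x
  have hbS : ∀ ρ ∈ R, ρ ∉ S' → 0 ≤ b ρ := fun ρ _ hρ => hb ρ hρ
  set T : (Fin n → ℝ) → ℝ := fun ρ => (tropIntegrand P e ρ).re with hT
  have hTneg : ∀ ρ ∈ R, T ρ < 0 := hneg
  -- the part of `x` along the rays outside `D`
  set N : (Fin n → ℝ) → ℝ := fun s => ∑ ρ ∈ R \ D, b ρ * (w s ⬝ᵥ ρ) with hN
  have hwx : ∀ s ∈ S', w s ⬝ᵥ x = - b s + N s := by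
    intro s hs
    have h1 : w s ⬝ᵥ x = ∑ ρ ∈ D, b ρ * (w s ⬝ᵥ ρ) + N s := by
      conv_lhs => rw [hx]
      rw [dotProduct_sum_smul, hN, add_comm, Finset.sum_sdiff hDR]
    rw [h1]
    congr 1
    rw [Finset.sum_eq_single s]
    · rw [hw.apply hSD hS hs hs, if_pos rfl, mul_neg_one]
    · intro ρ hρ hρs
      by_cases hbρ : b ρ = 0
      · rw [hbρ, zero_mul]
      · rw [hw s (hSD hs) ρ hρ, if_neg hρs.symm, mul_zero]
        refine hJ.mono fun r hr => ?_
        rcases Finset.mem_insert.1 hr with rfl | hr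
        · exact Finset.mem_union_left _ hs
        · rw [Finset.mem_singleton.1 hr]
          exact Finset.mem_union_right _ (Finset.mem_filter.2 ⟨hDR hρ, hbρ⟩)
    · intro h
      exact absurd (hSD hs) h
  have hbnd : ∀ ρ ∈ R \ D, 0 ≤ b ρ := fun ρ hρ =>
    hb ρ fun h => (Finset.mem_sdiff.1 hρ).2 (hSD h)
  have hNle : ∀ s, |N s| ≤ ∑ ρ ∈ R \ D, b ρ * |w s ⬝ᵥ ρ| := by
    intro s
    refine (Finset.abs_sum_le_sum_abs _ _).trans (le_of_eq ?_)
    refine Finset.sum_congr rfl fun ρ hρ => ?_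
    rw [abs_mul, abs_of_nonneg (hbnd ρ hρ)]
  -- the contribution of a ray `s ∈ S'`
  set B : (Fin n → ℝ) → ℝ := fun s => -T s * (w s ⬝ᵥ x) - (1 - T s) * max 0 (w s ⬝ᵥ x) with hB
  have hBneg : ∀ s ∈ S', w s ⬝ᵥ x ≠ 0 → B s < 0 := by
    intro s hs h0
    have hTs := hTneg s (hDR (hSD hs))
    simp only [hB]
    rcases lt_or_gt_of_ne h0 with h | h
    · rw [max_eq_left h.le]
      nlinarith
    · rw [max_eq_right h.le]
      nlinarith
  have hBnonpos : ∀ s ∈ S', B s ≤ 0 := by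
    intro s hs
    by_cases h0 : w s ⬝ᵥ x = 0
    · simp [hB, h0]
    · exact (hBneg s hs h0).le
  have hdecomp : growth P w ∅ S' e x = ∑ s ∈ S', B s + ∑ s ∈ S', T s * N s +
      ∑ ρ ∈ D \ S', b ρ * T ρ + ∑ ρ ∈ R \ D, b ρ * T ρ := by
    have h1 : growth P w ∅ S' e x = -∑ s ∈ S', (1 - T s) * max 0 (w s ⬝ᵥ x) +
        ∑ ρ ∈ R, b ρ * T ρ := by
      rw [growth, re_tropIntegrand_eq_sum e hx htrop, Finset.sum_empty, Finset.sdiff_empty,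
        zero_sub]
    have h2 : ∑ ρ ∈ R, b ρ * T ρ = ∑ ρ ∈ S', b ρ * T ρ + ∑ ρ ∈ D \ S', b ρ * T ρ +
        ∑ ρ ∈ R \ D, b ρ * T ρ := by
      rw [← Finset.sum_sdiff hDR, ← Finset.sum_sdiff hSD]
      ring
    have h3 : ∑ s ∈ S', b s * T s = ∑ s ∈ S', (-T s * (w s ⬝ᵥ x)) + ∑ s ∈ S', T s * N s := by
      rw [← Finset.sum_add_distrib]
      refine Finset.sum_congr rfl fun s hs => ?_
      rw [hwx s hs]
      ring
    rw [h1, h2, h3]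
    simp only [hB, Finset.sum_sub_distrib]
    ring
  have hE1 : ∑ s ∈ S', T s * N s + ∑ ρ ∈ R \ D, b ρ * T ρ ≤
      ∑ ρ ∈ R \ D, b ρ * (∑ s ∈ S', -T s * |w s ⬝ᵥ ρ| + T ρ) := by
    have h1 : ∑ s ∈ S', T s * N s ≤ ∑ s ∈ S', -T s * ∑ ρ ∈ R \ D, b ρ * |w s ⬝ᵥ ρ| := by
      refine Finset.sum_le_sum fun s hs => ?_
      have hTs := hTneg s (hDR (hSD hs))
      have h2 := hNle s
      have h3 := neg_abs_le (N s)
      nlinarith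
    have h4 : ∑ s ∈ S', -T s * ∑ ρ ∈ R \ D, b ρ * |w s ⬝ᵥ ρ| =
        ∑ ρ ∈ R \ D, b ρ * ∑ s ∈ S', -T s * |w s ⬝ᵥ ρ| := by
      simp only [Finset.mul_sum]
      rw [Finset.sum_comm]
      exact Finset.sum_congr rfl fun ρ _ => Finset.sum_congr rfl fun s _ => by ring
    simp only [mul_add, Finset.sum_add_distrib]
    linarith
  have hE2 : ∀ ρ ∈ R \ D, b ρ * (∑ s ∈ S', -T s * |w s ⬝ᵥ ρ| + T ρ) ≤ 0 := by
    intro ρ hρ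
    have h1 := hsmall ρ (Finset.mem_sdiff.1 hρ).1 (Finset.mem_sdiff.1 hρ).2
    exact mul_nonpos_of_nonneg_of_nonpos (hbnd ρ hρ) (by linarith)
  have hE3 : ∀ ρ ∈ D \ S', b ρ * T ρ ≤ 0 := by
    intro ρ hρ
    have h1 := Finset.mem_sdiff.1 hρ
    exact mul_nonpos_of_nonneg_of_nonpos (hb ρ h1.2) (hTneg ρ (hDR h1.1)).le
  have hs1 := Finset.sum_nonpos hBnonpos
  have hs2 := Finset.sum_nonpos hE2
  have hs3 := Finset.sum_nonpos hE3
  by_contra hcon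
  push Not at hcon
  have hz1 : ∑ s ∈ S', B s = 0 := by linarith
  have hz2 : ∑ ρ ∈ R \ D, b ρ * (∑ s ∈ S', -T s * |w s ⬝ᵥ ρ| + T ρ) = 0 := by linarith
  have hz3 : ∑ ρ ∈ D \ S', b ρ * T ρ = 0 := by linarith
  have hb2 : ∀ ρ ∈ R \ D, b ρ = 0 := by
    intro ρ hρ
    have h1 := hsmall ρ (Finset.mem_sdiff.1 hρ).1 (Finset.mem_sdiff.1 hρ).2
    have h2 := (Finset.sum_eq_zero_iff_of_nonpos hE2).1 hz2 ρ hρ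
    exact (mul_eq_zero.1 h2).resolve_right (by linarith : _ < (0 : ℝ)).ne
  have hb3 : ∀ ρ ∈ D \ S', b ρ = 0 := by
    intro ρ hρ
    have h2 := (Finset.sum_eq_zero_iff_of_nonpos hE3).1 hz3 ρ hρ
    exact (mul_eq_zero.1 h2).resolve_right (hTneg ρ (hDR (Finset.mem_sdiff.1 hρ).1)).ne
  have hb1 : ∀ s ∈ S', b s = 0 := by
    intro s hs
    have h1 := (Finset.sum_eq_zero_iff_of_nonpos hBnonpos).1 hz1 s hs
    have h2 : w s ⬝ᵥ x = 0 := by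
      by_contra h
      exact (hBneg s hs h).ne h1
    have h3 : N s = 0 := Finset.sum_eq_zero fun ρ hρ => by rw [hb2 ρ hρ, zero_mul]
    have h4 := hwx s hs
    rw [h2, h3] at h4
    linarith
  refine hx0 ?_
  rw [hx]
  refine Finset.sum_eq_zero fun ρ hρ => ?_
  have : b ρ = 0 := by
    by_cases h1 : ρ ∈ D
    · by_cases h2 : ρ ∈ S'
      · exact hb1 ρ h2
      · exact hb3 ρ (Finset.mem_sdiff.2 ⟨h1, h2⟩)
    · exact hb2 ρ (Finset.mem_sdiff.2 ⟨hρ, h1⟩)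
  rw [this, zero_smul]

end Growth

/-! ### Functions that decay exponentially in a direction -/

section Decay

variable {E X : Type*} [TopologicalSpace E] [NormedAddCommGroup X] [NormedSpace ℝ X]

/-- The functions `f e` decay exponentially along the half-lines close to the one spanned by
`x₀`, uniformly for `e` near `e₀`. -/
def DecaysNear (f : E → X → ℂ) (e₀ : E) (x₀ : X) : Prop :=
  ∃ δ > 0, ∃ C : ℝ, ∀ᶠ q : E × X in 𝓝 (e₀, x₀), ∀ t : ℝ, 0 ≤ t →
    ‖f q.1 (t • q.2)‖ ≤ C * Real.exp (-δ * t)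

theorem DecaysNear.zero (e₀ : E) (x₀ : X) : DecaysNear (fun _ _ => 0) e₀ x₀ :=
  ⟨1, one_pos, 0, Eventually.of_forall fun _ t _ => by simp⟩

theorem DecaysNear.mono {f : E → X → ℂ} {e₀ : E} {x₀ : X} {δ δ' C : ℝ} (hδ : δ' ≤ δ)
    (h : ∀ᶠ q : E × X in 𝓝 (e₀, x₀), ∀ t : ℝ, 0 ≤ t →
      ‖f q.1 (t • q.2)‖ ≤ C * Real.exp (-δ * t)) :
    ∀ᶠ q : E × X in 𝓝 (e₀, x₀), ∀ t : ℝ, 0 ≤ t →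
      ‖f q.1 (t • q.2)‖ ≤ |C| * Real.exp (-δ' * t) := by
  filter_upwards [h] with q hq t ht
  refine (hq t ht).trans ?_
  refine mul_le_mul (le_abs_self C) (Real.exp_le_exp.2 ?_) (Real.exp_pos _).le (abs_nonneg C)
  nlinarith

theorem DecaysNear.add {f g : E → X → ℂ} {e₀ : E} {x₀ : X} (hf : DecaysNear f e₀ x₀)
    (hg : DecaysNear g e₀ x₀) : DecaysNear (fun e x => f e x + g e x) e₀ x₀ := by
  obtain ⟨δ, hδ, C, hC⟩ := hf
  obtain ⟨δ', hδ', C', hC'⟩ := hg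
  refine ⟨min δ δ', lt_min hδ hδ', |C| + |C'|, ?_⟩
  filter_upwards [DecaysNear.mono (min_le_left δ δ') hC,
    DecaysNear.mono (min_le_right δ δ') hC'] with q h1 h2 t ht
  rw [add_mul]
  exact (norm_add_le _ _).trans (add_le_add (h1 t ht) (h2 t ht))

theorem DecaysNear.sum {ι : Type*} (s : Finset ι) {f : ι → E → X → ℂ} {e₀ : E} {x₀ : X}
    (hf : ∀ i ∈ s, DecaysNear (f i) e₀ x₀) :
    DecaysNear (fun e x => ∑ i ∈ s, f i e x) e₀ x₀ := by
  induction s using Finset.induction_on with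
  | empty => simpa using DecaysNear.zero e₀ x₀
  | insert a s ha ih =>
    simp only [Finset.sum_insert ha]
    exact (hf a (Finset.mem_insert_self a s)).add
      (ih fun i hi => hf i (Finset.mem_insert_of_mem hi))

theorem DecaysNear.const_mul {f : E → X → ℂ} {e₀ : E} {x₀ : X} (hf : DecaysNear f e₀ x₀)
    (a : ℂ) : DecaysNear (fun e x => a * f e x) e₀ x₀ := by
  obtain ⟨δ, hδ, C, hC⟩ := hf
  refine ⟨δ, hδ, ‖a‖ * C, ?_⟩
  filter_upwards [hC] with q h t ht
  rw [norm_mul, mul_assoc]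
  exact mul_le_mul_of_nonneg_left (h t ht) (norm_nonneg a)

theorem DecaysNear.comp {Y : Type*} [NormedAddCommGroup Y] [NormedSpace ℝ Y]
    {f : E → X → ℂ} {e₀ : E} (L : Y →L[ℝ] X) {y₀ : Y} (hf : DecaysNear f e₀ (L y₀)) :
    DecaysNear (fun e y => f e (L y)) e₀ y₀ := by
  obtain ⟨δ, hδ, C, hC⟩ := hf
  refine ⟨δ, hδ, C, ?_⟩
  have h1 : Tendsto (fun q : E × Y => (q.1, L q.2)) (𝓝 (e₀, y₀)) (𝓝 (e₀, L y₀)) :=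
    (continuous_fst.prodMk (L.continuous.comp continuous_snd)).tendsto (e₀, y₀)
  filter_upwards [h1.eventually hC] with q h t ht
  rw [map_smul]
  exact h t ht

/-- The growth of an exponential is at most the growth rate of its exponent. -/
theorem norm_exp_le_of_growth {lam : E → X → ℂ} {ψ : E → X → ℝ} {K : E → ℝ}
    (hψc : Continuous fun q : E × X => ψ q.1 q.2)
    (hψ : ∀ e x t, 0 ≤ t → ψ e (t • x) = t * ψ e x) (hK : Continuous K)
    (hle : ∀ e x, (lam e x).re ≤ ψ e x + K e) {e₀ : E} {x₀ : X} {η : ℝ} (hη : ψ e₀ x₀ < η) :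
    ∃ C : ℝ, ∀ᶠ q : E × X in 𝓝 (e₀, x₀), ∀ t : ℝ, 0 ≤ t →
      ‖Complex.exp (lam q.1 (t • q.2))‖ ≤ C * Real.exp (η * t) := by
  refine ⟨Real.exp (K e₀ + 1), ?_⟩
  have h1 : ∀ᶠ q : E × X in 𝓝 (e₀, x₀), ψ q.1 q.2 < η :=
    (hψc.tendsto (e₀, x₀)).eventually (gt_mem_nhds hη)
  have h2 : ∀ᶠ q : E × X in 𝓝 (e₀, x₀), K q.1 < K e₀ + 1 :=
    ((hK.comp continuous_fst).tendsto (e₀, x₀)).eventually (gt_mem_nhds (lt_add_one _))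
  filter_upwards [h1, h2] with q hq1 hq2 t ht
  rw [Complex.norm_exp, ← Real.exp_add, Real.exp_le_exp]
  have h3 := hle q.1 (t • q.2)
  rw [hψ _ _ _ ht] at h3
  nlinarith

theorem decaysNear_exp {lam : E → X → ℂ} {ψ : E → X → ℝ} {K : E → ℝ}
    (hψc : Continuous fun q : E × X => ψ q.1 q.2)
    (hψ : ∀ e x t, 0 ≤ t → ψ e (t • x) = t * ψ e x) (hK : Continuous K)
    (hle : ∀ e x, (lam e x).re ≤ ψ e x + K e) {e₀ : E} {x₀ : X} (hneg : ψ e₀ x₀ < 0) :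
    DecaysNear (fun e x => Complex.exp (lam e x)) e₀ x₀ := by
  obtain ⟨C, hC⟩ := norm_exp_le_of_growth hψc hψ hK hle
    (show ψ e₀ x₀ < ψ e₀ x₀ / 2 by linarith)
  refine ⟨-(ψ e₀ x₀ / 2), by linarith, C, ?_⟩
  filter_upwards [hC] with q hq t ht
  rw [neg_neg]
  exact hq t ht

/-- Two exponentials whose exponents converge to each other exponentially fast, and which do not
grow, have an exponentially decaying difference. -/
theorem decaysNear_exp_sub_exp {lam lam' : E → X → ℂ} {ψ : E → X → ℝ} {K : E → ℝ}
    (hψc : Continuous fun q : E × X => ψ q.1 q.2)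
    (hψ : ∀ e x t, 0 ≤ t → ψ e (t • x) = t * ψ e x) (hK : Continuous K)
    (hle : ∀ e x, (lam' e x).re ≤ ψ e x + K e) {e₀ : E} {x₀ : X} (hneg : ψ e₀ x₀ ≤ 0)
    (hdiff : DecaysNear (fun e x => lam e x - lam' e x) e₀ x₀) :
    DecaysNear (fun e x => Complex.exp (lam e x) - Complex.exp (lam' e x)) e₀ x₀ := by
  obtain ⟨δ, hδ, C, hC⟩ := hdiff
  obtain ⟨C', hC'⟩ := norm_exp_le_of_growth hψc hψ hK hle
    (show ψ e₀ x₀ < δ / 2 by linarith)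
  refine ⟨δ / 2, half_pos hδ, |C'| * (|C| * Real.exp |C|), ?_⟩
  filter_upwards [hC, hC'] with q hq hq' t ht
  set z := lam q.1 (t • q.2) - lam' q.1 (t • q.2) with hz
  have h1 : ‖z‖ ≤ |C| * Real.exp (-δ * t) :=
    (hq t ht).trans (mul_le_mul_of_nonneg_right (le_abs_self C) (Real.exp_pos _).le)
  have h2 : ‖z‖ ≤ |C| := h1.trans (mul_le_of_le_one_right (abs_nonneg C)
    (Real.exp_le_one_iff.2 (by nlinarith)))
  have h3 : ‖Complex.exp z - 1‖ ≤ ‖z‖ * Real.exp ‖z‖ := by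
    have := Complex.norm_exp_sub_sum_le_norm_mul_exp z 1
    simpa using this
  have h4 : Complex.exp (lam q.1 (t • q.2)) - Complex.exp (lam' q.1 (t • q.2)) =
      Complex.exp (lam' q.1 (t • q.2)) * (Complex.exp z - 1) := by
    rw [mul_sub, mul_one, ← Complex.exp_add, hz, add_sub_cancel]
  rw [h4, norm_mul]
  have h5 : ‖Complex.exp z - 1‖ ≤ (|C| * Real.exp (-δ * t)) * Real.exp |C| :=
    h3.trans (mul_le_mul h1 (Real.exp_le_exp.2 h2) (Real.exp_pos _).le (by positivity))
  have h6 : ‖Complex.exp (lam' q.1 (t • q.2))‖ ≤ |C'| * Real.exp (δ / 2 * t) :=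
    (hq' t ht).trans (mul_le_mul_of_nonneg_right (le_abs_self C') (Real.exp_pos _).le)
  refine (mul_le_mul h6 h5 (norm_nonneg _) (by positivity)).trans (le_of_eq ?_)
  have h7 : Real.exp (-(δ / 2) * t) = Real.exp (δ / 2 * t) * Real.exp (-δ * t) := by
    rw [← Real.exp_add]
    congr 1
    ring
  rw [h7]
  ring

/-- Decay in every direction is uniform, by compactness of the unit sphere. -/
theorem exists_bound_of_decaysNear [FiniteDimensional ℝ X] {f : E → X → ℂ} {e₀ : E}
    (h0 : ContinuousAt (fun e => f e 0) e₀) (h : ∀ x : X, x ≠ 0 → DecaysNear f e₀ x) :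
    ∃ δ > 0, ∃ C : ℝ, ∀ᶠ e in 𝓝 e₀, ∀ x, ‖f e x‖ ≤ C * Real.exp (-δ * ‖x‖) := by
  have hK : IsCompact (Metric.sphere (0 : X) 1) := isCompact_sphere 0 1
  have hsphere : ∃ δ > 0, ∃ C : ℝ, ∀ᶠ e in 𝓝 e₀, ∀ x ∈ Metric.sphere (0 : X) 1, ∀ t : ℝ, 0 ≤ t →
      ‖f e (t • x)‖ ≤ C * Real.exp (-δ * t) := by
    refine hK.induction_on (p := fun s => ∃ δ > 0, ∃ C : ℝ, ∀ᶠ e in 𝓝 e₀, ∀ x ∈ s, ∀ t : ℝ, 0 ≤ t →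
      ‖f e (t • x)‖ ≤ C * Real.exp (-δ * t)) ?_ ?_ ?_ ?_
    · exact ⟨1, one_pos, 0, Eventually.of_forall fun e x hx => absurd hx (Set.notMem_empty x)⟩
    · rintro s t hst ⟨δ, hδ, C, hC⟩
      exact ⟨δ, hδ, C, hC.mono fun e he x hx => he x (hst hx)⟩
    · rintro s t ⟨δ, hδ, C, hC⟩ ⟨δ', hδ', C', hC'⟩
      refine ⟨min δ δ', lt_min hδ hδ', max |C| |C'|, ?_⟩
      filter_upwards [hC, hC'] with e h1 h2 x hx a ha
      rcases hx with hx | hx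
      · refine (h1 x hx a ha).trans (mul_le_mul ((le_abs_self C).trans (le_max_left _ _))
          (Real.exp_le_exp.2 ?_) (Real.exp_pos _).le ((abs_nonneg C).trans (le_max_left _ _)))
        nlinarith [min_le_left δ δ']
      · refine (h2 x hx a ha).trans (mul_le_mul ((le_abs_self C').trans (le_max_right _ _))
          (Real.exp_le_exp.2 ?_) (Real.exp_pos _).le ((abs_nonneg C).trans (le_max_left _ _)))
        nlinarith [min_le_right δ δ']
    · intro x hx
      have hx0 : x ≠ 0 := by
        rintro rfl
        simp at hx
      obtain ⟨δ, hδ, C, hC⟩ := h x hx0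
      rw [nhds_prod_eq, eventually_prod_iff] at hC
      obtain ⟨pa, hpa, pb, hpb, hp⟩ := hC
      refine ⟨{y | pb y}, mem_nhdsWithin_of_mem_nhds hpb, δ, hδ, C, ?_⟩
      filter_upwards [hpa] with e he y hy
      exact hp he hy
  obtain ⟨δ, hδ, C, hC⟩ := hsphere
  have h1 : ∀ᶠ e in 𝓝 e₀, ‖f e 0‖ < ‖f e₀ 0‖ + 1 :=
    h0.norm.eventually (gt_mem_nhds (lt_add_one _))
  refine ⟨δ, hδ, max |C| (‖f e₀ 0‖ + 1), ?_⟩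
  filter_upwards [hC, h1] with e he1 he2 x
  by_cases hx : x = 0
  · rw [hx, norm_zero, mul_zero, Real.exp_zero, mul_one]
    exact he2.le.trans (le_max_right _ _)
  · have hx' : ‖x‖ ≠ 0 := norm_ne_zero_iff.2 hx
    have h2 := he1 (‖x‖⁻¹ • x) (by simp [norm_smul, hx']) ‖x‖ (norm_nonneg x)
    rw [smul_smul, mul_inv_cancel₀ hx', one_smul] at h2
    exact h2.trans (mul_le_mul_of_nonneg_right ((le_abs_self C).trans (le_max_left _ _))
      (Real.exp_pos _).le)

end Decay

/-! ### The terms of the subtraction in logarithmic coordinates -/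

section LogTerms

variable {n m : ℕ}

/-- The logarithm of `p (e ^ x)`. -/
def logEval (p : LaurentPoly n) (x : Fin n → ℝ) : ℝ := Real.log (evalAt p (expMap x))

theorem evalAt_expMap (p : LaurentPoly n) (x : Fin n → ℝ) :
    evalAt p (expMap x) = ∑ k ∈ p.coeff.support, p.coeff k * Real.exp (x ⬝ᵥ expVec k) := by
  refine Finset.sum_congr rfl fun k _ => ?_
  congr 1
  rw [dotProduct, Real.exp_sum]
  refine Finset.prod_congr rfl fun i _ => ?_
  rw [expMap, ← Real.rpow_intCast, ← Real.exp_mul]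
  rfl

theorem evalAt_expMap_pos {p : LaurentPoly n} (hp : p ≠ 0) (hpos : ∀ k, 0 ≤ p.coeff k)
    (x : Fin n → ℝ) : 0 < evalAt p (expMap x) := by
  rw [evalAt_expMap]
  obtain ⟨k, hk, _⟩ := exists_eq_tropPoly hp 0
  refine Finset.sum_pos (fun k hk => ?_) ⟨k, hk⟩
  exact mul_pos (lt_of_le_of_ne (hpos k) (Finsupp.mem_support_iff.1 hk).symm) (Real.exp_pos _)

theorem continuous_logEval {p : LaurentPoly n} (hp : p ≠ 0) (hpos : ∀ k, 0 ≤ p.coeff k) :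
    Continuous (logEval p) := by
  refine Continuous.log ?_ fun x => (evalAt_expMap_pos hp hpos x).ne'
  simp only [evalAt_expMap]
  refine continuous_finsetSum _ fun k _ => continuous_const.mul (Real.continuous_exp.comp ?_)
  exact Continuous.dotProduct continuous_id continuous_const

/-- The support function of the Newton polytope approximates `log p (e ^ x)` up to a constant. -/
theorem exists_abs_logEval_sub_le {p : LaurentPoly n} (hp : p ≠ 0)
    (hpos : ∀ k, 0 ≤ p.coeff k) :
    ∃ κ : ℝ, ∀ x, |logEval p x - tropPoly p x| ≤ κ := by
  obtain ⟨k₀, hk₀, _⟩ := exists_eq_tropPoly hp 0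
  have hcp : ∀ k ∈ p.coeff.support, 0 < p.coeff k := fun k hk =>
    lt_of_le_of_ne (hpos k) (Finsupp.mem_support_iff.1 hk).symm
  set M := ∑ k ∈ p.coeff.support, p.coeff k with hM
  have hMpos : 0 < M := Finset.sum_pos hcp ⟨k₀, hk₀⟩
  refine ⟨|Real.log M| + ∑ k ∈ p.coeff.support, |Real.log (p.coeff k)|, fun x => ?_⟩
  have hev := evalAt_expMap_pos hp hpos x
  have hs : 0 ≤ ∑ k ∈ p.coeff.support, |Real.log (p.coeff k)| :=
    Finset.sum_nonneg fun _ _ => abs_nonneg _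
  rw [abs_le]
  constructor
  · obtain ⟨k, hk, hkx⟩ := exists_eq_tropPoly hp x
    have h1 : p.coeff k * Real.exp (x ⬝ᵥ expVec k) ≤ evalAt p (expMap x) := by
      rw [evalAt_expMap]
      exact Finset.single_le_sum (f := fun k => p.coeff k * Real.exp (x ⬝ᵥ expVec k))
        (fun k hk => (mul_pos (hcp k hk) (Real.exp_pos _)).le) hk
    have h2 := Real.log_le_log (mul_pos (hcp k hk) (Real.exp_pos _)) h1
    rw [Real.log_mul (hcp k hk).ne' (Real.exp_pos _).ne', Real.log_exp, hkx] at h2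
    have h3 : |Real.log (p.coeff k)| ≤ ∑ k ∈ p.coeff.support, |Real.log (p.coeff k)| :=
      Finset.single_le_sum (f := fun k => |Real.log (p.coeff k)|) (fun _ _ => abs_nonneg _) hk
    have h4 := neg_abs_le (Real.log (p.coeff k))
    have h5 := abs_nonneg (Real.log M)
    rw [logEval]
    linarith
  · have h1 : evalAt p (expMap x) ≤ M * Real.exp (tropPoly p x) := by
      rw [evalAt_expMap, hM, Finset.sum_mul]
      refine Finset.sum_le_sum fun k hk => mul_le_mul_of_nonneg_left ?_ (hpos k)
      exact Real.exp_le_exp.2 (dotProduct_le_tropPoly hp x hk)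
    have h2 := Real.log_le_log hev h1
    rw [Real.log_mul hMpos.ne' (Real.exp_pos _).ne', Real.log_exp] at h2
    have h3 := le_abs_self (Real.log M)
    rw [logEval]
    linarith

/-- The logarithm of the integrand. -/
def logIntegrand (P : Fin m → LaurentPoly n) (e : Exponents n m) (x : Fin n → ℝ) : ℂ :=
  ∑ i, e.1 i * (x i : ℂ) + ∑ j, e.2 j * (logEval (P j) x : ℂ)

theorem integrand_expMap {P : Fin m → LaurentPoly n} (hP : ∀ j, P j ≠ 0)
    (hPpos : ∀ j k, 0 ≤ (P j).coeff k) (e : Exponents n m) (x : Fin n → ℝ) :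
    integrand P e (expMap x) = Complex.exp (logIntegrand P e x) := by
  rw [integrand, logIntegrand, Complex.exp_add, Complex.exp_sum, Complex.exp_sum]
  have hcpow : ∀ (r : ℝ) (z : ℂ), ((Real.exp r : ℝ) : ℂ) ^ z = Complex.exp (z * r) := by
    intro r z
    rw [Complex.cpow_def_of_ne_zero (by exact_mod_cast (Real.exp_pos r).ne'), ← Complex.ofReal_log
      (Real.exp_pos r).le, Real.log_exp, mul_comm]
  congr 1
  · exact Finset.prod_congr rfl fun i _ => hcpow _ _
  · refine Finset.prod_congr rfl fun j _ => ?_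
    rw [← hcpow, logEval, Real.exp_log (evalAt_expMap_pos (hP j) (hPpos j) x)]

/-- The logarithm of the term of `S'` in the renormalized integrand of `S`, times `α ^ u`. -/
def logTerm (P : Fin m → LaurentPoly n) (w : (Fin n → ℝ) → (Fin n → ℝ))
    (S S' : Finset (Fin n → ℝ)) (e : Exponents n m) (x : Fin n → ℝ) : ℂ :=
  ∑ ρ ∈ S, tropIntegrand P e ρ * ((w ρ ⬝ᵥ x : ℝ) : ℂ) -
    ∑ ρ ∈ S' \ S, (1 - tropIntegrand P e ρ) * (softplus (w ρ ⬝ᵥ x) : ℂ) +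
    logIntegrand (initialForms P S') e x

theorem tropIntegrand_add (P : Fin m → LaurentPoly n) (a b : Exponents n m) (ρ : Fin n → ℝ) :
    tropIntegrand P (a + b) ρ = tropIntegrand P a ρ + tropIntegrand P b ρ := by
  simp only [tropIntegrand, Prod.fst_add, Prod.snd_add, Pi.add_apply, add_mul,
    Finset.sum_add_distrib]
  ring

theorem tropIntegrand_smul (P : Fin m → LaurentPoly n) (z : ℂ) (a : Exponents n m)
    (ρ : Fin n → ℝ) : tropIntegrand P (z • a) ρ = z * tropIntegrand P a ρ := by
  simp only [tropIntegrand, Prod.smul_fst, Prod.smul_snd, Pi.smul_apply, smul_eq_mul, mul_add,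
    Finset.mul_sum, mul_assoc]

theorem continuous_tropIntegrand (P : Fin m → LaurentPoly n) (ρ : Fin n → ℝ) :
    Continuous fun e : Exponents n m => tropIntegrand P e ρ := by
  unfold tropIntegrand
  fun_prop

theorem continuous_dotProduct_right (y : Fin n → ℝ) : Continuous fun x : Fin n → ℝ => y ⬝ᵥ x :=
  Continuous.dotProduct continuous_const continuous_id

variable {P : Fin m → LaurentPoly n} {w : (Fin n → ℝ) → (Fin n → ℝ)} {S S' : Finset (Fin n → ℝ)}

theorem continuous_logIntegrand (hP : ∀ j, P j ≠ 0) (hPpos : ∀ j k, 0 ≤ (P j).coeff k) :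
    Continuous fun q : Exponents n m × (Fin n → ℝ) => logIntegrand P q.1 q.2 := by
  have h1 := fun j => continuous_logEval (hP j) (hPpos j)
  unfold logIntegrand
  fun_prop

theorem continuous_logTerm (hP : ∀ j, P j ≠ 0) (hPpos : ∀ j k, 0 ≤ (P j).coeff k)
    (hS : Joint P S') :
    Continuous fun q : Exponents n m × (Fin n → ℝ) => logTerm P w S S' q.1 q.2 := by
  have h1 := continuous_logIntegrand (initialForms_ne_zero hP hS)
    (coeff_initialForms_nonneg hPpos S')
  have h2 := continuous_tropIntegrand P
  have h3 := fun ρ => continuous_dotProduct_right (w ρ)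
  have h4 := continuous_softplus
  have h5 : ∀ ρ, Continuous fun q : Exponents n m × (Fin n → ℝ) => tropIntegrand P q.1 ρ :=
    fun ρ => (h2 ρ).comp continuous_fst
  have h6 : ∀ ρ, Continuous fun q : Exponents n m × (Fin n → ℝ) => w ρ ⬝ᵥ q.2 :=
    fun ρ => (h3 ρ).comp continuous_snd
  refine Continuous.add (Continuous.sub ?_ ?_) h1
  · exact continuous_finsetSum _ fun ρ _ =>
      (h5 ρ).mul (Complex.continuous_ofReal.comp (h6 ρ))
  · exact continuous_finsetSum _ fun ρ _ => (continuous_const.sub (h5 ρ)).mul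
      (Complex.continuous_ofReal.comp (h4.comp (h6 ρ)))

theorem continuous_growth (hP : ∀ j, P j ≠ 0) (hS : Joint P S') :
    Continuous fun q : Exponents n m × (Fin n → ℝ) => growth P w S S' q.1 q.2 := by
  have h1 := fun j => continuous_tropPoly (initialForms_ne_zero hP hS j)
  have h2 := continuous_tropIntegrand P
  have h3 := fun ρ => continuous_dotProduct_right (w ρ)
  have h5 : ∀ ρ, Continuous fun q : Exponents n m × (Fin n → ℝ) => (tropIntegrand P q.1 ρ).re :=
    fun ρ => Complex.continuous_re.comp ((h2 ρ).comp continuous_fst)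
  have h6 : ∀ ρ, Continuous fun q : Exponents n m × (Fin n → ℝ) => w ρ ⬝ᵥ q.2 :=
    fun ρ => (h3 ρ).comp continuous_snd
  have h7 : Continuous fun q : Exponents n m × (Fin n → ℝ) =>
      tropIntegrand (initialForms P S') q.1 q.2 := by
    unfold tropIntegrand
    fun_prop
  refine Continuous.add (Continuous.sub ?_ ?_) (Complex.continuous_re.comp h7)
  · exact continuous_finsetSum _ fun ρ _ => (h5 ρ).mul (h6 ρ)
  · exact continuous_finsetSum _ fun ρ _ => (continuous_const.sub (h5 ρ)).mul
      (continuous_const.max (h6 ρ))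

theorem growth_smul (hP : ∀ j, P j ≠ 0) (hS : Joint P S') (e : Exponents n m) (x : Fin n → ℝ)
    {t : ℝ} (ht : 0 ≤ t) : growth P w S S' e (t • x) = t * growth P w S S' e x := by
  have h1 : tropIntegrand (initialForms P S') e (t • x) =
      t * tropIntegrand (initialForms P S') e x := by
    simp only [tropIntegrand, tropPoly_smul (initialForms_ne_zero hP hS _) ht, Pi.smul_apply,
      smul_eq_mul, Complex.ofReal_mul, mul_add, Finset.mul_sum]
    congr 1 <;> exact Finset.sum_congr rfl fun i _ => by ring
  have h2 : ∀ a : ℝ, max 0 (t * a) = t * max 0 a := fun a => by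
    rw [mul_max_of_nonneg _ _ ht, mul_zero]
  simp only [growth, h1, dotProduct_smul, smul_eq_mul, h2, Complex.re_ofReal_mul, mul_add, mul_sub,
    Finset.mul_sum]
  congr 2 <;> exact Finset.sum_congr rfl fun i _ => by ring

theorem exists_re_logTerm_le (hP : ∀ j, P j ≠ 0) (hPpos : ∀ j k, 0 ≤ (P j).coeff k)
    (hS : Joint P S') : ∃ K : Exponents n m → ℝ, Continuous K ∧
      ∀ e x, (logTerm P w S S' e x).re ≤ growth P w S S' e x + K e := by
  choose κ hκ using fun j => exists_abs_logEval_sub_le (initialForms_ne_zero hP hS j)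
    (coeff_initialForms_nonneg hPpos S' j)
  refine ⟨fun e => ∑ ρ ∈ S' \ S, |1 - (tropIntegrand P e ρ).re| * Real.log 2 +
    ∑ j, |(e.2 j).re| * κ j, ?_, fun e x => ?_⟩
  · have h2 := continuous_tropIntegrand P
    refine Continuous.add ?_ (by fun_prop)
    exact continuous_finsetSum _ fun ρ _ => ((continuous_const.sub
      (Complex.continuous_re.comp (h2 ρ))).abs).mul continuous_const
  · have h1 : (logTerm P w S S' e x).re = ∑ ρ ∈ S, (tropIntegrand P e ρ).re * (w ρ ⬝ᵥ x) -
        ∑ ρ ∈ S' \ S, (1 - (tropIntegrand P e ρ).re) * softplus (w ρ ⬝ᵥ x) +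
        (∑ i, (e.1 i).re * x i + ∑ j, (e.2 j).re * logEval (initialForms P S' j) x) := by
      simp [logTerm, logIntegrand, Complex.re_sum]
    have h2 : growth P w S S' e x = ∑ ρ ∈ S, (tropIntegrand P e ρ).re * (w ρ ⬝ᵥ x) -
        ∑ ρ ∈ S' \ S, (1 - (tropIntegrand P e ρ).re) * max 0 (w ρ ⬝ᵥ x) +
        (∑ i, (e.1 i).re * x i + ∑ j, (e.2 j).re * tropPoly (initialForms P S' j) x) := by
      rw [growth]
      congr 1
      simp [tropIntegrand, Complex.re_sum]
    have h3 : ∑ ρ ∈ S' \ S, (1 - (tropIntegrand P e ρ).re) * max 0 (w ρ ⬝ᵥ x) ≤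
        ∑ ρ ∈ S' \ S, (1 - (tropIntegrand P e ρ).re) * softplus (w ρ ⬝ᵥ x) +
        ∑ ρ ∈ S' \ S, |1 - (tropIntegrand P e ρ).re| * Real.log 2 := by
      rw [← Finset.sum_add_distrib]
      refine Finset.sum_le_sum fun ρ _ => ?_
      have h4 := max_le_softplus (w ρ ⬝ᵥ x)
      have h5 := softplus_le_max_add (w ρ ⬝ᵥ x)
      have h6 := Real.log_nonneg one_le_two
      rcases le_total 0 (1 - (tropIntegrand P e ρ).re) with h | h
      · rw [abs_of_nonneg h]
        nlinarith
      · rw [abs_of_nonpos h]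
        nlinarith
    have h4 : ∑ j, (e.2 j).re * logEval (initialForms P S' j) x ≤
        ∑ j, (e.2 j).re * tropPoly (initialForms P S' j) x + ∑ j, |(e.2 j).re| * κ j := by
      rw [← Finset.sum_add_distrib]
      refine Finset.sum_le_sum fun j _ => ?_
      have h5 : (e.2 j).re * (logEval (initialForms P S' j) x -
          tropPoly (initialForms P S' j) x) ≤ |(e.2 j).re| * κ j := by
        refine (le_abs_self _).trans ?_
        rw [abs_mul]
        exact mul_le_mul_of_nonneg_left (hκ j x) (abs_nonneg _)
      linarith
    rw [h1, h2]
    linarith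

theorem decaysNear_exp_logTerm (hP : ∀ j, P j ≠ 0) (hPpos : ∀ j k, 0 ≤ (P j).coeff k)
    (hS : Joint P S') {e₀ : Exponents n m} {x₀ : Fin n → ℝ}
    (hneg : growth P w S S' e₀ x₀ < 0) :
    DecaysNear (fun e x => Complex.exp (logTerm P w S S' e x)) e₀ x₀ := by
  obtain ⟨K, hK, hle⟩ := exists_re_logTerm_le (w := w) (S := S) hP hPpos hS
  exact decaysNear_exp (continuous_growth hP hS) (fun e x t ht => growth_smul hP hS e x ht) hK
    hle hneg

end LogTerms

/-! ### Cancellation of the divergences -/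

section Cancellation

variable {n m : ℕ} {P : Fin m → LaurentPoly n} {R D : Finset (Fin n → ℝ)}
  {w : (Fin n → ℝ) → (Fin n → ℝ)} {S S' : Finset (Fin n → ℝ)}

theorem DecaysNear.of_norm_le {E X : Type*} [TopologicalSpace E] [NormedAddCommGroup X]
    [NormedSpace ℝ X] {f g : E → X → ℂ} {e₀ : E} {x₀ : X} (hg : DecaysNear g e₀ x₀)
    (h : ∀ e x, ‖f e x‖ ≤ ‖g e x‖) : DecaysNear f e₀ x₀ := by
  obtain ⟨δ, hδ, C, hC⟩ := hg
  exact ⟨δ, hδ, C, hC.mono fun q hq t ht => (h _ _).trans (hq t ht)⟩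

theorem DecaysNear.continuous_mul {E X : Type*} [TopologicalSpace E] [NormedAddCommGroup X]
    [NormedSpace ℝ X] {f : E → X → ℂ} {g : E → ℂ} {e₀ : E} {x₀ : X} (hf : DecaysNear f e₀ x₀)
    (hg : Continuous g) : DecaysNear (fun e x => g e * f e x) e₀ x₀ := by
  obtain ⟨δ, hδ, C, hC⟩ := hf
  refine ⟨δ, hδ, (‖g e₀‖ + 1) * C, ?_⟩
  have h1 : ∀ᶠ q : E × X in 𝓝 (e₀, x₀), ‖g q.1‖ < ‖g e₀‖ + 1 :=
    ((hg.norm.comp continuous_fst).tendsto (e₀, x₀)).eventually (gt_mem_nhds (lt_add_one _))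
  filter_upwards [hC, h1] with q h h' t ht
  rw [norm_mul, mul_assoc]
  exact mul_le_mul h'.le (h t ht) (norm_nonneg _) (by positivity)

theorem decaysNear_exp_dotProduct {E : Type*} [TopologicalSpace E] (e₀ : E) {y x₀ : Fin n → ℝ}
    (h : y ⬝ᵥ x₀ < 0) : DecaysNear (fun (_ : E) x => ((Real.exp (y ⬝ᵥ x) : ℝ) : ℂ)) e₀ x₀ := by
  have h1 := decaysNear_exp (E := E) (X := Fin n → ℝ) (lam := fun _ x => ((y ⬝ᵥ x : ℝ) : ℂ))
    (ψ := fun _ x => y ⬝ᵥ x) (K := fun _ => 0) (e₀ := e₀) (x₀ := x₀)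
    ((continuous_dotProduct_right y).comp continuous_snd)
    (fun e x t _ => by rw [dotProduct_smul, smul_eq_mul]) continuous_const
    (fun e x => by simp) h
  simpa only [Complex.ofReal_exp] using h1

theorem decaysNear_softplus {E : Type*} [TopologicalSpace E] (e₀ : E) {y x₀ : Fin n → ℝ}
    (h : y ⬝ᵥ x₀ < 0) : DecaysNear (fun (_ : E) x => ((softplus (y ⬝ᵥ x) : ℝ) : ℂ)) e₀ x₀ := by
  refine (decaysNear_exp_dotProduct e₀ h).of_norm_le fun _ x => ?_
  rw [Complex.norm_real, Complex.norm_real, Real.norm_of_nonneg (softplus_nonneg _),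
    Real.norm_of_nonneg (Real.exp_pos _).le]
  exact softplus_le_exp _

/-- If all exponents that are lost in the initial form along `S' ⊇ S` are dominated, in the
direction `x₀`, by an exponent of this initial form, then both initial forms are equivalent. -/
theorem decaysNear_logEval_sub {E : Type*} [TopologicalSpace E] (e₀ : E) (hP : ∀ j, P j ≠ 0)
    (hPpos : ∀ j k, 0 ≤ (P j).coeff k) (hSS : S ⊆ S') (j : Fin m) {x₀ : Fin n → ℝ}
    {a : Fin n → ℤ} (ha : a ∈ (initialForms P S' j).coeff.support)
    (hlt : ∀ k ∈ (initialForms P S j).coeff.support, k ∉ (initialForms P S' j).coeff.support →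
      x₀ ⬝ᵥ expVec k < x₀ ⬝ᵥ expVec a) :
    DecaysNear (fun (_ : E) x => ((logEval (initialForms P S j) x -
      logEval (initialForms P S' j) x : ℝ) : ℂ)) e₀ x₀ := by
  set p := initialForms P S j with hp
  set q := initialForms P S' j with hq
  have hsub : q.coeff.support ⊆ p.coeff.support := by
    intro k hk
    rw [hq, mem_support_initialForms hP] at hk
    rw [hp, mem_support_initialForms hP]
    exact ⟨hk.1, fun ρ hρ => hk.2 ρ (hSS hρ)⟩
  have hcoeff : ∀ k ∈ q.coeff.support, q.coeff k = p.coeff k := fun k hk => by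
    rw [hp, coeff_initialForms_of_mem (hsub hk), hq, coeff_initialForms_of_mem hk]
  have hpa : 0 < p.coeff a := lt_of_le_of_ne (coeff_initialForms_nonneg hPpos S j a)
    (Finsupp.mem_support_iff.1 (hsub ha)).symm
  have hdec : DecaysNear (fun (_ : E) x => ∑ k ∈ p.coeff.support \ q.coeff.support,
      ((p.coeff k / p.coeff a : ℝ) : ℂ) *
        ((Real.exp ((expVec k - expVec a) ⬝ᵥ x) : ℝ) : ℂ)) e₀ x₀ := by
    refine DecaysNear.sum _ fun k hk => (decaysNear_exp_dotProduct e₀ ?_).const_mul _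
    rw [Finset.mem_sdiff] at hk
    have := hlt k hk.1 hk.2
    rw [sub_dotProduct, dotProduct_comm _ x₀, dotProduct_comm _ x₀]
    linarith
  refine hdec.of_norm_le fun _ x => ?_
  have hA : 0 < evalAt q (expMap x) := by
    have hqne : q ≠ 0 := by
      intro h
      rw [h] at ha
      simp at ha
    exact evalAt_expMap_pos hqne (coeff_initialForms_nonneg hPpos S' j) x
  set B := ∑ k ∈ p.coeff.support \ q.coeff.support, p.coeff k * Real.exp (x ⬝ᵥ expVec k) with hB
  have hBnn : 0 ≤ B := Finset.sum_nonneg fun k _ =>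
    mul_nonneg (coeff_initialForms_nonneg hPpos S j k) (Real.exp_pos _).le
  have hsplit : evalAt p (expMap x) = B + evalAt q (expMap x) := by
    rw [evalAt_expMap, evalAt_expMap, ← Finset.sum_sdiff hsub]
    congr 1
    exact Finset.sum_congr rfl fun k hk => by rw [hcoeff k hk]
  have h1 : 0 ≤ logEval p x - logEval q x := by
    rw [logEval, logEval, sub_nonneg]
    exact Real.log_le_log hA (by linarith)
  have h2 : logEval p x - logEval q x ≤ B / evalAt q (expMap x) := by
    rw [logEval, logEval, ← Real.log_div (by linarith : 0 < evalAt p (expMap x)).ne' hA.ne']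
    refine (Real.log_le_sub_one_of_pos (div_pos (by linarith) hA)).trans (le_of_eq ?_)
    rw [hsplit]
    field_simp
    ring
  have h3 : p.coeff a * Real.exp (x ⬝ᵥ expVec a) ≤ evalAt q (expMap x) := by
    rw [evalAt_expMap, ← hcoeff a ha]
    exact Finset.single_le_sum (f := fun k => q.coeff k * Real.exp (x ⬝ᵥ expVec k))
      (fun k _ => mul_nonneg (coeff_initialForms_nonneg hPpos S' j k) (Real.exp_pos _).le) ha
  have h4 : B / evalAt q (expMap x) ≤ B / (p.coeff a * Real.exp (x ⬝ᵥ expVec a)) :=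
    div_le_div_of_nonneg_left hBnn (mul_pos hpa (Real.exp_pos _)) h3
  have h5 : B / (p.coeff a * Real.exp (x ⬝ᵥ expVec a)) =
      ∑ k ∈ p.coeff.support \ q.coeff.support, p.coeff k / p.coeff a *
        Real.exp ((expVec k - expVec a) ⬝ᵥ x) := by
    rw [hB, Finset.sum_div]
    refine Finset.sum_congr rfl fun k _ => ?_
    rw [sub_dotProduct, dotProduct_comm _ x, dotProduct_comm _ x, Real.exp_sub]
    field_simp
  have h6 : ∑ k ∈ p.coeff.support \ q.coeff.support, ((p.coeff k / p.coeff a : ℝ) : ℂ) *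
        ((Real.exp ((expVec k - expVec a) ⬝ᵥ x) : ℝ) : ℂ) =
      ((∑ k ∈ p.coeff.support \ q.coeff.support, p.coeff k / p.coeff a *
        Real.exp ((expVec k - expVec a) ⬝ᵥ x) : ℝ) : ℂ) := by
    push_cast
    rfl
  rw [h6, ← h5, Complex.norm_real, Complex.norm_real, Real.norm_of_nonneg h1,
    Real.norm_of_nonneg (div_nonneg hBnn (mul_pos hpa (Real.exp_pos _)).le)]
  exact h2.trans h4

/-- Close to the ray `ρ₀`, the terms of `S'` and of `S' ∪ {ρ₀}` cancel. -/
theorem IsFanRays.decaysNear_pair (H : IsFanRays P R) (hPpos : ∀ j k, 0 ≤ (P j).coeff k)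
    (hw : DualOn P D w) (hDR : D ⊆ R) {e₀ : Exponents n m}
    (h0 : ∀ ρ ∈ D, tropIntegrand P e₀ ρ = 0)
    (hneg : ∀ ρ ∈ R, ρ ∉ D → (tropIntegrand P e₀ ρ).re < 0)
    (hSS : S ⊆ S') {ρ₀ : Fin n → ℝ} (hρ₀ : ρ₀ ∉ S') (hSD : insert ρ₀ S' ⊆ D)
    {b : (Fin n → ℝ) → ℝ} (hb : ∀ ρ, ρ ∉ S → 0 ≤ b ρ) (hbρ₀ : b ρ₀ ≠ 0)
    (hbD : ∀ ρ ∈ R, b ρ ≠ 0 → ρ ∈ D)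
    (hJ : Joint P (insert ρ₀ S' ∪ R.filter fun ρ => b ρ ≠ 0)) :
    DecaysNear (fun e x => Complex.exp (logTerm P w S S' e x) -
      Complex.exp (logTerm P w S (insert ρ₀ S') e x)) e₀ (∑ ρ ∈ R, b ρ • ρ) := by
  set x₀ := ∑ ρ ∈ R, b ρ • ρ with hx₀
  have hJ' : Joint P (insert ρ₀ S') := hJ.mono Finset.subset_union_left
  have hρ₀S : ρ₀ ∉ S := fun h => hρ₀ (hSS h)
  have hρ₀D : ρ₀ ∈ D := hSD (Finset.mem_insert_self _ _)
  have hρ₀R : ρ₀ ∈ R := hDR hρ₀D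
  have hbpos : 0 < b ρ₀ := lt_of_le_of_ne (hb ρ₀ hρ₀S) hbρ₀.symm
  have hJD : insert ρ₀ S' ∪ R.filter (fun ρ => b ρ ≠ 0) ⊆ D := by
    refine Finset.union_subset hSD fun s hs => ?_
    exact hbD s (Finset.mem_filter.1 hs).1 (Finset.mem_filter.1 hs).2
  have hwx : w ρ₀ ⬝ᵥ x₀ = - b ρ₀ := by
    rw [hx₀, dotProduct_sum_smul, Finset.sum_eq_single ρ₀]
    · rw [hw.apply hSD hJ' (Finset.mem_insert_self _ _) (Finset.mem_insert_self _ _), if_pos rfl,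
        mul_neg_one]
    · intro s hs hsρ
      by_cases hbs : b s = 0
      · rw [hbs, zero_mul]
      · rw [hw.apply hJD hJ (Finset.mem_union_left _ (Finset.mem_insert_self _ _))
          (Finset.mem_union_right _ (Finset.mem_filter.2 ⟨hs, hbs⟩)), if_neg hsρ.symm, mul_zero]
    · intro h
      exact absurd hρ₀R h
  obtain ⟨K, hK, hle⟩ := exists_re_logTerm_le (w := w) (S := S) H.ne_zero hPpos hJ'
  refine decaysNear_exp_sub_exp (continuous_growth H.ne_zero hJ')
    (fun e x t ht => growth_smul H.ne_zero hJ' e x ht) hK hle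
    (H.growth_nonpos hw hDR h0 hneg (hSS.trans (Finset.subset_insert _ _)) hSD hJ' x₀).1 ?_
  have hdiff : ∀ e x, logTerm P w S S' e x - logTerm P w S (insert ρ₀ S') e x =
      (1 - tropIntegrand P e ρ₀) * ((softplus (w ρ₀ ⬝ᵥ x) : ℝ) : ℂ) +
      ∑ j, e.2 j * ((logEval (initialForms P S' j) x -
        logEval (initialForms P (insert ρ₀ S') j) x : ℝ) : ℂ) := by
    intro e x
    have h1 : insert ρ₀ S' \ S = insert ρ₀ (S' \ S) := Finset.insert_sdiff_of_notMem _ hρ₀S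
    have h2 : ρ₀ ∉ S' \ S := fun h => hρ₀ (Finset.mem_sdiff.1 h).1
    rw [logTerm, logTerm, h1, Finset.sum_insert h2, logIntegrand, logIntegrand]
    simp only [Complex.ofReal_sub, mul_sub, Finset.sum_sub_distrib]
    ring
  simp only [hdiff]
  refine DecaysNear.add ?_ (DecaysNear.sum _ fun j _ => ?_)
  · exact (decaysNear_softplus e₀ (by rw [hwx]; linarith)).continuous_mul
      (continuous_const.sub (continuous_tropIntegrand P ρ₀))
  · refine DecaysNear.continuous_mul (g := fun e : Exponents n m => e.2 j) ?_ (by fun_prop)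
    obtain ⟨a, has, ha⟩ := hJ
    refine decaysNear_logEval_sub e₀ H.ne_zero hPpos (Finset.subset_insert _ _) j (a := a j) ?_ ?_
    · exact (mem_support_initialForms H.ne_zero).2
        ⟨has j, fun ρ hρ => ha ρ (Finset.mem_union_left _ hρ) j⟩
    · intro k hk hk'
      rw [mem_support_initialForms H.ne_zero] at hk hk'
      have hkρ₀ : k ∉ face (P j) ρ₀ := by
        intro h
        refine hk' ⟨hk.1, fun ρ hρ => ?_⟩
        rcases Finset.mem_insert.1 hρ with rfl | hρ
        · exact h
        · exact hk.2 ρ hρ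
      have hdot : ∀ z, x₀ ⬝ᵥ z = ∑ ρ ∈ R, b ρ * (ρ ⬝ᵥ z) := by
        intro z
        rw [hx₀, sum_dotProduct]
        exact Finset.sum_congr rfl fun s _ => by rw [smul_dotProduct, smul_eq_mul]
      rw [hdot, hdot]
      refine Finset.sum_lt_sum (fun ρ hρ => ?_) ⟨ρ₀, hρ₀R, ?_⟩
      · by_cases hbρ : b ρ = 0
        · simp [hbρ]
        have haρ := ha ρ (Finset.mem_union_right _ (Finset.mem_filter.2 ⟨hρ, hbρ⟩)) j
        by_cases hρS : ρ ∈ S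
        · rw [(mem_face.1 haρ).2, (mem_face.1 (hk.2 ρ (hSS hρS))).2]
        · exact mul_le_mul_of_nonneg_left (le_of_mem_face (H.ne_zero j) haρ hk.1) (hb ρ hρS)
      · have haρ := ha ρ₀ (Finset.mem_union_left _ (Finset.mem_insert_self _ _)) j
        refine mul_lt_mul_of_pos_left (lt_of_le_of_ne
          (le_of_mem_face (H.ne_zero j) haρ hk.1) fun h => hkρ₀ ?_) hbpos
        exact mem_face.2 ⟨hk.1, h.trans (mem_face.1 haρ).2⟩

/-- The compatible subsets of `D` that contain `S`. -/
def starSets (P : Fin m → LaurentPoly n) (D S : Finset (Fin n → ℝ)) :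
    Finset (Finset (Fin n → ℝ)) :=
  D.powerset.filter fun S' => Joint P S' ∧ S ⊆ S'

theorem mem_starSets : S' ∈ starSets P D S ↔ S' ⊆ D ∧ Joint P S' ∧ S ⊆ S' := by
  rw [starSets, Finset.mem_filter, Finset.mem_powerset]

/-- The renormalized integrand of `S`, times `α ^ u`, in logarithmic coordinates. -/
def renSum (P : Fin m → LaurentPoly n) (w : (Fin n → ℝ) → (Fin n → ℝ))
    (D S : Finset (Fin n → ℝ)) (e : Exponents n m) (x : Fin n → ℝ) : ℂ :=
  ∑ S' ∈ starSets P D S, (-1 : ℂ) ^ (S'.card - S.card) * Complex.exp (logTerm P w S S' e x)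

/-- The renormalized integrand decays in all directions outside the span of `S`: along the
divergent cones, where the individual terms do not decay, they cancel in pairs. -/
theorem IsFanRays.decaysNear_renSum (H : IsFanRays P R) (hPpos : ∀ j k, 0 ≤ (P j).coeff k)
    (hw : DualOn P D w) (hDR : D ⊆ R) {e₀ : Exponents n m}
    (h0 : ∀ ρ ∈ D, tropIntegrand P e₀ ρ = 0)
    (hneg : ∀ ρ ∈ R, ρ ∉ D → (tropIntegrand P e₀ ρ).re < 0)
    {x₀ : Fin n → ℝ} (hx₀ : ∀ b : (Fin n → ℝ) → ℝ, x₀ ≠ ∑ ρ ∈ S, b ρ • ρ) :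
    DecaysNear (renSum P w D S) e₀ x₀ := by
  -- a term with negative growth rate decays by itself
  have hterm : ∀ S' ∈ starSets P D S, growth P w S S' e₀ x₀ ≠ 0 → DecaysNear (fun e x =>
      (-1 : ℂ) ^ (S'.card - S.card) * Complex.exp (logTerm P w S S' e x)) e₀ x₀ := by
    intro S' hS' hne
    obtain ⟨h1, h2, h3⟩ := mem_starSets.1 hS'
    refine (decaysNear_exp_logTerm H.ne_zero hPpos h2 ?_).const_mul _
    exact lt_of_le_of_ne (H.growth_nonpos hw hDR h0 hneg h3 h1 h2 x₀).1 hne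
  by_cases hcone : ∃ b : (Fin n → ℝ) → ℝ, (∀ ρ, ρ ∉ S → 0 ≤ b ρ) ∧ x₀ = ∑ ρ ∈ R, b ρ • ρ ∧
      (∀ ρ ∈ R, b ρ ≠ 0 → ρ ∈ D) ∧ Joint P (S ∪ R.filter fun ρ => b ρ ≠ 0)
  swap
  · refine DecaysNear.sum _ fun S' hS' => hterm S' hS' fun hzero => hcone ?_
    obtain ⟨h1, h2, h3⟩ := mem_starSets.1 hS'
    obtain ⟨b, hb, hx, hbD, hJ⟩ := (H.growth_nonpos hw hDR h0 hneg h3 h1 h2 x₀).2 hzero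
    exact ⟨b, hb, hx, hbD, hJ.mono (Finset.union_subset_union_left h3)⟩
  obtain ⟨b, hb, hx, hbD, hJ⟩ := hcone
  obtain ⟨ρ₀, hρ₀R, hρ₀S, hbρ₀⟩ : ∃ ρ₀ ∈ R, ρ₀ ∉ S ∧ b ρ₀ ≠ 0 := by
    by_contra hcon
    push Not at hcon
    refine hx₀ (fun ρ => if ρ ∈ R then b ρ else 0) ?_
    have h1 : ∑ ρ ∈ S, (if ρ ∈ R then b ρ else 0) • ρ = ∑ ρ ∈ R ∩ S, b ρ • ρ := by
      simp only [ite_smul, zero_smul]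
      rw [← Finset.sum_filter, Finset.filter_mem_eq_inter, Finset.inter_comm]
    rw [h1, hx]
    symm
    refine Finset.sum_subset Finset.inter_subset_left fun ρ hρ hρ' => ?_
    rw [hcon ρ hρ fun h => hρ' (Finset.mem_inter.2 ⟨hρ, h⟩), zero_smul]
  have hρ₀D := hbD ρ₀ hρ₀R hbρ₀
  -- if the term of `S'` does not decay, then `S'` is compatible with all rays near `x₀`
  have hcompat : ∀ S' ∈ starSets P D S, growth P w S S' e₀ x₀ = 0 →
      Joint P (insert ρ₀ S' ∪ R.filter fun ρ => b ρ ≠ 0) := by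
    intro S' hS' hzero
    obtain ⟨h1, h2, h3⟩ := mem_starSets.1 hS'
    obtain ⟨b', hb', hx', hbD', hJ'⟩ := (H.growth_nonpos hw hDR h0 hneg h3 h1 h2 x₀).2 hzero
    refine (joint_of_sum_eq H.ne_zero h3 hb hb' hJ hJ' (hx.symm.trans hx')).mono ?_
    refine Finset.union_subset (Finset.insert_subset ?_ Finset.subset_union_left)
      Finset.subset_union_right
    exact Finset.mem_union_right _ (Finset.mem_filter.2 ⟨hρ₀R, hbρ₀⟩)
  -- pair `S'` with `S' ∪ {ρ₀}`
  have hsum : ∀ e x, renSum P w D S e x = ∑ S' ∈ (D.erase ρ₀).powerset,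
      ((if Joint P S' ∧ S ⊆ S' then
        (-1 : ℂ) ^ (S'.card - S.card) * Complex.exp (logTerm P w S S' e x) else 0) +
      if Joint P (insert ρ₀ S') ∧ S ⊆ insert ρ₀ S' then (-1 : ℂ) ^ ((insert ρ₀ S').card - S.card) *
        Complex.exp (logTerm P w S (insert ρ₀ S') e x) else 0) := by
    intro e x
    rw [renSum, starSets, Finset.sum_filter]
    conv_lhs => rw [← Finset.insert_erase hρ₀D]
    rw [Finset.sum_powerset_insert (Finset.notMem_erase ρ₀ D), ← Finset.sum_add_distrib]
  have hfun : renSum P w D S = fun e x => ∑ S' ∈ (D.erase ρ₀).powerset,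
      ((if Joint P S' ∧ S ⊆ S' then
        (-1 : ℂ) ^ (S'.card - S.card) * Complex.exp (logTerm P w S S' e x) else 0) +
      if Joint P (insert ρ₀ S') ∧ S ⊆ insert ρ₀ S' then (-1 : ℂ) ^ ((insert ρ₀ S').card - S.card) *
        Complex.exp (logTerm P w S (insert ρ₀ S') e x) else 0) := by
    funext e x
    exact hsum e x
  rw [hfun]
  refine DecaysNear.sum _ fun S' hS' => ?_
  have hS'D : S' ⊆ D := (Finset.mem_powerset.1 hS').trans (Finset.erase_subset _ _)
  have hρ₀S' : ρ₀ ∉ S' := fun h => Finset.notMem_erase ρ₀ D (Finset.mem_powerset.1 hS' h)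
  have hinsD : insert ρ₀ S' ⊆ D := Finset.insert_subset hρ₀D hS'D
  by_cases h2 : Joint P (insert ρ₀ S') ∧ S ⊆ insert ρ₀ S'
  · have hSS : S ⊆ S' := (Finset.subset_insert_iff_of_notMem hρ₀S).1 h2.2
    have h1 : Joint P S' ∧ S ⊆ S' := ⟨h2.1.mono (Finset.subset_insert _ _), hSS⟩
    simp only [if_pos h1, if_pos h2]
    by_cases hcomp : Joint P (insert ρ₀ S' ∪ R.filter fun ρ => b ρ ≠ 0)
    · have hpair := H.decaysNear_pair hPpos hw hDR h0 hneg hSS hρ₀S' hinsD hb hbρ₀ hbD hcomp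
      rw [← hx] at hpair
      have hcard : (insert ρ₀ S').card - S.card = (S'.card - S.card) + 1 := by
        rw [Finset.card_insert_of_notMem hρ₀S']
        have := Finset.card_le_card hSS
        omega
      have heq : (fun e x => (-1 : ℂ) ^ (S'.card - S.card) * Complex.exp (logTerm P w S S' e x) +
          (-1 : ℂ) ^ ((insert ρ₀ S').card - S.card) *
            Complex.exp (logTerm P w S (insert ρ₀ S') e x)) =
          fun e x => (-1 : ℂ) ^ (S'.card - S.card) * (Complex.exp (logTerm P w S S' e x) -
            Complex.exp (logTerm P w S (insert ρ₀ S') e x)) := by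
        funext e x
        rw [hcard, pow_succ]
        ring
      rw [heq]
      exact hpair.const_mul _
    · have hm1 : S' ∈ starSets P D S := mem_starSets.2 ⟨hS'D, h1⟩
      have hm2 : insert ρ₀ S' ∈ starSets P D S := mem_starSets.2 ⟨hinsD, h2⟩
      refine (hterm S' hm1 fun h => hcomp (hcompat S' hm1 h)).add
        (hterm _ hm2 fun h => hcomp ?_)
      have := hcompat _ hm2 h
      rwa [Finset.insert_idem] at this
  · simp only [if_neg h2, add_zero]
    by_cases h1 : Joint P S' ∧ S ⊆ S'
    · simp only [if_pos h1]
      have hm1 : S' ∈ starSets P D S := mem_starSets.2 ⟨hS'D, h1⟩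
      refine hterm S' hm1 fun h => h2 ⟨(hcompat S' hm1 h).mono Finset.subset_union_left, ?_⟩
      exact h1.2.trans (Finset.subset_insert _ _)
    · simp only [if_neg h1]
      exact DecaysNear.zero _ _

end Cancellation

/-! ### Locally dominated families of entire functions -/

section ParameterIntegrals

variable {E X : Type*} [NormedAddCommGroup E] [NormedSpace ℂ E] [MeasurableSpace X]
  {μ : Measure X} {f : E → X → ℂ}

/-- Restricting a locally dominated family of entire functions to a complex line. -/
theorem exists_dominatedHolomorphic_line (hm : ∀ e, AEStronglyMeasurable (f e) μ)
    (hd : ∀ x, Differentiable ℂ fun e => f e x) {e : E} {g : X → ℝ} (hg : Integrable g μ)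
    (hb : ∀ᶠ e' in 𝓝 e, ∀ x, ‖f e' x‖ ≤ g x) (y : E) :
    ∃ r, DominatedHolomorphic μ (fun (z : ℂ) x => f (e + z • y) x) 0 r g := by
  have hc : Continuous fun z : ℂ => e + z • y := by fun_prop
  have h1 : ∀ᶠ z in 𝓝 (0 : ℂ), ∀ x, ‖f (e + z • y) x‖ ≤ g x := by
    have h2 : Tendsto (fun z : ℂ => e + z • y) (𝓝 0) (𝓝 e) := by
      simpa using hc.tendsto 0
    exact h2.eventually hb
  obtain ⟨r, hr, hsub⟩ := Metric.eventually_nhds_iff_ball.1 h1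
  refine ⟨r, hr, hg, fun z _ => hm _, fun x => ?_, hsub⟩
  have h2 : Differentiable ℂ fun z : ℂ => e + z • y := by fun_prop
  exact ((hd x).comp h2).differentiableOn

/-- The integral of a locally dominated family of entire functions is analytic. -/
theorem analyticOnNhd_integral [FiniteDimensional ℂ E] {U : Set E} (hU : IsOpen U)
    (hm : ∀ e, AEStronglyMeasurable (f e) μ) (hd : ∀ x, Differentiable ℂ fun e => f e x)
    (hb : ∀ e ∈ U, ∃ g : X → ℝ, Integrable g μ ∧ ∀ᶠ e' in 𝓝 e, ∀ x, ‖f e' x‖ ≤ g x) :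
    AnalyticOnNhd ℂ (fun e => ∫ x, f e x ∂μ) U := by
  refine osgood hU (fun e he => ?_) fun e he y => ?_
  · obtain ⟨g, hg, hgb⟩ := hb e he
    refine ContinuousAt.continuousWithinAt ?_
    refine MeasureTheory.continuousAt_of_dominated (bound := g) (Eventually.of_forall hm) ?_ hg ?_
    · filter_upwards [hgb] with e' he'
      exact ae_of_all _ he'
    · exact ae_of_all _ fun x => (hd x).continuous.continuousAt
  · obtain ⟨g, hg, hgb⟩ := hb e he
    obtain ⟨r, h⟩ := exists_dominatedHolomorphic_line hm hd hg hgb y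
    exact h.analyticAt_integral.differentiableAt

end ParameterIntegrals

/-! ### The slices in logarithmic coordinates -/

section Slices

variable {n m : ℕ} {P : Fin m → LaurentPoly n} {R D S S' : Finset (Fin n → ℝ)}
  {w : (Fin n → ℝ) → (Fin n → ℝ)}

/-- Extension by zero of the coordinates labelled by `J`. -/
def sliceLin (J : Finset (Fin n)) : (J → ℝ) →L[ℝ] (Fin n → ℝ) :=
  ContinuousLinearMap.pi fun i =>
    if h : i ∈ J then ContinuousLinearMap.proj (R := ℝ) (φ := fun _ : J => ℝ) ⟨i, h⟩ else 0

theorem sliceLin_apply (J : Finset (Fin n)) (y : J → ℝ) (i : Fin n) :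
    sliceLin J y i = if h : i ∈ J then y ⟨i, h⟩ else 0 := by
  rw [sliceLin, ContinuousLinearMap.pi_apply]
  split_ifs <;> rfl

theorem sliceEmb_expMap (J : Finset (Fin n)) (y : J → ℝ) :
    sliceEmb J (expMap y) = expMap (sliceLin J y) := by
  funext i
  rw [sliceEmb, expMap, sliceLin_apply]
  split_ifs
  · rfl
  · rw [Real.exp_zero]

theorem dotProduct_sliceLin (J : Finset (Fin n)) (a : Fin n → ℝ) (y : J → ℝ) :
    a ⬝ᵥ sliceLin J y = ∑ j : J, a j * y j := by
  simp only [dotProduct, sliceLin_apply, mul_dite, mul_zero]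
  rw [← Finset.sum_subset (Finset.subset_univ J)]
  · rw [← Finset.sum_attach J]
    refine Finset.sum_congr rfl fun j _ => ?_
    rw [dif_pos j.2]
  · intro i _ hi
    rw [dif_neg hi]

/-- A nonzero minor is the determinant of an honest square matrix, whose rows are labelled by the
complement of `J` and whose columns are the vectors of `S`. -/
theorem exists_equiv_of_absMinor_ne_zero {J : Finset (Fin n)} (h : absMinor S Jᶜ ≠ 0) :
    ∃ g : {i // i ∉ J} ≃ S, (Matrix.of fun i k : {i // i ∉ J} => (g k : Fin n → ℝ) i).det ≠ 0 ∧
      absMinor S Jᶜ = |(Matrix.of fun i k : {i // i ∉ J} => (g k : Fin n → ℝ) i).det| := by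
  have hcard : (Jᶜ).card = S.card := by
    by_contra hne
    exact h (by rw [absMinor, dif_neg hne])
  let q : {i // i ∉ J} ≃ (Jᶜ : Finset (Fin n)) :=
    Equiv.subtypeEquivRight fun i => Finset.mem_compl.symm
  refine ⟨q.trans (Finset.equivOfCardEq hcard), ?_⟩
  have h1 : absMinor S Jᶜ = |(Matrix.of fun i k : {i // i ∉ J} =>
      ((q.trans (Finset.equivOfCardEq hcard)) k : Fin n → ℝ) i).det| := by
    rw [absMinor, dif_pos hcard, ← Matrix.det_submatrix_equiv_self q]
    rfl
  exact ⟨fun h2 => h (by rw [h1, h2, abs_zero]), h1⟩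

/-- The slice is transversal to the span of the rays. -/
theorem sliceLin_ne_sum {J : Finset (Fin n)} (h : absMinor S Jᶜ ≠ 0) {y : J → ℝ} (hy : y ≠ 0)
    (b : (Fin n → ℝ) → ℝ) : sliceLin J y ≠ ∑ ρ ∈ S, b ρ • ρ := by
  intro heq
  obtain ⟨g, hg, -⟩ := exists_equiv_of_absMinor_ne_zero h
  have h1 : (Matrix.of fun i k : {i // i ∉ J} => (g k : Fin n → ℝ) i) *ᵥ (fun k => b (g k)) =
      0 := by
    funext i
    have h2 := congrFun heq i
    rw [sliceLin_apply, dif_neg i.2, Finset.sum_apply, ← Finset.sum_coe_sort,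
      ← Equiv.sum_comp g] at h2
    rw [Matrix.mulVec, dotProduct, Pi.zero_apply, h2]
    exact Finset.sum_congr rfl fun k _ => by simp [mul_comm]
  have h3 := Matrix.eq_zero_of_mulVec_eq_zero hg h1
  have h4 : sliceLin J y = 0 := by
    rw [heq]
    refine Finset.sum_eq_zero fun ρ hρ => ?_
    have h5 := congrFun h3 (g.symm ⟨ρ, hρ⟩)
    simp only [Equiv.apply_symm_apply, Pi.zero_apply] at h5
    rw [h5, zero_smul]
  refine hy (funext fun j => ?_)
  have h5 := congrFun h4 j
  rw [sliceLin_apply, dif_pos j.2] at h5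
  exact h5

theorem differentiable_tropIntegrand (P : Fin m → LaurentPoly n) (ρ : Fin n → ℝ) :
    Differentiable ℂ fun e : Exponents n m => tropIntegrand P e ρ := by
  unfold tropIntegrand
  fun_prop

theorem differentiable_logTerm (P : Fin m → LaurentPoly n) (w : (Fin n → ℝ) → (Fin n → ℝ))
    (S S' : Finset (Fin n → ℝ)) (x : Fin n → ℝ) :
    Differentiable ℂ fun e : Exponents n m => logTerm P w S S' e x := by
  have h1 := differentiable_tropIntegrand P
  unfold logTerm logIntegrand
  fun_prop

theorem differentiable_renSum (P : Fin m → LaurentPoly n) (w : (Fin n → ℝ) → (Fin n → ℝ))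
    (D S : Finset (Fin n → ℝ)) (x : Fin n → ℝ) :
    Differentiable ℂ fun e : Exponents n m => renSum P w D S e x := by
  unfold renSum
  refine Differentiable.fun_sum fun S' _ => ?_
  exact (differentiable_logTerm P w S S' x).cexp.const_mul _

theorem continuous_renSum (hP : ∀ j, P j ≠ 0) (hPpos : ∀ j k, 0 ≤ (P j).coeff k)
    (e : Exponents n m) : Continuous fun x => renSum P w D S e x := by
  have h1 : ∀ S' ∈ starSets P D S, Continuous fun x => Complex.exp (logTerm P w S S' e x) := by
    intro S' hS'
    have h2 := continuous_logTerm (w := w) (S := S) hP hPpos (mem_starSets.1 hS').2.1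
    have h3 : Continuous fun x : Fin n → ℝ => (e, x) := by fun_prop
    exact (h2.comp h3).cexp
  unfold renSum
  exact continuous_finsetSum _ fun S' hS' => Continuous.mul continuous_const (h1 S' hS')

/-- Locally in the exponents, the renormalized integrand is dominated on the slice. -/
theorem IsFanRays.exists_bound_renSum (H : IsFanRays P R) (hPpos : ∀ j k, 0 ≤ (P j).coeff k)
    (hw : DualOn P D w) (hDR : D ⊆ R) {e₀ : Exponents n m}
    (h0 : ∀ ρ ∈ D, tropIntegrand P e₀ ρ = 0)
    (hneg : ∀ ρ ∈ R, ρ ∉ D → (tropIntegrand P e₀ ρ).re < 0)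
    {J : Finset (Fin n)} (hJ : absMinor S Jᶜ ≠ 0) :
    ∃ g : (J → ℝ) → ℝ, Integrable g ∧
      ∀ᶠ e in 𝓝 e₀, ∀ y, ‖renSum P w D S e (sliceLin J y)‖ ≤ g y := by
  have hcont : ContinuousAt (fun e => renSum P w D S e (sliceLin J 0)) e₀ :=
    (differentiable_renSum P w D S (sliceLin J 0)).continuous.continuousAt
  obtain ⟨δ, hδ, C, hC⟩ := exists_bound_of_decaysNear
    (f := fun e (y : J → ℝ) => renSum P w D S e (sliceLin J y)) hcont fun y hy =>
    (H.decaysNear_renSum hPpos hw hDR h0 hneg (sliceLin_ne_sum hJ hy)).comp (sliceLin J)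
  exact ⟨_, (integrable_exp_neg_mul_norm hδ).const_mul C, hC⟩

/-! ### Translation of the subtraction scheme -/

theorem dualOn_of_geometricProperty (hP : ∀ j, P j ≠ 0) (hPpos : ∀ j k, 0 ≤ (P j).coeff k)
    {e₀ : Exponents n m} (hw : GeometricProperty P e₀ R w) : DualOn P (divRays P e₀ R) w := by
  intro ρ hρ ρ' hρ' hJ
  refine hw ρ hρ ρ' hρ' ?_
  have := (compatible_iff_joint hP hPpos {ρ, ρ'}).2 hJ
  simpa using this

theorem IsFanRays.coneRays_hull (H : IsFanRays P R) (hSR : S ⊆ R) (hS : Joint P S) :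
    coneRays R (PointedCone.hull ℝ (S : Set (Fin n → ℝ))) = S := by
  ext ρ
  rw [coneRays, Finset.mem_filter]
  refine ⟨fun h => H.mem_of_mem_hull hSR hS h.1 h.2, fun h => ⟨hSR h, ?_⟩⟩
  exact Submodule.subset_span h

theorem IsFanRays.hull_le_hull_iff (H : IsFanRays P R) (hSR : S ⊆ R) (hSR' : S' ⊆ R)
    (hS' : Joint P S') : PointedCone.hull ℝ (S : Set (Fin n → ℝ)) ≤
      PointedCone.hull ℝ (S' : Set (Fin n → ℝ)) ↔ S ⊆ S' := by
  refine ⟨fun h ρ hρ => ?_, fun h => Submodule.span_mono (Finset.coe_subset.2 h)⟩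
  exact H.mem_of_mem_hull hSR' hS' (hSR hρ) (h (Submodule.subset_span hρ))

theorem DualOn.coneDim_hull (hw : DualOn P D w) (hSD : S ⊆ D) (hS : Joint P S) :
    coneDim (PointedCone.hull ℝ (S : Set (Fin n → ℝ))) = S.card := by
  rw [EulerSubtraction.coneDim_hull]
  refine finrank_span_finset_eq_card ?_
  rw [linearIndepOn_finset_iff]
  intro b hb ρ hρ
  have h1 : w ρ ⬝ᵥ (∑ s ∈ S, b s • s) = 0 := by
    have : ∑ s ∈ S, b s • s = 0 := hb
    rw [this, dotProduct_zero]
  rw [dotProduct_sum_smul, Finset.sum_eq_single ρ] at h1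
  · rw [hw.apply hSD hS hρ hρ, if_pos rfl] at h1
    linarith
  · intro s hs hsρ
    rw [hw.apply hSD hS hρ hs, if_neg hsρ.symm, mul_zero]
  · exact fun h => absurd hρ h

/-- The cones of the divergent fan correspond to the jointly compatible sets of divergent rays. -/
theorem divFan_eq_image (hP : ∀ j, P j ≠ 0) (hPpos : ∀ j k, 0 ≤ (P j).coeff k)
    (e₀ : Exponents n m) : divFan P e₀ R = (starSets P (divRays P e₀ R) ∅).image
      fun S : Finset (Fin n → ℝ) => PointedCone.hull ℝ (S : Set (Fin n → ℝ)) := by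
  ext σ
  -- `divFan` filters a finset of finsets coerced to a finset of sets; `bind` and `pure` come from
  -- this coercion
  simp only [divFan, Finset.mem_image, Finset.mem_filter, Finset.bind_def, Finset.pure_def,
    Finset.mem_sup, Finset.mem_singleton, Finset.mem_powerset, mem_starSets, Finset.empty_subset,
    and_true]
  constructor
  · rintro ⟨X, ⟨⟨S, hS, rfl⟩, hX⟩, rfl⟩
    exact ⟨S, ⟨hS, (compatible_iff_joint hP hPpos S).1 hX⟩, rfl⟩
  · rintro ⟨S, ⟨hS, hJ⟩, rfl⟩
    exact ⟨S, ⟨⟨S, hS, rfl⟩, (compatible_iff_joint hP hPpos S).2 hJ⟩, rfl⟩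

theorem divRays_subset (e₀ : Exponents n m) : divRays P e₀ R ⊆ R := Finset.filter_subset _ _

theorem IsFanRays.hull_injOn (H : IsFanRays P R) (hDR : D ⊆ R) (S₀ : Finset (Fin n → ℝ)) :
    Set.InjOn (fun S : Finset (Fin n → ℝ) => PointedCone.hull ℝ (S : Set (Fin n → ℝ)))
      (starSets P D S₀) := by
  intro S hS S' hS' heq
  have h1 := mem_starSets.1 hS
  have h2 := mem_starSets.1 hS'
  have h3 := congrArg (coneRays R) heq
  simp only at h3
  rwa [H.coneRays_hull (h1.1.trans hDR) h1.2.1, H.coneRays_hull (h2.1.trans hDR) h2.2.1] at h3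

theorem IsFanRays.sum_divFan (H : IsFanRays P R) (hPpos : ∀ j k, 0 ≤ (P j).coeff k)
    (e₀ : Exponents n m) (f : PointedCone ℝ (Fin n → ℝ) → ℂ) :
    ∑ σ ∈ divFan P e₀ R, f σ = ∑ S ∈ starSets P (divRays P e₀ R) ∅,
      f (PointedCone.hull ℝ (S : Set (Fin n → ℝ))) := by
  rw [divFan_eq_image H.ne_zero hPpos, Finset.sum_image (H.hull_injOn (divRays_subset e₀) ∅)]

theorem IsFanRays.divFan_filter (H : IsFanRays P R) (hPpos : ∀ j k, 0 ≤ (P j).coeff k)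
    {e₀ : Exponents n m} (hSD : S ⊆ divRays P e₀ R) :
    (divFan P e₀ R).filter (fun σ' => PointedCone.hull ℝ (S : Set (Fin n → ℝ)) ≤ σ') =
      (starSets P (divRays P e₀ R) S).image
        fun S' : Finset (Fin n → ℝ) => PointedCone.hull ℝ (S' : Set (Fin n → ℝ)) := by
  have hDR := divRays_subset (P := P) (R := R) e₀
  ext σ
  rw [divFan_eq_image H.ne_zero hPpos, Finset.mem_filter, Finset.mem_image, Finset.mem_image]
  constructor
  · rintro ⟨⟨S', hS', rfl⟩, hle⟩
    have h1 := mem_starSets.1 hS'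
    exact ⟨S', mem_starSets.2 ⟨h1.1, h1.2.1, (H.hull_le_hull_iff (hSD.trans hDR)
      (h1.1.trans hDR) h1.2.1).1 hle⟩, rfl⟩
  · rintro ⟨S', hS', rfl⟩
    have h1 := mem_starSets.1 hS'
    exact ⟨⟨S', mem_starSets.2 ⟨h1.1, h1.2.1, Finset.empty_subset _⟩, rfl⟩,
      Submodule.span_mono (Finset.coe_subset.2 h1.2.2)⟩

theorem ofReal_exp_cpow (r : ℝ) (z : ℂ) : ((Real.exp r : ℝ) : ℂ) ^ z = Complex.exp (z * r) := by
  rw [Complex.cpow_def_of_ne_zero (by exact_mod_cast (Real.exp_pos r).ne'), ← Complex.ofReal_log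
    (Real.exp_pos r).le, Real.log_exp, mul_comm]

theorem IsFanRays.vFactor_hull_expMap (H : IsFanRays P R) (hSR : S ⊆ R) (hS : Joint P S)
    (e : Exponents n m) (x : Fin n → ℝ) :
    vFactor P R w e (PointedCone.hull ℝ (S : Set (Fin n → ℝ))) (expMap x) =
      Complex.exp (-∑ ρ ∈ S, (1 - tropIntegrand P e ρ) * (softplus (w ρ ⬝ᵥ x) : ℂ)) := by
  rw [vFactor, H.coneRays_hull hSR hS, ← Finset.sum_neg_distrib, Complex.exp_sum]
  refine Finset.prod_congr rfl fun ρ _ => ?_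
  have h1 : ∏ i, expMap x i ^ w ρ i = Real.exp (w ρ ⬝ᵥ x) := by
    rw [dotProduct, Real.exp_sum]
    refine Finset.prod_congr rfl fun i _ => ?_
    rw [expMap, ← Real.exp_mul, mul_comm]
  have h2 : 1 / (1 + Real.exp (w ρ ⬝ᵥ x)) = Real.exp (-softplus (w ρ ⬝ᵥ x)) := by
    rw [softplus, Real.exp_neg, Real.exp_log (by positivity), one_div]
  rw [h1, h2, ofReal_exp_cpow]
  push_cast
  ring_nf

/-- The renormalized integrands of the subtraction scheme in logarithmic coordinates. -/
theorem IsFanRays.sliceIntegrand_expMap (H : IsFanRays P R)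
    (hPpos : ∀ j k, 0 ≤ (P j).coeff k) {e₀ : Exponents n m}
    (hw : DualOn P (divRays P e₀ R) w) (hSD : S ⊆ divRays P e₀ R) (hS : Joint P S)
    (e : Exponents n m) (J : Finset (Fin n)) (y : J → ℝ) :
    sliceIntegrand P e₀ R w e (PointedCone.hull ℝ (S : Set (Fin n → ℝ))) J (expMap y) =
      renSum P w (divRays P e₀ R) S e (sliceLin J y) := by
  have hDR := divRays_subset (P := P) (R := R) e₀
  rw [sliceIntegrand, H.coneRays_hull (hSD.trans hDR) hS, sliceEmb_expMap, renormalized,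
    H.divFan_filter hPpos hSD, Finset.sum_image (H.hull_injOn hDR S),
    H.vFactor_hull_expMap (hSD.trans hDR) hS, ← Complex.exp_neg, ← mul_assoc, renSum,
    Finset.mul_sum]
  have hu : ∏ j : J, ((expMap y j : ℝ) : ℂ) ^ (∑ ρ ∈ S, tropIntegrand P e ρ * (w ρ j : ℂ)) =
      Complex.exp (∑ ρ ∈ S, tropIntegrand P e ρ * ((w ρ ⬝ᵥ sliceLin J y : ℝ) : ℂ)) := by
    simp only [dotProduct_sliceLin, Complex.ofReal_sum, Finset.mul_sum]
    rw [Finset.sum_comm, Complex.exp_sum]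
    refine Finset.prod_congr rfl fun j _ => ?_
    rw [expMap, ofReal_exp_cpow, Finset.sum_mul]
    congr 1
    refine Finset.sum_congr rfl fun ρ _ => ?_
    push_cast
    ring
  refine Finset.sum_congr rfl fun S' hS' => ?_
  obtain ⟨h1, h2, h3⟩ := mem_starSets.1 hS'
  have hint : integrand (fun j => initialForm (P j)
      (PointedCone.hull ℝ (S' : Set (Fin n → ℝ)))) e (expMap (sliceLin J y)) =
      Complex.exp (logIntegrand (initialForms P S') e (sliceLin J y)) :=
    integrand_expMap (initialForms_ne_zero H.ne_zero h2) (coeff_initialForms_nonneg hPpos S') _ _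
  rw [hu, H.vFactor_hull_expMap (h1.trans hDR) h2, hint, hw.coneDim_hull h1 h2,
    hw.coneDim_hull hSD hS, logTerm, ← Finset.sum_sdiff h3]
  have hcomb : ∀ a b c d s : ℂ, Complex.exp a * Complex.exp b *
      (s * Complex.exp c * Complex.exp d) = s * Complex.exp (a + b + c + d) := by
    intro a b c d s
    simp only [Complex.exp_add]
    ring
  rw [hcomb]
  congr 2
  ring

/-- Local finiteness of the renormalized integrands along a line of exponents. -/
theorem IsFanRays.locallyFiniteFamily_sliceIntegrand (H : IsFanRays P R)
    (hPpos : ∀ j k, 0 ≤ (P j).coeff k) {e₀ e₁ : Exponents n m} (hlog : LogDivergent P e₀ R)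
    (hw : DualOn P (divRays P e₀ R) w) (hSD : S ⊆ divRays P e₀ R) (hS : Joint P S)
    {J : Finset (Fin n)} (hJ : absMinor S Jᶜ ≠ 0) :
    LocallyFiniteFamily (logMeasure J) fun ε => sliceIntegrand P e₀ R w (affineExp e₀ e₁ ε)
      (PointedCone.hull ℝ (S : Set (Fin n → ℝ))) J := by
  refine locallyFiniteFamily_logMeasure ?_
  simp only [H.sliceIntegrand_expMap hPpos hw hSD hS]
  obtain ⟨g, hg, hgb⟩ := H.exists_bound_renSum hPpos hw (divRays_subset e₀)
    (fun ρ hρ => (Finset.mem_filter.1 hρ).2)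
    (fun ρ hρ hρD => (hlog ρ hρ).resolve_left fun h => hρD (Finset.mem_filter.2 ⟨hρ, h⟩)) hJ
  obtain ⟨r, hr⟩ := exists_dominatedHolomorphic_line (μ := volume)
    (f := fun e (y : J → ℝ) => renSum P w (divRays P e₀ R) S e (sliceLin J y))
    (fun e => ((continuous_renSum H.ne_zero hPpos e).comp
      (sliceLin J).continuous).aestronglyMeasurable)
    (fun y => differentiable_renSum P w _ S _) hg hgb e₁
  exact hr.locallyFiniteFamily

end Slices

/-! ### The domain of convergence -/

section Convergence

variable {n m : ℕ} {P : Fin m → LaurentPoly n} {R D S' : Finset (Fin n → ℝ)}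
  {w : (Fin n → ℝ) → (Fin n → ℝ)}

theorem logTerm_empty (hP : ∀ j, P j ≠ 0) (w : (Fin n → ℝ) → (Fin n → ℝ)) (e : Exponents n m)
    (x : Fin n → ℝ) : logTerm P w ∅ ∅ e x = logIntegrand P e x := by
  rw [logTerm, initialForms_empty hP]
  simp

/-- Where all rays are convergent, the terms of the subtraction formula are locally dominated. -/
theorem IsFanRays.exists_bound_exp_logTerm (H : IsFanRays P R)
    (hPpos : ∀ j k, 0 ≤ (P j).coeff k) (hw : DualOn P D w) (hDR : D ⊆ R)
    {e : Exponents n m} (hneg : ∀ ρ ∈ R, (tropIntegrand P e ρ).re < 0) (hSD : S' ⊆ D)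
    (hS : Joint P S') (hsmall : ∀ ρ ∈ R, ρ ∉ D →
      ∑ s ∈ S', -(tropIntegrand P e s).re * |w s ⬝ᵥ ρ| < -(tropIntegrand P e ρ).re) :
    ∃ g : (Fin n → ℝ) → ℝ, Integrable g ∧
      ∀ᶠ e' in 𝓝 e, ∀ x, ‖Complex.exp (logTerm P w ∅ S' e' x)‖ ≤ g x := by
  obtain ⟨δ, hδ, C, hC⟩ := exists_bound_of_decaysNear
    (f := fun e' x => Complex.exp (logTerm P w ∅ S' e' x)) (e₀ := e)
    (differentiable_logTerm P w ∅ S' 0).cexp.continuous.continuousAt fun x hx =>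
    decaysNear_exp_logTerm H.ne_zero hPpos hS (H.growth_neg hw hDR hneg hSD hS hsmall hx)
  exact ⟨_, (integrable_exp_neg_mul_norm hδ).const_mul C, hC⟩

theorem IsFanRays.exists_bound_exp_logIntegrand (H : IsFanRays P R)
    (hPpos : ∀ j k, 0 ≤ (P j).coeff k) {e : Exponents n m}
    (hneg : ∀ ρ ∈ R, (tropIntegrand P e ρ).re < 0) :
    ∃ g : (Fin n → ℝ) → ℝ, Integrable g ∧
      ∀ᶠ e' in 𝓝 e, ∀ x, ‖Complex.exp (logIntegrand P e' x)‖ ≤ g x := by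
  have hJ : Joint P ∅ := by
    choose v hv using fun j => exists_eq_tropPoly (H.ne_zero j) 0
    exact ⟨v, fun j => (hv j).1, by simp⟩
  have h := H.exists_bound_exp_logTerm (D := ∅) (S' := ∅) (w := 0) hPpos (by simp [DualOn])
    (Finset.empty_subset R) hneg (Finset.empty_subset _) hJ
    (fun ρ hρ _ => by simpa using hneg ρ hρ)
  simpa only [logTerm_empty H.ne_zero] using h

theorem tropPoly_add_le {p : LaurentPoly n} (hp : p ≠ 0) (x y : Fin n → ℝ) :
    tropPoly p (x + y) ≤ tropPoly p x + tropPoly p y := by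
  obtain ⟨k, hk, h⟩ := exists_eq_tropPoly hp (x + y)
  rw [← h, add_dotProduct]
  exact add_le_add (dotProduct_le_tropPoly hp x hk) (dotProduct_le_tropPoly hp y hk)

theorem exists_abs_tropPoly_add_sub_le {p : LaurentPoly n} (hp : p ≠ 0) :
    ∃ M, ∀ x, ∀ y ∈ Metric.closedBall (0 : Fin n → ℝ) 1,
      |tropPoly p (x + y) - tropPoly p x| ≤ M := by
  have hc : Continuous fun y => |tropPoly p y| + |tropPoly p (-y)| := by
    have := continuous_tropPoly hp
    fun_prop
  obtain ⟨M, hM⟩ := (isCompact_closedBall (0 : Fin n → ℝ) 1).exists_bound_of_continuousOn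
    hc.continuousOn
  refine ⟨M, fun x y hy => ?_⟩
  have h1 := tropPoly_add_le hp x y
  have h2 := tropPoly_add_le hp (x + y) (-y)
  rw [add_neg_cancel_right] at h2
  have h3 := hM y hy
  rw [Real.norm_of_nonneg (by positivity)] at h3
  have h4 := abs_nonneg (tropPoly p y)
  have h5 := abs_nonneg (tropPoly p (-y))
  rw [abs_le]
  constructor
  · linarith [le_abs_self (tropPoly p (-y))]
  · linarith [le_abs_self (tropPoly p y)]

theorem re_tropIntegrand (P : Fin m → LaurentPoly n) (e : Exponents n m) (x : Fin n → ℝ) :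
    (tropIntegrand P e x).re = ∑ i, (e.1 i).re * x i + ∑ j, (e.2 j).re * tropPoly (P j) x := by
  simp [tropIntegrand, Complex.re_sum]

theorem tropIntegrand_smul_right (hP : ∀ j, P j ≠ 0) (e : Exponents n m) (x : Fin n → ℝ) {t : ℝ}
    (ht : 0 ≤ t) : tropIntegrand P e (t • x) = t * tropIntegrand P e x := by
  simp only [tropIntegrand, tropPoly_smul (hP _) ht, Pi.smul_apply, smul_eq_mul,
    Complex.ofReal_mul, mul_add, Finset.mul_sum]
  congr 1 <;> exact Finset.sum_congr rfl fun i _ => by ring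

/-- On the unit ball around any point, the integrand is bounded below by a constant times the
exponential of its tropicalization at the centre, with a constant independent of the centre. -/
theorem exists_le_re_logIntegrand (hP : ∀ j, P j ≠ 0) (hPpos : ∀ j k, 0 ≤ (P j).coeff k)
    (e : Exponents n m) : ∃ K, ∀ x, ∀ y ∈ Metric.closedBall (0 : Fin n → ℝ) 1,
      (tropIntegrand P e x).re - K ≤ (logIntegrand P e (x + y)).re := by
  choose κ hκ using fun j => exists_abs_logEval_sub_le (hP j) (hPpos j)
  choose M hM using fun j => exists_abs_tropPoly_add_sub_le (hP j)
  refine ⟨∑ i, |(e.1 i).re| + ∑ j, |(e.2 j).re| * (κ j + M j), fun x y hy => ?_⟩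
  have h1 : (logIntegrand P e (x + y)).re - (tropIntegrand P e x).re =
      ∑ i, (e.1 i).re * y i + ∑ j, (e.2 j).re * (logEval (P j) (x + y) - tropPoly (P j) x) := by
    rw [re_tropIntegrand]
    simp only [logIntegrand, Complex.add_re, Complex.re_sum, Complex.re_mul_ofReal, Pi.add_apply,
      mul_add, mul_sub, Finset.sum_add_distrib, Finset.sum_sub_distrib]
    ring
  have h2 : ∀ i, -|(e.1 i).re| ≤ (e.1 i).re * y i := by
    intro i
    have h3 : |y i| ≤ 1 := by
      have := (norm_le_pi_norm y i).trans (mem_closedBall_zero_iff.1 hy)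
      simpa using this
    refine le_trans ?_ (neg_abs_le _)
    rw [abs_mul]
    nlinarith [abs_nonneg (e.1 i).re]
  have h4 : ∀ j, -(|(e.2 j).re| * (κ j + M j)) ≤
      (e.2 j).re * (logEval (P j) (x + y) - tropPoly (P j) x) := by
    intro j
    refine le_trans ?_ (neg_abs_le _)
    rw [abs_mul]
    have h5 := hκ j (x + y)
    have h6 := hM j x y hy
    have h7 : |logEval (P j) (x + y) - tropPoly (P j) x| ≤ κ j + M j := by
      have := abs_add_le (logEval (P j) (x + y) - tropPoly (P j) (x + y))
        (tropPoly (P j) (x + y) - tropPoly (P j) x)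
      rw [sub_add_sub_cancel] at this
      linarith
    exact neg_le_neg (mul_le_mul_of_nonneg_left h7 (abs_nonneg _))
  have h8 := Finset.sum_le_sum fun i (_ : i ∈ Finset.univ) => h2 i
  have h9 := Finset.sum_le_sum fun j (_ : j ∈ Finset.univ) => h4 j
  rw [Finset.sum_neg_distrib] at h8 h9
  linarith

/-- Unit balls with centres far enough apart on a half-line have infinite total volume. -/
theorem measure_iUnion_ball_eq_top {v : Fin n → ℝ} (hv : v ≠ 0) :
    ∃ s : ℝ, 0 ≤ s ∧ volume (⋃ k : ℕ, Metric.ball (((k : ℝ) * s) • v) 1) = ⊤ := by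
  have hv' : 0 < ‖v‖ := norm_pos_iff.2 hv
  refine ⟨2 / ‖v‖, by positivity, ?_⟩
  have hdist : ∀ k l : ℕ, dist (((k : ℝ) * (2 / ‖v‖)) • v) (((l : ℝ) * (2 / ‖v‖)) • v) =
      2 * |(k : ℝ) - l| := by
    intro k l
    rw [dist_eq_norm, ← sub_smul, norm_smul, ← sub_mul, Real.norm_eq_abs, abs_mul,
      abs_of_pos (by positivity : 0 < 2 / ‖v‖)]
    field_simp
  rw [measure_iUnion _ fun k => Metric.isOpen_ball.measurableSet]
  · simp only [Measure.addHaar_ball_center]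
    exact ENNReal.tsum_const_eq_top_of_ne_zero (Metric.measure_ball_pos volume _ one_pos).ne'
  · intro k l hkl
    refine Metric.ball_disjoint_ball ?_
    rw [hdist]
    have h1 : (1 : ℝ) ≤ |(k : ℝ) - l| := by
      have : (1 : ℤ) ≤ |(k : ℤ) - l| := Int.one_le_abs (by omega)
      exact_mod_cast this
    linarith

theorem mem_convergenceDomain (hP : ∀ j, P j ≠ 0) (hPpos : ∀ j k, 0 ≤ (P j).coeff k)
    {e : Exponents n m} : e ∈ convergenceDomain P ↔
      Integrable fun x : Fin n → ℝ => Complex.exp (logIntegrand P e x) := by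
  have : e ∈ convergenceDomain P ↔ Integrable (integrand P e) (logMeasure (Fin n)) := Iff.rfl
  rw [this, integrable_logMeasure_iff]
  simp only [integrand_expMap hP hPpos]

theorem eulerIntegral_eq (hP : ∀ j, P j ≠ 0) (hPpos : ∀ j k, 0 ≤ (P j).coeff k)
    (e : Exponents n m) : eulerIntegral P e = ∫ x, Complex.exp (logIntegrand P e x) := by
  rw [eulerIntegral, integral_logMeasure]
  simp only [integrand_expMap hP hPpos]

theorem continuous_exp_logIntegrand (hP : ∀ j, P j ≠ 0) (hPpos : ∀ j k, 0 ≤ (P j).coeff k)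
    (e : Exponents n m) : Continuous fun x => Complex.exp (logIntegrand P e x) := by
  have h2 := continuous_logIntegrand hP hPpos
  have h3 : Continuous fun x : Fin n → ℝ => (e, x) := by fun_prop
  exact (h2.comp h3).cexp

/-- The Euler integral converges if and only if the tropicalization of the integrand is negative
on all rays. -/
theorem IsFanRays.mem_convergenceDomain_iff (H : IsFanRays P R)
    (hPpos : ∀ j k, 0 ≤ (P j).coeff k) {e : Exponents n m} :
    e ∈ convergenceDomain P ↔ ∀ ρ ∈ R, (tropIntegrand P e ρ).re < 0 := by
  rw [mem_convergenceDomain H.ne_zero hPpos]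
  constructor
  · intro h ρ hρ
    by_contra hcon
    push Not at hcon
    -- where `Re Trop` is non-negative along a ray, the integrand is bounded below on infinitely
    -- many disjoint unit balls centred on it
    obtain ⟨K, hK⟩ := exists_le_re_logIntegrand H.ne_zero hPpos e
    obtain ⟨s, hs, htop⟩ := measure_iUnion_ball_eq_top (H.ray_ne_zero ρ hρ)
    have hfin := h.measure_norm_ge_lt_top (Real.exp_pos (-K))
    refine (lt_of_le_of_lt (measure_mono ?_) hfin).ne htop
    intro x hx
    obtain ⟨k, hk⟩ := Set.mem_iUnion.1 hx
    have h1 := hK (((k : ℝ) * s) • ρ) (x - ((k : ℝ) * s) • ρ) (by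
      rw [mem_closedBall_zero_iff, ← dist_eq_norm]
      exact (Metric.mem_ball.1 hk).le)
    rw [add_sub_cancel, tropIntegrand_smul_right H.ne_zero e ρ (by positivity),
      Complex.re_ofReal_mul] at h1
    have h2 : 0 ≤ (k : ℝ) * s * (tropIntegrand P e ρ).re := by positivity
    change Real.exp (-K) ≤ ‖Complex.exp (logIntegrand P e x)‖
    rw [Complex.norm_exp]
    exact Real.exp_le_exp.2 (by linarith)
  · intro h
    obtain ⟨g, hg, hgb⟩ := H.exists_bound_exp_logIntegrand hPpos h
    exact hg.mono' (continuous_exp_logIntegrand H.ne_zero hPpos e).aestronglyMeasurable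
      (ae_of_all _ hgb.self_of_nhds)

theorem IsFanRays.isOpen_convergenceDomain (H : IsFanRays P R)
    (hPpos : ∀ j k, 0 ≤ (P j).coeff k) : IsOpen (convergenceDomain P) := by
  have h1 : convergenceDomain P = ⋂ ρ ∈ R, {e | (tropIntegrand P e ρ).re < 0} := by
    ext e
    rw [H.mem_convergenceDomain_iff hPpos]
    simp
  rw [h1]
  exact isOpen_biInter_finset fun ρ _ => isOpen_lt
    (Complex.continuous_re.comp (continuous_tropIntegrand P ρ)) continuous_const

theorem re_tropIntegrand_combo (P : Fin m → LaurentPoly n) (e e' : Exponents n m) (a b : ℝ)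
    (ρ : Fin n → ℝ) : (tropIntegrand P (a • e + b • e') ρ).re =
      a * (tropIntegrand P e ρ).re + b * (tropIntegrand P e' ρ).re := by
  have h : a • e + b • e' = (a : ℂ) • e + (b : ℂ) • e' := by
    ext <;> simp
  rw [h, tropIntegrand_add, tropIntegrand_smul, tropIntegrand_smul, Complex.add_re,
    Complex.re_ofReal_mul, Complex.re_ofReal_mul]

theorem IsFanRays.convex_convergenceDomain (H : IsFanRays P R)
    (hPpos : ∀ j k, 0 ≤ (P j).coeff k) : Convex ℝ (convergenceDomain P) := by
  intro e he e' he' a b ha hb hab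
  rw [H.mem_convergenceDomain_iff hPpos] at *
  intro ρ hρ
  rw [re_tropIntegrand_combo]
  have h1 := he ρ hρ
  have h2 := he' ρ hρ
  rcases ha.eq_or_lt with rfl | ha
  · rw [zero_add] at hab
    subst hab
    linarith
  · nlinarith

theorem IsFanRays.convergenceDomain_nonempty (H : IsFanRays P R)
    (hPpos : ∀ j k, 0 ≤ (P j).coeff k)
    (hfull : (interior (newtonPolytope (∏ j, P j))).Nonempty) :
    (convergenceDomain P).Nonempty := by
  obtain ⟨z, hz⟩ := hfull
  refine ⟨(fun i => (z i : ℂ), fun _ => -1), (H.mem_convergenceDomain_iff hPpos).2 fun ρ hρ => ?_⟩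
  have hc : Continuous fun t : ℝ => z + t • ρ := by fun_prop
  have h1 : ∀ᶠ t in 𝓝[>] (0 : ℝ), z + t • ρ ∈ newtonPolytope (∏ j, P j) := by
    refine nhdsWithin_le_nhds (hc.continuousAt.preimage_mem_nhds ?_)
    rw [zero_smul, add_zero]
    exact mem_interior_iff_mem_nhds.1 hz
  obtain ⟨t, ht, ht0⟩ := (h1.and self_mem_nhdsWithin).exists
  have h2 := dotProduct_le_sum_tropPoly H.ne_zero hPpos ρ ht
  rw [dotProduct_add, dotProduct_smul, smul_eq_mul] at h2
  have h3 : 0 < ρ ⬝ᵥ ρ := by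
    refine lt_of_le_of_ne (Finset.sum_nonneg fun i _ => mul_self_nonneg (ρ i)) fun h => ?_
    exact H.ray_ne_zero ρ hρ (dotProduct_self_eq_zero.1 h.symm)
  have h4 : 0 < t * (ρ ⬝ᵥ ρ) := mul_pos ht0 h3
  rw [re_tropIntegrand]
  simp only [Complex.ofReal_re, Complex.neg_re, Complex.one_re, neg_mul, one_mul,
    Finset.sum_neg_distrib]
  have h5 : ∑ i, z i * ρ i = ρ ⬝ᵥ z := dotProduct_comm z ρ
  rw [h5]
  linarith

theorem IsFanRays.analyticOnNhd_eulerIntegral (H : IsFanRays P R)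
    (hPpos : ∀ j k, 0 ≤ (P j).coeff k) :
    AnalyticOnNhd ℂ (eulerIntegral P) (convergenceDomain P) := by
  have h1 : eulerIntegral P = fun e => ∫ x, Complex.exp (logIntegrand P e x) :=
    funext (eulerIntegral_eq H.ne_zero hPpos)
  rw [h1]
  refine analyticOnNhd_integral (H.isOpen_convergenceDomain hPpos)
    (fun e => (continuous_exp_logIntegrand H.ne_zero hPpos e).aestronglyMeasurable)
    (fun x => ?_) fun e he => H.exists_bound_exp_logIntegrand hPpos
      ((H.mem_convergenceDomain_iff hPpos).1 he)
  have h2 := differentiable_logTerm P 0 ∅ ∅ x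
  simp only [logTerm_empty H.ne_zero] at h2
  exact h2.cexp

/-- Logarithmically divergent exponents can be approached from inside the domain of
convergence. -/
theorem IsFanRays.lineMap_mem_convergenceDomain (H : IsFanRays P R)
    (hPpos : ∀ j k, 0 ≤ (P j).coeff k) {e₀ e : Exponents n m} (hlog : LogDivergent P e₀ R)
    (he : e ∈ convergenceDomain P) {t : ℝ} (ht : 0 < t) (ht1 : t ≤ 1) :
    (1 - t) • e₀ + t • e ∈ convergenceDomain P := by
  rw [H.mem_convergenceDomain_iff hPpos] at *
  intro ρ hρ
  rw [re_tropIntegrand_combo]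
  have h1 := he ρ hρ
  have h2 : (tropIntegrand P e₀ ρ).re ≤ 0 := by
    rcases hlog ρ hρ with h | h
    · rw [h, Complex.zero_re]
    · exact h.le
  nlinarith

end Convergence

/-! ### The subtraction formula inside the domain of convergence -/

section Formula

variable {n m : ℕ} {P : Fin m → LaurentPoly n} {R D S S' : Finset (Fin n → ℝ)}
  {w : (Fin n → ℝ) → (Fin n → ℝ)}

/-- Initial forms are quasi-homogeneous along the rays. -/
theorem logEval_initialForms_add (hP : ∀ j, P j ≠ 0) (hPpos : ∀ j k, 0 ≤ (P j).coeff k)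
    (hS : Joint P S') {K : Type*} [Fintype K] {g : K → Fin n → ℝ} (hg : ∀ k, g k ∈ S') (j : Fin m)
    (x : Fin n → ℝ) (t : K → ℝ) : logEval (initialForms P S' j) (x + ∑ k, t k • g k) =
      logEval (initialForms P S' j) x + ∑ k, t k * tropPoly (P j) (g k) := by
  have h1 : evalAt (initialForms P S' j) (expMap (x + ∑ k, t k • g k)) =
      evalAt (initialForms P S' j) (expMap x) * Real.exp (∑ k, t k * tropPoly (P j) (g k)) := by
    rw [evalAt_expMap, evalAt_expMap, Finset.sum_mul]
    refine Finset.sum_congr rfl fun a ha => ?_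
    have h2 : (∑ k, t k • g k) ⬝ᵥ expVec a = ∑ k, t k * tropPoly (P j) (g k) := by
      rw [sum_dotProduct]
      refine Finset.sum_congr rfl fun k _ => ?_
      rw [smul_dotProduct, smul_eq_mul,
        (mem_face.1 (((mem_support_initialForms hP).1 ha).2 _ (hg k))).2]
    rw [add_dotProduct, h2, Real.exp_add, mul_assoc]
  rw [logEval, h1, Real.log_mul, Real.log_exp, logEval]
  · exact (evalAt_expMap_pos (initialForms_ne_zero hP hS j)
      (coeff_initialForms_nonneg hPpos S' j) x).ne'
  · exact (Real.exp_pos _).ne'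

/-- The term of `S'` along the rays in `S ⊆ S'`. -/
theorem logTerm_add_sum (hP : ∀ j, P j ≠ 0) (hPpos : ∀ j k, 0 ≤ (P j).coeff k)
    (hw : DualOn P D w) (hSD : S' ⊆ D) (hS : Joint P S') (hSS : S ⊆ S') {K : Type*} [Fintype K]
    (g : K ≃ S) (e : Exponents n m) (x : Fin n → ℝ) (t : K → ℝ) :
    logTerm P w ∅ S' e (x + ∑ k, t k • (g k : Fin n → ℝ)) =
      (-∑ ρ ∈ S' \ S, (1 - tropIntegrand P e ρ) * (softplus (w ρ ⬝ᵥ x) : ℂ) +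
        logIntegrand (initialForms P S') e x) +
      ∑ k, (tropIntegrand P e (g k) * (t k : ℂ) -
        (1 - tropIntegrand P e (g k)) * (softplus (w (g k) ⬝ᵥ x - t k) : ℂ)) := by
  have hwt : ∀ ρ ∈ S', w ρ ⬝ᵥ (x + ∑ k, t k • (g k : Fin n → ℝ)) =
      w ρ ⬝ᵥ x + ∑ k, t k * (if ρ = g k then -1 else 0) := by
    intro ρ hρ
    rw [dotProduct_add, dotProduct_sum]
    congr 1
    refine Finset.sum_congr rfl fun k _ => ?_
    rw [dotProduct_smul, smul_eq_mul, hw.apply hSD hS hρ (hSS (g k).2)]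
  have h1 : ∑ ρ ∈ S' \ S, (1 - tropIntegrand P e ρ) *
      (softplus (w ρ ⬝ᵥ (x + ∑ k, t k • (g k : Fin n → ℝ))) : ℂ) =
      ∑ ρ ∈ S' \ S, (1 - tropIntegrand P e ρ) * (softplus (w ρ ⬝ᵥ x) : ℂ) := by
    refine Finset.sum_congr rfl fun ρ hρ => ?_
    rw [Finset.mem_sdiff] at hρ
    rw [hwt ρ hρ.1, Finset.sum_eq_zero, add_zero]
    intro k _
    rw [if_neg, mul_zero]
    rintro rfl
    exact hρ.2 (g k).2
  have h2 : ∑ ρ ∈ S, (1 - tropIntegrand P e ρ) *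
      (softplus (w ρ ⬝ᵥ (x + ∑ k, t k • (g k : Fin n → ℝ))) : ℂ) =
      ∑ k, (1 - tropIntegrand P e (g k)) * (softplus (w (g k) ⬝ᵥ x - t k) : ℂ) := by
    rw [← Finset.sum_coe_sort, ← Equiv.sum_comp g]
    refine Finset.sum_congr rfl fun k _ => ?_
    rw [hwt _ (hSS (g k).2), Finset.sum_eq_single k]
    · rw [if_pos rfl, mul_neg_one, ← sub_eq_add_neg]
    · intro l _ hl
      rw [if_neg, mul_zero]
      exact fun h => hl (g.injective (Subtype.ext h)).symm
    · exact fun h => absurd (Finset.mem_univ k) h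
  have h3 : logIntegrand (initialForms P S') e (x + ∑ k, t k • (g k : Fin n → ℝ)) =
      logIntegrand (initialForms P S') e x + ∑ k, tropIntegrand P e (g k) * (t k : ℂ) := by
    simp only [logIntegrand, tropIntegrand,
      logEval_initialForms_add hP hPpos hS (fun k => hSS (g k).2), Pi.add_apply,
      Finset.sum_apply, Pi.smul_apply, smul_eq_mul, Complex.ofReal_add, Complex.ofReal_sum,
      Complex.ofReal_mul, mul_add, Finset.sum_add_distrib, add_mul, Finset.mul_sum,
      Finset.sum_mul]
    rw [Finset.sum_comm (s := Finset.univ) (t := (Finset.univ : Finset K)),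
      Finset.sum_comm (s := Finset.univ) (t := (Finset.univ : Finset K))]
    have h4 : ∀ i k, e.1 i * ((t k : ℂ) * ((g k : Fin n → ℝ) i : ℂ)) =
        e.1 i * ((g k : Fin n → ℝ) i : ℂ) * (t k : ℂ) := fun i k => by ring
    have h5 : ∀ j k, e.2 j * ((t k : ℂ) * (tropPoly (P j) (g k) : ℂ)) =
        e.2 j * (tropPoly (P j) (g k) : ℂ) * (t k : ℂ) := fun j k => by ring
    simp only [h4, h5]
    ring
  rw [logTerm, Finset.sdiff_empty, Finset.sum_empty, zero_sub, ← Finset.sum_sdiff hSS, h1, h2, h3,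
    Finset.sum_sub_distrib]
  ring

/-- Integrating the term of `S'` over the span of the rays in `S`. -/
theorem integral_exp_logTerm_add_sum (hP : ∀ j, P j ≠ 0) (hPpos : ∀ j k, 0 ≤ (P j).coeff k)
    (hw : DualOn P D w) (hSD : S' ⊆ D) (hS : Joint P S') (hSS : S ⊆ S') {K : Type*} [Fintype K]
    (g : K ≃ S) {e : Exponents n m} (hneg : ∀ ρ ∈ S, (tropIntegrand P e ρ).re < 0)
    (x : Fin n → ℝ) :
    ∫ t : K → ℝ, Complex.exp (logTerm P w ∅ S' e (x + ∑ k, t k • (g k : Fin n → ℝ))) =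
      Complex.exp (logTerm P w S S' e x) * ∏ ρ ∈ S, (-tropIntegrand P e ρ)⁻¹ := by
  simp only [logTerm_add_sum hP hPpos hw hSD hS hSS, Complex.exp_add _ (Finset.sum _ _),
    Complex.exp_sum]
  rw [integral_const_mul, integral_fintype_prod_volume_eq_prod (f := fun (k : K) (t : ℝ) =>
    Complex.exp (tropIntegrand P e (g k) * (t : ℂ) -
        (1 - tropIntegrand P e (g k)) * (softplus (w (g k) ⬝ᵥ x - t) : ℂ)))]
  have h1 : ∀ k : K, ∫ t : ℝ, Complex.exp (tropIntegrand P e (g k) * (t : ℂ) -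
      (1 - tropIntegrand P e (g k)) * (softplus (w (g k) ⬝ᵥ x - t) : ℂ)) =
      Complex.exp (tropIntegrand P e (g k) * ((w (g k) ⬝ᵥ x : ℝ) : ℂ)) *
        (-tropIntegrand P e (g k))⁻¹ := fun k => integral_exp_softplus (hneg _ (g k).2) _
  simp only [h1, Finset.prod_mul_distrib, ← Complex.exp_sum]
  have h2 : ∑ k, tropIntegrand P e (g k) * ((w (g k) ⬝ᵥ x : ℝ) : ℂ) =
      ∑ ρ ∈ S, tropIntegrand P e ρ * ((w ρ ⬝ᵥ x : ℝ) : ℂ) := by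
    rw [← Finset.sum_coe_sort S, ← Equiv.sum_comp g]
  have h3 : ∏ k, (-tropIntegrand P e (g k))⁻¹ = ∏ ρ ∈ S, (-tropIntegrand P e ρ)⁻¹ := by
    rw [← Finset.prod_coe_sort S, ← Equiv.prod_comp g]
  rw [h2, h3, ← mul_assoc, ← Complex.exp_add, logTerm]
  congr 2
  ring

/-- Fubini's theorem for the term of `S'`: integration over the span of the rays in `S` leaves an
integral over the slice of `S`. -/
theorem integral_exp_logTerm_slice (hP : ∀ j, P j ≠ 0) (hPpos : ∀ j k, 0 ≤ (P j).coeff k)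
    (hw : DualOn P D w) (hSD : S' ⊆ D) (hS : Joint P S') (hSS : S ⊆ S') {e : Exponents n m}
    (hneg : ∀ ρ ∈ S, (tropIntegrand P e ρ).re < 0)
    (hint : Integrable fun x => Complex.exp (logTerm P w ∅ S' e x)) {J : Finset (Fin n)}
    (hJ : absMinor S Jᶜ ≠ 0) :
    (Integrable fun y : J → ℝ => Complex.exp (logTerm P w S S' e (sliceLin J y))) ∧
    ((absMinor S Jᶜ : ℂ) * ∏ ρ ∈ S, (-tropIntegrand P e ρ)⁻¹) *
      ∫ y : J → ℝ, Complex.exp (logTerm P w S S' e (sliceLin J y)) =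
      ∫ x, Complex.exp (logTerm P w ∅ S' e x) := by
  obtain ⟨g, hg, hgdet⟩ := exists_equiv_of_absMinor_ne_zero hJ
  obtain ⟨h1, h2⟩ := integral_eq_integral_slice J (fun k => (g k : Fin n → ℝ)) hg hint
  have h3 : ∀ y : J → ℝ, (fun i => if h : i ∈ J then y ⟨i, h⟩ else 0) = sliceLin J y := by
    intro y
    funext i
    rw [sliceLin_apply]
  have h4 := fun y : J → ℝ =>
    integral_exp_logTerm_add_sum hP hPpos hw hSD hS hSS g hneg (sliceLin J y)
  simp only [h3, h4] at h1 h2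
  have hne : ∏ ρ ∈ S, (-tropIntegrand P e ρ)⁻¹ ≠ 0 := by
    refine Finset.prod_ne_zero_iff.2 fun ρ hρ => inv_ne_zero (neg_ne_zero.2 fun h => ?_)
    have := hneg ρ hρ
    rw [h, Complex.zero_re] at this
    exact lt_irrefl _ this
  refine ⟨?_, ?_⟩
  · have h5 := h1.mul_const (∏ ρ ∈ S, (-tropIntegrand P e ρ)⁻¹)⁻¹
    simpa only [mul_assoc, mul_inv_cancel₀ hne, mul_one] using h5
  · rw [h2, integral_mul_const, hgdet]
    ring

/-- The right-hand side of the subtraction formula, in logarithmic coordinates. -/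
def renFormula (P : Fin m → LaurentPoly n) (w : (Fin n → ℝ) → (Fin n → ℝ))
    (D : Finset (Fin n → ℝ)) (J : Finset (Fin n → ℝ) → Finset (Fin n)) (e : Exponents n m) : ℂ :=
  ∑ S ∈ starSets P D ∅, ((absMinor S (J S)ᶜ : ℂ) * ∏ ρ ∈ S, (-tropIntegrand P e ρ)⁻¹) *
    ∫ y : J S → ℝ, renSum P w D S e (sliceLin (J S) y)

theorem sum_powerset_neg_one_pow_sub (S' : Finset (Fin n → ℝ)) :
    ∑ S ∈ S'.powerset, (-1 : ℂ) ^ (S'.card - S.card) = if S' = ∅ then 1 else 0 := by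
  have h1 : ∀ S ∈ S'.powerset, (-1 : ℂ) ^ (S'.card - S.card) =
      (-1) ^ S'.card * (((-1 : ℤ) ^ S.card : ℤ) : ℂ) := by
    intro S hS
    have h2 := Finset.card_le_card (Finset.mem_powerset.1 hS)
    obtain ⟨k, hk⟩ := Nat.exists_eq_add_of_le h2
    have h3 : ((-1 : ℂ) ^ S.card) * (-1) ^ S.card = 1 := by
      rw [← mul_pow]
      simp
    rw [hk, Nat.add_sub_cancel_left, pow_add]
    push_cast
    linear_combination (-(-1 : ℂ) ^ k) * h3
  rw [Finset.sum_congr rfl h1, ← Finset.mul_sum, ← Int.cast_sum,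
    Finset.sum_powerset_neg_one_pow_card]
  split_ifs with h
  · simp [h]
  · simp

/-- Inside the domain of convergence the subtraction formula holds by inclusion-exclusion: after
Fubini's theorem, each term `S'` occurs in the summands of all `S ⊆ S'`, with alternating signs. -/
theorem IsFanRays.renFormula_eq_eulerIntegral (H : IsFanRays P R)
    (hPpos : ∀ j k, 0 ≤ (P j).coeff k) (hw : DualOn P D w) (hDR : D ⊆ R)
    {J : Finset (Fin n → ℝ) → Finset (Fin n)}
    (hJ : ∀ S ∈ starSets P D ∅, absMinor S (J S)ᶜ ≠ 0) {e : Exponents n m}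
    (he : e ∈ convergenceDomain P) (hsmall : ∀ S' ∈ starSets P D ∅, ∀ ρ ∈ R, ρ ∉ D →
      ∑ s ∈ S', -(tropIntegrand P e s).re * |w s ⬝ᵥ ρ| < -(tropIntegrand P e ρ).re) :
    renFormula P w D J e = eulerIntegral P e := by
  have hneg := (H.mem_convergenceDomain_iff hPpos).1 he
  have hint : ∀ S' ∈ starSets P D ∅, Integrable fun x => Complex.exp (logTerm P w ∅ S' e x) := by
    intro S' hS'
    obtain ⟨h1, h2, -⟩ := mem_starSets.1 hS'
    obtain ⟨g, hg, hgb⟩ := H.exists_bound_exp_logTerm hPpos hw hDR hneg h1 h2 (hsmall S' hS')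
    refine hg.mono' ?_ (ae_of_all _ hgb.self_of_nhds)
    have h3 := continuous_logTerm (w := w) (S := ∅) H.ne_zero hPpos h2
    have h4 : Continuous fun x : Fin n → ℝ => (e, x) := by fun_prop
    exact (h3.comp h4).cexp.aestronglyMeasurable
  have hmem : ∀ {S S'}, S ∈ starSets P D ∅ → S' ∈ starSets P D S → S' ∈ starSets P D ∅ :=
    fun _ h => mem_starSets.2 ⟨(mem_starSets.1 h).1, (mem_starSets.1 h).2.1, Finset.empty_subset _⟩
  have hslice : ∀ S ∈ starSets P D ∅, ∀ S' ∈ starSets P D S, _ := fun S hS S' hS' =>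
    integral_exp_logTerm_slice (S := S) (S' := S') H.ne_zero hPpos hw (mem_starSets.1 hS').1
      (mem_starSets.1 hS').2.1 (mem_starSets.1 hS').2.2
      (fun ρ hρ => hneg ρ (hDR ((mem_starSets.1 hS).1 hρ))) (hint S' (hmem hS hS')) (hJ S hS)
  have hterm : ∀ S ∈ starSets P D ∅,
      ((absMinor S (J S)ᶜ : ℂ) * ∏ ρ ∈ S, (-tropIntegrand P e ρ)⁻¹) *
        ∫ y : J S → ℝ, renSum P w D S e (sliceLin (J S) y) = ∑ S' ∈ starSets P D S,
          (-1 : ℂ) ^ (S'.card - S.card) * ∫ x, Complex.exp (logTerm P w ∅ S' e x) := by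
    intro S hS
    simp only [renSum]
    rw [integral_finsetSum _ fun S' hS' => (hslice S hS S' hS').1.const_mul _, Finset.mul_sum]
    refine Finset.sum_congr rfl fun S' hS' => ?_
    rw [integral_const_mul, mul_left_comm, (hslice S hS S' hS').2]
  rw [renFormula, Finset.sum_congr rfl hterm]
  have hcomm : ∀ S S', S ∈ starSets P D ∅ ∧ S' ∈ starSets P D S ↔
      S ∈ S'.powerset ∧ S' ∈ starSets P D ∅ := by
    intro S S'
    rw [Finset.mem_powerset]
    constructor
    · rintro ⟨h1, h2⟩
      exact ⟨(mem_starSets.1 h2).2.2, hmem h1 h2⟩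
    · rintro ⟨h1, h2⟩
      obtain ⟨h3, h4, -⟩ := mem_starSets.1 h2
      exact ⟨mem_starSets.2 ⟨h1.trans h3, h4.mono h1, Finset.empty_subset _⟩,
        mem_starSets.2 ⟨h3, h4, h1⟩⟩
  rw [Finset.sum_comm' hcomm]
  simp only [← Finset.sum_mul, sum_powerset_neg_one_pow_sub]
  have hempty : ∅ ∈ starSets P D ∅ := by
    choose v hv using fun j => exists_eq_tropPoly (H.ne_zero j) 0
    exact mem_starSets.2 ⟨Finset.empty_subset _, ⟨v, fun j => (hv j).1, by simp⟩, le_rfl⟩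
  rw [Finset.sum_eq_single_of_mem ∅ hempty fun S' _ hS' => by rw [if_neg hS', zero_mul],
    if_pos rfl, one_mul, eulerIntegral_eq H.ne_zero hPpos]
  simp only [logTerm_empty H.ne_zero]

/-- Near the divergent exponents the tropicalization is small on the divergent rays and bounded
away from `0` on the others, which gives the smallness hypothesis of `IsFanRays.growth_neg`. -/
theorem eventually_forall_sum_lt {e₀ : Exponents n m} (h0 : ∀ ρ ∈ D, tropIntegrand P e₀ ρ = 0)
    (hneg : ∀ ρ ∈ R, ρ ∉ D → (tropIntegrand P e₀ ρ).re < 0) :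
    ∀ᶠ e in 𝓝 e₀, ∀ S' ∈ starSets P D ∅, ∀ ρ ∈ R, ρ ∉ D →
      ∑ s ∈ S', -(tropIntegrand P e s).re * |w s ⬝ᵥ ρ| < -(tropIntegrand P e ρ).re := by
  have hc : ∀ ρ, Continuous fun e : Exponents n m => (tropIntegrand P e ρ).re := fun ρ =>
    Complex.continuous_re.comp (continuous_tropIntegrand P ρ)
  refine (Finset.eventually_all _).2 fun S' hS' => (Finset.eventually_all _).2 fun ρ hρ => ?_
  by_cases hρD : ρ ∈ D
  · exact Eventually.of_forall fun e h => absurd hρD h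
  have h1 : Continuous fun e : Exponents n m =>
      ∑ s ∈ S', -(tropIntegrand P e s).re * |w s ⬝ᵥ ρ| + (tropIntegrand P e ρ).re := by fun_prop
  have h2 : ∑ s ∈ S', -(tropIntegrand P e₀ s).re * |w s ⬝ᵥ ρ| + (tropIntegrand P e₀ ρ).re < 0 := by
    rw [Finset.sum_eq_zero, zero_add]
    · exact hneg ρ hρ hρD
    · intro s hs
      rw [h0 s ((mem_starSets.1 hS').1 hs)]
      simp
  filter_upwards [(h1.tendsto e₀).eventually (gt_mem_nhds h2)] with e he _
  linarith

/-- The integrals in the subtraction formula are analytic near the divergent exponents. -/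
theorem IsFanRays.eventually_analyticAt_integral_renSum (H : IsFanRays P R)
    (hPpos : ∀ j k, 0 ≤ (P j).coeff k) (hw : DualOn P D w) (hDR : D ⊆ R) {e₀ : Exponents n m}
    (h0 : ∀ ρ ∈ D, tropIntegrand P e₀ ρ = 0)
    (hneg : ∀ ρ ∈ R, ρ ∉ D → (tropIntegrand P e₀ ρ).re < 0)
    {J : Finset (Fin n)} (hJ : absMinor S Jᶜ ≠ 0) :
    ∀ᶠ e in 𝓝 e₀, AnalyticAt ℂ (fun e => ∫ y : J → ℝ, renSum P w D S e (sliceLin J y)) e := by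
  obtain ⟨g, hg, hgb⟩ := H.exists_bound_renSum hPpos hw hDR h0 hneg hJ
  have h1 : AnalyticOnNhd ℂ (fun e => ∫ y : J → ℝ, renSum P w D S e (sliceLin J y))
      {e | ∀ᶠ e' in 𝓝 e, ∀ y, ‖renSum P w D S e' (sliceLin J y)‖ ≤ g y} :=
    analyticOnNhd_integral isOpen_setOfPred_eventually_nhds
      (fun e => ((continuous_renSum H.ne_zero hPpos e).comp
        (sliceLin J).continuous).aestronglyMeasurable)
      (fun y => differentiable_renSum P w D S _) fun e he => ⟨g, hg, he⟩
  filter_upwards [hgb.eventually_nhds] with e he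
  exact h1 e he

end Formula

/-! ### Meromorphic continuation -/

section Meromorphic

variable {E : Type*} [NormedAddCommGroup E] [NormedSpace ℂ E]

theorem analyticAt_of_differentiable [FiniteDimensional ℂ E] {f : E → ℂ}
    (hf : Differentiable ℂ f) (e : E) : AnalyticAt ℂ f e := by
  refine osgood isOpen_univ hf.continuous.continuousOn (fun x _ y => ?_) e (Set.mem_univ e)
  have h : Differentiable ℂ fun z : ℂ => x + z • y := by fun_prop
  exact (hf.comp h).differentiableAt

/-- The identity theorem for meromorphic continuations: a linear relation `L * F = H` on `C` with
analytic coefficients propagates along connected open sets. -/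
theorem IsMeromorphicContinuation.mul_eq {C Ω Z U : Set E} {F G L H : E → ℂ}
    (h : IsMeromorphicContinuation C F Ω Z G) (hC : IsOpen C) (hU : IsOpen U)
    (hUc : IsPreconnected U) (hUΩ : U ⊆ Ω) (hUC : (U ∩ C).Nonempty)
    (hL : AnalyticOnNhd ℂ L U) (hH : AnalyticOnNhd ℂ H U)
    (heq : ∀ q ∈ U ∩ C, L q * F q = H q) : ∀ q ∈ U \ Z, L q * G q = H q := by
  have hsub : U ⊆ {p | ∀ᶠ q in 𝓝 p, q ∉ Z → L q * G q = H q} := by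
    refine hUc.subset_of_closure_inter_subset isOpen_setOfPred_eventually_nhds ?_ ?_
    · obtain ⟨p, hpU, hpC⟩ := hUC
      refine ⟨p, hpU, ?_⟩
      filter_upwards [hU.mem_nhds hpU, hC.mem_nhds hpC] with q hq hqC _
      rw [h.eqOn hqC, heq q ⟨hq, hqC⟩]
    · rintro p ⟨hpA, hpU⟩
      obtain ⟨g, k, hg, hk, hg0, hgk⟩ := h.quotient p (hUΩ hpU)
      obtain ⟨r, hr, hball⟩ := Metric.eventually_nhds_iff_ball.1 ((hgk.and
        (hg.eventually_analyticAt.and hk.eventually_analyticAt)).and (hU.mem_nhds hpU))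
      have hBc : IsPreconnected (Metric.ball p r) := (convex_ball p r).isPreconnected
      have hgB : AnalyticOnNhd ℂ g (Metric.ball p r) := fun q hq => (hball q hq).1.2.1
      have hkB : AnalyticOnNhd ℂ k (Metric.ball p r) := fun q hq => (hball q hq).1.2.2
      have hLB : AnalyticOnNhd ℂ L (Metric.ball p r) := fun q hq => hL q (hball q hq).2
      have hHB : AnalyticOnNhd ℂ H (Metric.ball p r) := fun q hq => hH q (hball q hq).2
      obtain ⟨a, haB, haA⟩ := mem_closure_iff_nhds.1 hpA _ (Metric.ball_mem_nhds p hr)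
      -- the factor `g` takes care of the points of `Z`
      have hzero : Set.EqOn (fun q => g q * (L q * k q - g q * H q)) 0 (Metric.ball p r) := by
        refine AnalyticOnNhd.eqOn_zero_of_preconnected_of_eventuallyEq_zero
          (hgB.mul ((hLB.mul hkB).sub (hgB.mul hHB))) hBc haB ?_
        filter_upwards [haA, Metric.isOpen_ball.mem_nhds haB] with q hq hqB
        obtain ⟨h1, h2⟩ := (hball q hqB).1.1
        by_cases hqZ : q ∈ Z
        · simp [h1 hqZ]
        · simp only [Pi.zero_apply]
          rw [← h2 hqZ, ← hq hqZ]
          ring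
      have hne : ∀ q ∈ Metric.ball p r, g q ≠ 0 → q ∉ Z → L q * G q = H q := by
        intro q hqB hgq hqZ
        have h1 := (mul_eq_zero.1 (hzero hqB)).resolve_left hgq
        rw [← (hball q hqB).1.1.2 hqZ] at h1
        refine mul_left_cancel₀ hgq ?_
        linear_combination h1
      -- the zeros of `g` outside `Z` are reached by continuity
      change ∀ᶠ q in 𝓝 p, q ∉ Z → L q * G q = H q
      filter_upwards [Metric.ball_mem_nhds p hr] with q hqB hqZ
      have hqΩ : q ∈ Ω \ Z := ⟨hUΩ (hball q hqB).2, hqZ⟩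
      have hfreq : ∃ᶠ q' in 𝓝 q, g q' ≠ 0 := by
        intro hcon
        refine hg0 ?_
        have h1 : ∀ᶠ q' in 𝓝 q, g q' = 0 := hcon.mono fun _ h2 => not_not.1 h2
        have h2 := AnalyticOnNhd.eqOn_zero_of_preconnected_of_eventuallyEq_zero hgB hBc hqB h1
        filter_upwards [Metric.ball_mem_nhds p hr] with q' hq'
        exact h2 hq'
      have hev : ∀ᶠ q' in 𝓝 q, q' ∈ Metric.ball p r ∧ q' ∈ Ω \ Z :=
        (Metric.isOpen_ball.eventually_mem hqB).and (h.isOpen_diff.eventually_mem hqΩ)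
      have hfreq' : ∃ᶠ q' in 𝓝 q, L q' * G q' - H q' = 0 := by
        refine (hfreq.and_eventually hev).mono ?_
        rintro q' ⟨h1, h2, h3⟩
        rw [hne q' h2 h1 h3.2, sub_self]
      have hcont : ContinuousAt (fun q' => L q' * G q' - H q') q :=
        (((hLB q hqB).continuousAt).mul (h.analytic q hqΩ).continuousAt).sub
          (hHB q hqB).continuousAt
      have hmem : L q * G q - H q ∈ ({0} : Set ℂ) :=
        isClosed_singleton.mem_of_frequently_of_tendsto hfreq' hcont
      exact sub_eq_zero.1 hmem
  intro q hq
  exact (hsub hq.1).self_of_nhds hq.2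

end Meromorphic

section Final

variable {n m : ℕ} {P : Fin m → LaurentPoly n} {R D S : Finset (Fin n → ℝ)}
  {w : (Fin n → ℝ) → (Fin n → ℝ)} {J : Finset (Fin n → ℝ) → Finset (Fin n)}

/-- The common denominator of the right-hand side of the subtraction formula. -/
def polarFactor (P : Fin m → LaurentPoly n) (D : Finset (Fin n → ℝ)) (e : Exponents n m) : ℂ :=
  ∏ ρ ∈ D, tropIntegrand P e ρ

/-- The right-hand side of the subtraction formula with its denominators cleared. -/
def clearedFormula (P : Fin m → LaurentPoly n) (w : (Fin n → ℝ) → (Fin n → ℝ))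
    (D : Finset (Fin n → ℝ)) (J : Finset (Fin n → ℝ) → Finset (Fin n)) (e : Exponents n m) : ℂ :=
  ∑ S ∈ starSets P D ∅, ((absMinor S (J S)ᶜ : ℂ) * (-1) ^ S.card *
    ∏ ρ ∈ D \ S, tropIntegrand P e ρ) * ∫ y : J S → ℝ, renSum P w D S e (sliceLin (J S) y)

theorem analyticAt_tropIntegrand (P : Fin m → LaurentPoly n) (ρ : Fin n → ℝ)
    (e : Exponents n m) : AnalyticAt ℂ (fun e => tropIntegrand P e ρ) e :=
  analyticAt_of_differentiable (differentiable_tropIntegrand P ρ) e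

theorem analyticAt_polarFactor (P : Fin m → LaurentPoly n) (D : Finset (Fin n → ℝ))
    (e : Exponents n m) : AnalyticAt ℂ (polarFactor P D) e :=
  Finset.analyticAt_fun_prod _ fun ρ _ => analyticAt_tropIntegrand P ρ e

theorem polarFactor_mul_renFormula {e : Exponents n m} (he : polarFactor P D e ≠ 0) :
    polarFactor P D e * renFormula P w D J e = clearedFormula P w D J e := by
  rw [renFormula, clearedFormula, Finset.mul_sum]
  refine Finset.sum_congr rfl fun S hS => ?_
  have hSD := (mem_starSets.1 hS).1
  have h1 : (∏ ρ ∈ S, tropIntegrand P e ρ) * ∏ ρ ∈ S, (-tropIntegrand P e ρ)⁻¹ =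
      (-1) ^ S.card := by
    rw [← Finset.prod_mul_distrib, ← Finset.prod_const]
    refine Finset.prod_congr rfl fun ρ hρ => ?_
    have := Finset.prod_ne_zero_iff.1 he ρ (hSD hρ)
    field_simp
  rw [← h1, polarFactor, ← Finset.prod_sdiff hSD]
  ring

/-- A neighbourhood of the divergent exponents on which all ingredients of the subtraction formula
are under control. -/
theorem IsFanRays.eventually_analyticAt_and_eq (H : IsFanRays P R)
    (hPpos : ∀ j k, 0 ≤ (P j).coeff k) (hw : DualOn P D w) (hDR : D ⊆ R) {e₀ : Exponents n m}
    (h0 : ∀ ρ ∈ D, tropIntegrand P e₀ ρ = 0)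
    (hneg : ∀ ρ ∈ R, ρ ∉ D → (tropIntegrand P e₀ ρ).re < 0)
    (hJ : ∀ S ∈ starSets P D ∅, absMinor S (J S)ᶜ ≠ 0) :
    ∀ᶠ e in 𝓝 e₀, AnalyticAt ℂ (clearedFormula P w D J) e ∧
      (polarFactor P D e ≠ 0 → AnalyticAt ℂ (renFormula P w D J) e) ∧
      (e ∈ convergenceDomain P → renFormula P w D J e = eulerIntegral P e) := by
  have h1 : ∀ᶠ e in 𝓝 e₀, ∀ S ∈ starSets P D ∅, AnalyticAt ℂ
      (fun e => ∫ y : J S → ℝ, renSum P w D S e (sliceLin (J S) y)) e :=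
    (Finset.eventually_all _).2 fun S hS =>
      H.eventually_analyticAt_integral_renSum hPpos hw hDR h0 hneg (hJ S hS)
  filter_upwards [h1, eventually_forall_sum_lt (w := w) h0 hneg] with e he hsmall
  refine ⟨?_, fun hpol => ?_, fun heC =>
    H.renFormula_eq_eulerIntegral hPpos hw hDR hJ heC hsmall⟩
  · refine Finset.analyticAt_fun_sum _ fun S hS => (analyticAt_const.mul ?_).mul (he S hS)
    exact Finset.analyticAt_fun_prod _ fun ρ _ => analyticAt_tropIntegrand P ρ e
  · refine Finset.analyticAt_fun_sum _ fun S hS => (analyticAt_const.mul ?_).mul (he S hS)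
    refine Finset.analyticAt_fun_prod _ fun ρ hρ => (analyticAt_tropIntegrand P ρ e).neg.inv ?_
    exact neg_ne_zero.2 (Finset.prod_ne_zero_iff.1 hpol ρ ((mem_starSets.1 hS).1 hρ))

theorem IsFanRays.polarFactor_ne_zero (H : IsFanRays P R) (hPpos : ∀ j k, 0 ≤ (P j).coeff k)
    (hDR : D ⊆ R) {e : Exponents n m} (he : e ∈ convergenceDomain P) : polarFactor P D e ≠ 0 := by
  refine Finset.prod_ne_zero_iff.2 fun ρ hρ h => ?_
  have := (H.mem_convergenceDomain_iff hPpos).1 he ρ (hDR hρ)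
  rw [h, Complex.zero_re] at this
  exact lt_irrefl _ this

/-- The divergent exponents are in the closure of the domain of convergence. -/
theorem exists_mem_ball_convergenceDomain (H : IsFanRays P R)
    (hPpos : ∀ j k, 0 ≤ (P j).coeff k)
    (hfull : (interior (newtonPolytope (∏ j, P j))).Nonempty) {e₀ : Exponents n m}
    (hlog : LogDivergent P e₀ R) {r : ℝ} (hr : 0 < r) :
    (Metric.ball e₀ r ∩ convergenceDomain P).Nonempty := by
  obtain ⟨e, he⟩ := H.convergenceDomain_nonempty hPpos hfull
  have hc : Continuous fun t : ℝ => (1 - t) • e₀ + t • e := by fun_prop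
  have h1 : ∀ᶠ t in 𝓝[>] (0 : ℝ), (1 - t) • e₀ + t • e ∈ Metric.ball e₀ r := by
    refine nhdsWithin_le_nhds (hc.continuousAt.preimage_mem_nhds ?_)
    simpa using Metric.ball_mem_nhds e₀ hr
  have h2 : ∀ᶠ t in 𝓝[>] (0 : ℝ), t ≤ 1 := nhdsWithin_le_nhds (ge_mem_nhds one_pos)
  obtain ⟨t, ⟨h3, h4⟩, h5⟩ := ((h1.and h2).and self_mem_nhdsWithin).exists
  exact ⟨_, h3, H.lineMap_mem_convergenceDomain hPpos hlog he h5 h4⟩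

/-- The Euler integral and the right-hand side of the subtraction formula glue to a meromorphic
continuation. -/
theorem IsFanRays.isMeromorphicContinuation (H : IsFanRays P R)
    (hPpos : ∀ j k, 0 ≤ (P j).coeff k)
    (hfull : (interior (newtonPolytope (∏ j, P j))).Nonempty) (hDR : D ⊆ R) {e₀ : Exponents n m}
    (hlog : LogDivergent P e₀ R) {r : ℝ} (hr : 0 < r)
    (hball : ∀ e ∈ Metric.ball e₀ r, AnalyticAt ℂ (clearedFormula P w D J) e ∧
      (polarFactor P D e ≠ 0 → AnalyticAt ℂ (renFormula P w D J) e) ∧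
      (e ∈ convergenceDomain P → renFormula P w D J e = eulerIntegral P e)) :
    IsMeromorphicContinuation (convergenceDomain P) (eulerIntegral P)
      (convergenceDomain P ∪ Metric.ball e₀ r) {e ∈ Metric.ball e₀ r | polarFactor P D e = 0}
      (fun e => if e ∈ convergenceDomain P then eulerIntegral P e else renFormula P w D J e) := by
  have hCo := H.isOpen_convergenceDomain hPpos
  have hCB := exists_mem_ball_convergenceDomain H hPpos hfull hlog hr
  have hG : ∀ e ∈ Metric.ball e₀ r, (if e ∈ convergenceDomain P then eulerIntegral P e else
      renFormula P w D J e) = renFormula P w D J e := by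
    intro e he
    split_ifs with h
    · exact ((hball e he).2.2 h).symm
    · rfl
  have hdisj : ∀ e ∈ convergenceDomain P,
      e ∉ {e ∈ Metric.ball e₀ r | polarFactor P D e = 0} := fun e he h =>
    H.polarFactor_ne_zero hPpos hDR he h.2
  have hdiff : (convergenceDomain P ∪ Metric.ball e₀ r) \
      {e ∈ Metric.ball e₀ r | polarFactor P D e = 0} =
      convergenceDomain P ∪ (Metric.ball e₀ r ∩ {e | polarFactor P D e ≠ 0}) := by
    ext e
    constructor
    · rintro ⟨h1 | h1, h2⟩
      · exact Or.inl h1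
      · exact Or.inr ⟨h1, fun h3 => h2 ⟨h1, h3⟩⟩
    · rintro (h1 | h1)
      · exact ⟨Or.inl h1, hdisj e h1⟩
      · exact ⟨Or.inr h1.1, fun h2 => h1.2 h2.2⟩
  have hpolc : Continuous (polarFactor P D) :=
    continuous_iff_continuousAt.2 fun e => (analyticAt_polarFactor P D e).continuousAt
  have hpolo : IsOpen {e | polarFactor P D e ≠ 0} := isOpen_ne_fun hpolc continuous_const
  refine ⟨hCo.union Metric.isOpen_ball, ?_, Set.subset_union_left, ?_, ?_, ?_, ?_, ?_, ?_⟩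
  · obtain ⟨q, hq⟩ := hCB
    exact IsConnected.union ⟨q, hq.2, hq.1⟩
      ⟨⟨q, hq.2⟩, (H.convex_convergenceDomain hPpos).isPreconnected⟩
      ⟨⟨q, hq.1⟩, (convex_ball e₀ r).isPreconnected⟩
  · rw [hCo.interior_eq]
    exact H.convergenceDomain_nonempty hPpos hfull
  · exact Set.disjoint_left.2 hdisj
  · rw [hdiff]
    exact hCo.union (Metric.isOpen_ball.inter hpolo)
  · rw [hdiff]
    rintro e (he | he)
    · refine (H.analyticOnNhd_eulerIntegral hPpos e he).congr ?_
      filter_upwards [hCo.mem_nhds he] with q hq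
      rw [if_pos hq]
    · refine ((hball e he.1).2.1 he.2).congr ?_
      filter_upwards [Metric.isOpen_ball.mem_nhds he.1] with q hq
      exact (hG q hq).symm
  · intro e he
    simp only [if_pos he]
  · intro p hp
    by_cases hpC : p ∈ convergenceDomain P
    · refine ⟨fun _ => 1, eulerIntegral P, analyticAt_const,
        H.analyticOnNhd_eulerIntegral hPpos p hpC, ?_, ?_⟩
      · intro hcon
        exact one_ne_zero hcon.self_of_nhds
      · filter_upwards [hCo.mem_nhds hpC] with q hq
        refine ⟨fun h => absurd h (hdisj q hq), fun _ => ?_⟩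
        rw [if_pos hq, one_mul]
    · have hpB : p ∈ Metric.ball e₀ r := hp.resolve_left hpC
      refine ⟨polarFactor P D, clearedFormula P w D J, analyticAt_polarFactor P D p,
        (hball p hpB).1, ?_, ?_⟩
      · intro hcon
        obtain ⟨q, -, hq⟩ := hCB
        refine H.polarFactor_ne_zero hPpos hDR hq ?_
        exact AnalyticOnNhd.eqOn_zero_of_preconnected_of_eventuallyEq_zero
          (fun e _ => analyticAt_polarFactor P D e) isPreconnected_univ (Set.mem_univ p) hcon
          (Set.mem_univ q)
      · filter_upwards [Metric.isOpen_ball.mem_nhds hpB] with q hq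
        refine ⟨fun h => h.2, fun h => ?_⟩
        rw [hG q hq]
        exact polarFactor_mul_renFormula fun h2 => h ⟨hq, h2⟩

theorem tropIntegrand_affineExp (P : Fin m → LaurentPoly n) (e₀ e₁ : Exponents n m) (ε : ℂ)
    (ρ : Fin n → ℝ) : tropIntegrand P (affineExp e₀ e₁ ε) ρ =
      tropIntegrand P e₀ ρ + ε * tropIntegrand P e₁ ρ := by
  rw [affineExp, tropIntegrand_add, tropIntegrand_smul]

theorem polarFactor_affineExp_ne_zero {e₀ e₁ : Exponents n m} (hreg : Regulated P e₀ e₁ R)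
    {ε : ℂ} (hε : ε ≠ 0) : polarFactor P (divRays P e₀ R) (affineExp e₀ e₁ ε) ≠ 0 := by
  refine Finset.prod_ne_zero_iff.2 fun ρ hρ => ?_
  obtain ⟨hρR, h0⟩ := Finset.mem_filter.1 hρ
  obtain ⟨ε', hε'⟩ := hreg ρ hρR
  rw [tropIntegrand_affineExp, h0, zero_add] at *
  exact mul_ne_zero hε (right_ne_zero_of_mul hε')

/-- The subtraction formula for an arbitrary meromorphic continuation. -/
theorem IsFanRays.eventually_eq_renFormula (H : IsFanRays P R)
    (hPpos : ∀ j k, 0 ≤ (P j).coeff k)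
    (hfull : (interior (newtonPolytope (∏ j, P j))).Nonempty) {e₀ e₁ : Exponents n m}
    (hlog : LogDivergent P e₀ R) (hreg : Regulated P e₀ e₁ R)
    (hev : ∀ᶠ e in 𝓝 e₀, AnalyticAt ℂ (clearedFormula P w (divRays P e₀ R) J) e ∧
      (polarFactor P (divRays P e₀ R) e ≠ 0 →
        AnalyticAt ℂ (renFormula P w (divRays P e₀ R) J) e) ∧
      (e ∈ convergenceDomain P →
        renFormula P w (divRays P e₀ R) J e = eulerIntegral P e))
    {Ω Z : Set (Exponents n m)} {G : Exponents n m → ℂ}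
    (hG : IsMeromorphicContinuation (convergenceDomain P) (eulerIntegral P) Ω Z G) (he₀ : e₀ ∈ Ω) :
    ∀ᶠ ε in 𝓝[≠] (0 : ℂ), affineExp e₀ e₁ ε ∉ Z →
      G (affineExp e₀ e₁ ε) = renFormula P w (divRays P e₀ R) J (affineExp e₀ e₁ ε) := by
  have hDR := divRays_subset (P := P) (R := R) e₀
  obtain ⟨r, hr, hball⟩ := Metric.eventually_nhds_iff_ball.1 (hev.and (hG.isOpen.mem_nhds he₀))
  have hmul := hG.mul_eq (U := Metric.ball e₀ r) (L := polarFactor P (divRays P e₀ R))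
    (H := clearedFormula P w (divRays P e₀ R) J)
    (H.isOpen_convergenceDomain hPpos) Metric.isOpen_ball (convex_ball e₀ r).isPreconnected
    (fun e he => (hball e he).2) (exists_mem_ball_convergenceDomain H hPpos hfull hlog hr)
    (fun e _ => analyticAt_polarFactor P _ e) (fun e he => (hball e he).1.1)
    (fun e he => by
      rw [← (hball e he.1).1.2.2 he.2]
      exact polarFactor_mul_renFormula (H.polarFactor_ne_zero hPpos hDR he.2))
  have hc : Continuous fun ε : ℂ => affineExp e₀ e₁ ε := by
    unfold affineExp
    fun_prop
  have h1 : ∀ᶠ ε in 𝓝[≠] (0 : ℂ), affineExp e₀ e₁ ε ∈ Metric.ball e₀ r := by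
    refine nhdsWithin_le_nhds (hc.continuousAt.preimage_mem_nhds ?_)
    simpa [affineExp] using Metric.ball_mem_nhds e₀ hr
  filter_upwards [h1, self_mem_nhdsWithin] with ε hε hε0 hZ
  have hpol := polarFactor_affineExp_ne_zero hreg hε0
  refine mul_left_cancel₀ hpol ?_
  rw [hmul _ ⟨hε, hZ⟩, polarFactor_mul_renFormula hpol]

/-- The right-hand side of the subtraction formula in logarithmic coordinates. -/
theorem IsFanRays.sum_vol_mul_integral (H : IsFanRays P R) (hPpos : ∀ j k, 0 ≤ (P j).coeff k)
    {e₀ : Exponents n m} (hw : DualOn P (divRays P e₀ R) w)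
    (J : PointedCone ℝ (Fin n → ℝ) → Finset (Fin n)) (e : Exponents n m) :
    ∑ σ ∈ divFan P e₀ R, vol P R e σ (J σ) *
        ∫ β, sliceIntegrand P e₀ R w e σ (J σ) β ∂(logMeasure (J σ)) =
      renFormula P w (divRays P e₀ R)
        (fun S => J (PointedCone.hull ℝ (S : Set (Fin n → ℝ)))) e := by
  rw [H.sum_divFan hPpos, renFormula]
  refine Finset.sum_congr rfl fun S hS => ?_
  obtain ⟨hSD, hSJ, -⟩ := mem_starSets.1 hS
  rw [vol, H.coneRays_hull (hSD.trans (divRays_subset e₀)) hSJ, integral_logMeasure]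
  simp only [H.sliceIntegrand_expMap hPpos hw hSD hSJ]

end Final

end EulerSubtraction

end

theorem mainTheorem5 {n m : ℕ} (P : Fin m → LaurentPoly n)
    (hP : ∀ j, P j ≠ 0) (hPpos : ∀ j k, 0 ≤ (P j).coeff k)
    (hfull : (interior (newtonPolytope (∏ j, P j))).Nonempty)
    (e₀ e₁ : Exponents n m)
    (R : Finset (Fin n → ℝ)) (hR : IsRaySystem (integrandFan P) R)
    (hlog : LogDivergent P e₀ R) (hreg : Regulated P e₀ e₁ R)
    (w : (Fin n → ℝ) → (Fin n → ℝ)) (hw : GeometricProperty P e₀ R w)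
    (J : PointedCone ℝ (Fin n → ℝ) → Finset (Fin n))
    (hJ : ∀ σ ∈ divFan P e₀ R,
      (J σ)ᶜ.card = (coneRays R σ).card ∧ absMinor (coneRays R σ) (J σ)ᶜ ≠ 0) :
    -- all integrands on the right-hand side are locally finite
    (∀ σ ∈ divFan P e₀ R,
      LocallyFiniteFamily (logMeasure (J σ))
        fun ε => sliceIntegrand P e₀ R w (affineExp e₀ e₁ ε) σ (J σ)) ∧
    -- the Euler integral continues meromorphically in the exponents to a domain around `e₀`,
    -- and `e₀ + ε e₁` is not a pole for small `ε ≠ 0`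
    (∃ (Ω Z : Set (Exponents n m)) (G : Exponents n m → ℂ),
      IsMeromorphicContinuation (convergenceDomain P) (eulerIntegral P) Ω Z G ∧
      e₀ ∈ Ω ∧ ∀ᶠ ε in 𝓝[≠] (0 : ℂ), affineExp e₀ e₁ ε ∉ Z) ∧
    -- every such continuation, in particular the one to all exponents, satisfies the formula
    (∀ (Ω Z : Set (Exponents n m)) (G : Exponents n m → ℂ),
      IsMeromorphicContinuation (convergenceDomain P) (eulerIntegral P) Ω Z G → e₀ ∈ Ω →
      ∀ᶠ ε in 𝓝[≠] (0 : ℂ), affineExp e₀ e₁ ε ∉ Z →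
        G (affineExp e₀ e₁ ε) =
          ∑ σ ∈ divFan P e₀ R, vol P R (affineExp e₀ e₁ ε) σ (J σ) *
            ∫ β, sliceIntegrand P e₀ R w (affineExp e₀ e₁ ε) σ (J σ) β
              ∂(logMeasure (J σ))) := by
  have H := isFanRays hP hPpos hfull hR
  have hdual := dualOn_of_geometricProperty hP hPpos hw
  have hmem : ∀ S ∈ starSets P (divRays P e₀ R) ∅,
      PointedCone.hull ℝ (S : Set (Fin n → ℝ)) ∈ divFan P e₀ R := by
    intro S hS
    rw [divFan_eq_image hP hPpos]
    exact Finset.mem_image_of_mem _ hS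
  have hminor : ∀ S ∈ starSets P (divRays P e₀ R) ∅,
      absMinor S (J (PointedCone.hull ℝ (S : Set (Fin n → ℝ))))ᶜ ≠ 0 := by
    intro S hS
    have h1 := (hJ _ (hmem S hS)).2
    obtain ⟨hSD, hSJ, -⟩ := mem_starSets.1 hS
    rwa [H.coneRays_hull (hSD.trans (divRays_subset e₀)) hSJ] at h1
  have hev := H.eventually_analyticAt_and_eq hPpos hdual (divRays_subset e₀)
    (fun ρ hρ => (Finset.mem_filter.1 hρ).2)
    (fun ρ hρ hρD => (hlog ρ hρ).resolve_left fun h => hρD (Finset.mem_filter.2 ⟨hρ, h⟩)) hminor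
  refine ⟨fun σ hσ => ?_, ?_, fun Ω Z G hG he₀ => ?_⟩
  · rw [divFan_eq_image hP hPpos] at hσ
    obtain ⟨S, hS, rfl⟩ := Finset.mem_image.1 hσ
    obtain ⟨hSD, hSJ, -⟩ := mem_starSets.1 hS
    exact H.locallyFiniteFamily_sliceIntegrand hPpos hlog hdual hSD hSJ (hminor S hS)
  · obtain ⟨r, hr, hball⟩ := Metric.eventually_nhds_iff_ball.1 hev
    refine ⟨_, _, _, H.isMeromorphicContinuation hPpos hfull (divRays_subset e₀) hlog hr hball,
      Or.inr (Metric.mem_ball_self hr), ?_⟩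
    filter_upwards [self_mem_nhdsWithin] with ε hε h
    exact polarFactor_affineExp_ne_zero hreg hε h.2
  · simp only [H.sum_vol_mul_integral hPpos hdual J]
    exact H.eventually_eq_renFormula hPpos hfull hlog hreg hev hG he₀
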